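/- Let $d\ge 2$ and $\tau\in(1,d)$. Let $\phi:(0,\infty)\to\mathbb R$ be injective and differentiable with $\phi'(\rho)\neq 0$ for almost every $\rho>0$, let $\psi:(0,\infty)\to\mathbb R$ be measurable with $\psi(\rho)^2=|\phi'(\rho)|\rho^{1-\tau}$ for all $\rho>0$, and let $\theta:[0,\infty)\to\mathbb C$ be any function. For $k\in\mathbb N_0=\{0,1,2,\dots\}$ let $\mu_k=k(k+d-2)$, \[ \beta_k=\pi 2^{2-\tau}\,\frac{\Gamma(\tau-1)\,\Gamma(k+\frac{d-\tau}{2})}{\Gamma(\frac{\tau}{2})^2\,\Gamma(k+\frac{d+\tau}{2}-1)}\,|\theta(\mu_k)|^2, \] \[ \mathbf k=\{k\in\mathbb N_0:\inf_{\ell}\beta_\ell=\beta_k\},\qquad \mathbf K=\{k\in\mathbb N_0:\sup_{\ell}\beta_\ell=\beta_k\}, \] and let $\mathfrak H_k\subset L^2(\mathbb R^d)$ be the space of all linear combinations of functions $\xi\mapsto P(\xi)f_0(|\xi|)|\xi|^{-d/2-k+1/2}$, where $P$ is a homogeneous harmonic polynomial of degree $k$ and $f_0\in L^2(0,\infty)$.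 Let $H_k$ be the orthogonal projection of $L^2(\mathbb R^d)$ onto $\mathfrak H_k$, let $\theta(-\Lambda)=\sum_k\theta(\mu_k)H_k$, and let $m(|\nabla|)$ be the Fourier multiplier operator with symbol $m(|\xi|)$. For $S\subset\mathbb N_0$, $\bigoplus_{k\in S}\mathfrak H_k$ denotes the closed (Hilbert) direct sum. For a solution $u\in C(\mathbb R;L^2(\mathbb R^d))$ of $i\partial_tu+\phi(|\nabla|)u=0$ put \[ I(u)=\int_{\mathbb R}\int_{\mathbb R^d}|\psi(|\nabla|)\,\theta(-\Lambda)\,u(t,x)|^2\,\frac{\mathrm dx\,\mathrm dt}{|x|^\tau}\in[0,\infty]. \] Here the operator $u(0)\mapsto\psi(|\nabla|)\theta(-\Lambda)u$ from $L^2(\mathbb R^d)$ to $L^2(\mathbb R\times\mathbb R^d,|x|^{-\tau}\mathrm dx\,\mathrm dt)$ is extended from the data for which $\theta(-\Lambda)u(t)$ and $\psi(|\nabla|)\theta(-\Lambda)u(t)$ belong to $L^2(\mathbb R^d)$ by taking the closure of its graph, and $I(u)=\infty$ if $u(0)$ is not in the domain of the closed operator. Then $I(u)$ is well defined (the closure of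 the graph determines its value uniquely), and for every such solution $u$ \[ \inf_{k\in\mathbb N_0}\beta_k\,\|u(0)\|_{L^2(\mathbb R^d)}^2\le I(u)\le\sup_{k\in\mathbb N_0}\beta_k\,\|u(0)\|_{L^2(\mathbb R^d)}^2 \] (where $\sup_k\beta_k$ may be $\infty$, with $\infty\cdot0=0$), and both constants are optimal. Call nonzero initial data $u(0)$ an extremiser for one of the two bounds if both sides of that bound are finite and equal. Then nonzero $u(0)$ is an extremiser for the lower bound if and only if $u(0)\in\bigoplus_{k\in\mathbf k}\mathfrak H_k$, and an extremiser for the upper bound if and only if $u(0)\in\bigoplus_{k\in\mathbf K}\mathfrak H_k$. -/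

import Mathlib

namespace AngularSmoothing

open MeasureTheory
open scoped FourierTransform ENNReal

noncomputable section

/-- Euclidean space `ℝ^d`. -/
abbrev Space (d : ℕ) : Type := EuclideanSpace ℝ (Fin d)

/-- The Hilbert space `L²(ℝ^d)` of complex-valued functions. -/
abbrev L2 (d : ℕ) : Type := Lp ℂ 2 (volume : Measure (Space d))

/-- `h = m(|∇|) f` in `L²(ℝ^d)`. With the normalisation `e^{-2πi x·ξ}` of the Fourier transform
used by Mathlib, the operator `|∇|` is multiplication by `2π|ξ|` on the Fourier side. -/
def IsRadialMultiplier {d : ℕ} (m : ℝ → ℝ) (f h : L2 d) : Prop :=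
  (𝓕 h : L2 d) =ᵐ[volume]
    fun ξ : Space d => ((m (2 * Real.pi * ‖ξ‖) : ℝ) : ℂ) * (𝓕 f : L2 d) ξ

/-- `u ∈ C(ℝ; L²(ℝ^d))` is a (weak) solution of `i ∂ₜu + φ(|∇|)u = 0`: for every `g` in the domain
of the self-adjoint operator `φ(|∇|)`, with `h = φ(|∇|)g`, one has
`d/dt ⟨g, u(t)⟩ = i ⟨h, u(t)⟩` at all times. -/
def IsSolution {d : ℕ} (φ : ℝ → ℝ) (u : ℝ → L2 d) : Prop :=
  Continuous u ∧
    ∀ g h : L2 d, IsRadialMultiplier φ g h → ∀ t : ℝ,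
      HasDerivAt (fun s => inner ℂ g (u s)) (Complex.I * inner ℂ h (u t)) t

/-- `P` is a homogeneous harmonic polynomial of degree `k` on `ℝ^d` (a solid spherical harmonic). -/
def IsSolidHarmonic {d : ℕ} (k : ℕ) (P : MvPolynomial (Fin d) ℂ) : Prop :=
  P.IsHomogeneous k ∧ ∑ i, MvPolynomial.pderiv i (MvPolynomial.pderiv i P) = 0

/-- The space `𝔥_k ⊆ L²(ℝ^d)` of all linear combinations of functions
`ξ ↦ P(ξ) f₀(|ξ|) |ξ|^{-d/2-k+1/2}`, where `P` is a homogeneous harmonic polynomial of degree `k`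
and `f₀ ∈ L²(0,∞)`. -/
def harmonicSpace (d k : ℕ) : Submodule ℂ (L2 d) :=
  Submodule.span ℂ
    {f : L2 d | ∃ (P : MvPolynomial (Fin d) ℂ) (f₀ : ℝ → ℂ),
      IsSolidHarmonic k P ∧ MemLp f₀ 2 (volume.restrict (Set.Ioi (0 : ℝ))) ∧
      (f : Space d → ℂ) =ᵐ[volume] fun ξ =>
        MvPolynomial.eval (fun i => ((ξ i : ℝ) : ℂ)) P * f₀ ‖ξ‖ *
          ((‖ξ‖ ^ (-(d : ℝ) / 2 - (k : ℝ) + 1 / 2) : ℝ) : ℂ)}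

/-- The orthogonal projection `H_k` of `L²(ℝ^d)` onto `𝔥_k`. (The space `𝔥_k` is in fact closed;
its closure is written so that the projection is available without proving this first.) -/
def harmonicProj (d k : ℕ) : L2 d →L[ℂ] L2 d :=
  (harmonicSpace d k).topologicalClosure.starProjection

/-- The Hilbert direct sum `⨁_{k ∈ S} 𝔥_k`, as a closed subspace of `L²(ℝ^d)`. -/
def harmonicSum (d : ℕ) (S : Set ℕ) : Submodule ℂ (L2 d) :=
  (⨆ k ∈ S, harmonicSpace d k).topologicalClosure

/-- The eigenvalue `μ_k = k(k+d-2)` of the Laplace--Beltrami operator `-Λ`. -/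
def sphereEigenvalue (d k : ℕ) : ℝ := (k : ℝ) * ((k : ℝ) + (d : ℝ) - 2)

/-- `h = θ(-Λ) f = ∑_k θ(μ_k) H_k f`, with convergence in `L²(ℝ^d)`. -/
def IsAngularMultiplier {d : ℕ} (θ : ℝ → ℂ) (f h : L2 d) : Prop :=
  HasSum (fun k : ℕ => θ (sphereEigenvalue d k) • harmonicProj d k f) h

/-- The weighted space-time integral `∫_ℝ ∫_{ℝ^d} |F(t,x)|² |x|^{-τ} dx dt`, with value in
`[0,∞]`. -/
def weightedIntegral {d : ℕ} (τ : ℝ) (F : ℝ → Space d → ℂ) : ℝ≥0∞ :=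
  ∫⁻ t : ℝ, ∫⁻ x : Space d, ‖F t x‖ₑ ^ 2 * ENNReal.ofReal (‖x‖ ^ (-τ))

/-- `F(t,x) = ψ(|∇|) θ(-Λ) u(t,x)` where both operators are applied within `L²(ℝ^d)`, that is,
`u(t)` lies in the natural domain of `ψ(|∇|) θ(-Λ)`. -/
def IsRegularField {d : ℕ} (ψ : ℝ → ℝ) (θ : ℝ → ℂ) (u : ℝ → L2 d) (F : ℝ → Space d → ℂ) : Prop :=
  AEStronglyMeasurable (Function.uncurry F) (volume : Measure (ℝ × Space d)) ∧
    ∀ᵐ t : ℝ, ∃ w v : L2 d,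
      IsAngularMultiplier θ (u t) w ∧ IsRadialMultiplier ψ w v ∧ F t =ᵐ[volume] v

/-- `F = ψ(|∇|) θ(-Λ) u` for a solution `u` with arbitrary data in `L²(ℝ^d)`, for which `θ(-Λ)u(t)`
or `ψ(|∇|)θ(-Λ)u(t)` need not belong to `L²(ℝ^d)`. The operator
`u(0) ↦ ψ(|∇|) θ(-Λ) u` from `L²(ℝ^d)` to `L²(ℝ × ℝ^d, |x|^{-τ} dx dt)` is extended from its
natural domain by taking the closure of its graph. -/
def IsSmoothedField {d : ℕ} (τ : ℝ) (φ ψ : ℝ → ℝ) (θ : ℝ → ℂ) (u : ℝ → L2 d)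
    (F : ℝ → Space d → ℂ) : Prop :=
  AEStronglyMeasurable (Function.uncurry F) (volume : Measure (ℝ × Space d)) ∧
    ∀ ε : ℝ, 0 < ε → ∃ (u' : ℝ → L2 d) (F' : ℝ → Space d → ℂ),
      IsSolution φ u' ∧ IsRegularField ψ θ u' F' ∧
      ‖u' 0 - u 0‖ ≤ ε ∧
      weightedIntegral τ (fun t x => F' t x - F t x) ≤ ENNReal.ofReal ε

/-- The quantity `∫_ℝ ∫_{ℝ^d} |ψ(|∇|) θ(-Λ) u(t,x)|² |x|^{-τ} dx dt ∈ [0,∞]`. It is `∞` if `u` is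
outside the domain of the closed operator; otherwise all admissible `F` give the same value, which
is the first assertion of the main theorem. -/
def smoothingEnergy {d : ℕ} (τ : ℝ) (φ ψ : ℝ → ℝ) (θ : ℝ → ℂ) (u : ℝ → L2 d) : ℝ≥0∞ :=
  ⨅ (F : ℝ → Space d → ℂ) (_ : IsSmoothedField τ φ ψ θ u F), weightedIntegral τ F

/-- The constants `β_k`. -/
def beta (d : ℕ) (τ : ℝ) (θ : ℝ → ℂ) (k : ℕ) : ℝ≥0∞ :=
  ENNReal.ofReal
    (Real.pi * (2 : ℝ) ^ (2 - τ) *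
      (Real.Gamma (τ - 1) * Real.Gamma ((k : ℝ) + ((d : ℝ) - τ) / 2) /
        (Real.Gamma (τ / 2) ^ 2 * Real.Gamma ((k : ℝ) + ((d : ℝ) + τ) / 2 - 1))) *
      ‖θ (sphereEigenvalue d k)‖ ^ 2)

/-- The index set where the infimum of the `β_k` is attained. -/
def lowerIndexSet (d : ℕ) (τ : ℝ) (θ : ℝ → ℂ) : Set ℕ :=
  {k | (⨅ l, beta d τ θ l) = beta d τ θ k}

/-- The index set where the supremum of the `β_k` is attained. -/
def upperIndexSet (d : ℕ) (τ : ℝ) (θ : ℝ → ℂ) : Set ℕ :=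
  {k | (⨆ l, beta d τ θ l) = beta d τ θ k}

/-- The data of `u` are an extremiser for the lower bound: they are nonzero, and the two sides of
the lower bound are finite and equal. -/
def IsLowerExtremiser {d : ℕ} (τ : ℝ) (φ ψ : ℝ → ℝ) (θ : ℝ → ℂ) (u : ℝ → L2 d) : Prop :=
  u 0 ≠ 0 ∧ smoothingEnergy τ φ ψ θ u < ∞ ∧
    smoothingEnergy τ φ ψ θ u = (⨅ k, beta d τ θ k) * ‖u 0‖ₑ ^ 2

/-- The data of `u` are an extremiser for the upper bound: they are nonzero, and the two sides of
the upper bound are finite and equal. -/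
def IsUpperExtremiser {d : ℕ} (τ : ℝ) (φ ψ : ℝ → ℝ) (θ : ℝ → ℂ) (u : ℝ → L2 d) : Prop :=
  u 0 ≠ 0 ∧ smoothingEnergy τ φ ψ θ u < ∞ ∧
    smoothingEnergy τ φ ψ θ u = (⨆ k, beta d τ θ k) * ‖u 0‖ₑ ^ 2

end

end AngularSmoothing

/-! Everything follows from the identity I(u) = ∑_k β_k ‖H_k u(0)‖² (`smoothingEnergy_eq`). The two
bounds compare β_k with the infimum and the supremum. Data in a single 𝔥_k show optimality. Equality
forces H_k u(0) = 0 for every k whose β_k is not extremal.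

Consider a wave with spatial Fourier transform e^{itφ(2π|ξ|)} ψ(2π|ξ|) W(ξ), at a fixed point x. The
phase depends only on ρ = |ξ|, so in polar coordinates the wave is an oscillatory integral in ρ. Its
amplitude is ρ^{d-1} ψ(2πρ) times the Fourier extension, at ρx, of W(ρ·) from the unit sphere. Since
φ is injective, y = φ(2πρ) is a change of variables and Plancherel applies in t
(`lintegral_oscillatory_sq`). The resulting Jacobian 1/|φ'| is cancelled by ψ² = |φ'| ρ^{1-τ}.
Scaling in x then leaves (2π)^{1-τ} ∫ ρ^{d-1} `sphereEnergy` τ (W(ρ·)) dρ, from which φ has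
disappeared (`weightedIntegral_waveField`).

The form `sphereEnergy` is diagonal in spherical harmonics. No Bessel functions are needed for this
or for the eigenvalues: since the form does not depend on φ, the Schrödinger equation may be used.
There P(ξ) e^{-π|ξ|²}, with P a solid harmonic, evolves explicitly by the Hecke identity
(`gaussianMoment_solidHarmonic`). The evolution is P(x) times a radial function of x, which gives
Funk–Hecke (`sphereExt_proportional`). Its weighted norm consists of Gamma integrals, which gives
the eigenvalue (`sphereEnergy_solidHarmonic`).

The decomposition of L² into the 𝔥_k rests on the same Gaussians: orthogonality comes from the Hecke
identity and Parseval, completeness from the Fischer decomposition.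

General data are reached by limits. The identity is first proved for finite angular sums localised
in frequency. It extends to regular fields because the constants without θ are bounded by the one
for k = 0 (`weightedNorm_eq_angularNorm`). The closure of the graph is then treated with the lower
semicontinuity of ∑ β_k ‖H_k f‖², as θ may be unbounded, and with the completeness of the weighted
L² space. Weak solutions are identified with e^{itφ} on the Fourier side by `IsSolution.fourier_eq`.
-/

namespace AngularSmoothing

open MeasureTheory
open scoped FourierTransform ENNReal

/-! ### The Fourier transform on L¹ ∩ L² and Plancherel's theorem. -/

section Fourier

variable {E : Type*} [NormedAddCommGroup E] [InnerProductSpace ℝ E] [FiniteDimensional ℝ E]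
  [MeasurableSpace E] [BorelSpace E]

theorem locallyIntegrable_of_continuous_fourier {f : E → ℂ} (hf : Integrable f) :
    LocallyIntegrable (𝓕 f) volume :=
  (VectorFourier.fourierIntegral_continuous Real.continuous_fourierChar
      continuous_inner hf).locallyIntegrable

theorem integral_schwartz_fourier_smul (g : SchwartzMap E ℂ) {f : E → ℂ} (hf : Integrable f) :
    ∫ x, (𝓕 g : SchwartzMap E ℂ) x • f x = ∫ x, g x • 𝓕 f x := by
  have := VectorFourier.integral_fourierIntegral_smul_eq_flip (L := innerₗ E)
    (μ := volume) (ν := volume) Real.continuous_fourierChar continuous_inner g.integrable hf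
  rw [flip_innerₗ] at this
  rw [SchwartzMap.fourier_coe]
  exact this

theorem integral_schwartz_fourierInv_smul (g : SchwartzMap E ℂ) {f : E → ℂ} (hf : Integrable f) :
    ∫ x, (𝓕⁻ g : SchwartzMap E ℂ) x • f x = ∫ x, g x • 𝓕⁻ f x := by
  have h := integral_schwartz_fourier_smul g hf.comp_neg
  calc ∫ x, (𝓕⁻ g : SchwartzMap E ℂ) x • f x
      = ∫ x, (𝓕⁻ g : SchwartzMap E ℂ) (-x) • f (-x) :=
        (integral_neg_eq_self (fun x => (𝓕⁻ g : SchwartzMap E ℂ) x • f x) volume).symm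
    _ = ∫ x, (𝓕 g : SchwartzMap E ℂ) x • f (-x) := by
        simp only [SchwartzMap.fourierInv_coe, SchwartzMap.fourier_coe,
          Real.fourierInv_eq_fourier_neg, neg_neg]
    _ = ∫ x, g x • 𝓕⁻ f x := by
        rw [h]
        simp only [Real.fourierInv_eq_fourier_comp_neg]

/-- An `L²` function is determined by its pairings with Schwartz functions. -/
theorem ae_eq_of_schwartz_pairing {f g : E → ℂ} (hf : LocallyIntegrable f volume)
    (hg : LocallyIntegrable g volume)
    (h : ∀ s : SchwartzMap E ℂ, ∫ x, s x • f x = ∫ x, s x • g x) : f =ᵐ[volume] g := by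
  refine ae_eq_of_integral_contDiff_smul_eq hf hg fun s hs hc => ?_
  have h₁ : HasCompactSupport (Complex.ofRealCLM ∘ s) := hc.comp_left rfl
  have h₂ : ContDiff ℝ (⊤ : ℕ∞) (Complex.ofRealCLM ∘ s) := by fun_prop
  simpa using h (h₁.toSchwartzMap h₂)

theorem schwartz_pairing_fourier (s : SchwartzMap E ℂ) (f : Lp ℂ 2 (volume : Measure E)) :
    ∫ x, s x • (𝓕 f : Lp ℂ 2 (volume : Measure E)) x = ∫ x, (𝓕 s : SchwartzMap E ℂ) x • f x := by
  have := congrArg (fun T => T s) (Lp.fourier_toTemperedDistribution_eq f)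
  simp only [TemperedDistribution.fourier_apply, Lp.toTemperedDistribution_apply] at this
  exact this.symm

theorem schwartz_pairing_fourierInv (s : SchwartzMap E ℂ) (f : Lp ℂ 2 (volume : Measure E)) :
    ∫ x, s x • (𝓕⁻ f : Lp ℂ 2 (volume : Measure E)) x
      = ∫ x, (𝓕⁻ s : SchwartzMap E ℂ) x • f x := by
  have := congrArg (fun T => T s) (Lp.fourierInv_toTemperedDistribution_eq f)
  simp only [TemperedDistribution.fourierInv_apply, Lp.toTemperedDistribution_apply] at this
  exact this.symm

/-- On `L¹ ∩ L²` the `L²` Fourier transform is given by the Fourier integral. -/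
theorem fourier_toLp_ae {f : E → ℂ} (hf : Integrable f) (hf2 : MemLp f 2) :
    (𝓕 (hf2.toLp f) : Lp ℂ 2 (volume : Measure E)) =ᵐ[volume] 𝓕 f := by
  refine ae_eq_of_schwartz_pairing ((Lp.memLp _).locallyIntegrable (by norm_num))
    (locallyIntegrable_of_continuous_fourier hf) fun s => ?_
  rw [schwartz_pairing_fourier, ← integral_schwartz_fourier_smul s hf]
  refine integral_congr_ae ?_
  filter_upwards [hf2.coeFn_toLp] with x hx
  rw [hx]

theorem fourierInv_eq_comp_neg (f : E → ℂ) : 𝓕⁻ f = fun x => 𝓕 f (-x) := by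
  ext x; exact Real.fourierInv_eq_fourier_neg f x

theorem locallyIntegrable_fourierInv {f : E → ℂ} (hf : Integrable f) :
    LocallyIntegrable (𝓕⁻ f) volume := by
  rw [fourierInv_eq_comp_neg]
  exact ((VectorFourier.fourierIntegral_continuous Real.continuous_fourierChar
      continuous_inner hf).comp continuous_neg).locallyIntegrable

/-- On `L¹ ∩ L²` the `L²` inverse Fourier transform is given by the inverse Fourier integral. -/
theorem fourierInv_toLp_ae {f : E → ℂ} (hf : Integrable f) (hf2 : MemLp f 2) :
    (𝓕⁻ (hf2.toLp f) : Lp ℂ 2 (volume : Measure E)) =ᵐ[volume] 𝓕⁻ f := by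
  refine ae_eq_of_schwartz_pairing ((Lp.memLp _).locallyIntegrable (by norm_num))
    (locallyIntegrable_fourierInv hf) fun s => ?_
  rw [schwartz_pairing_fourierInv, ← integral_schwartz_fourierInv_smul s hf]
  refine integral_congr_ae ?_
  filter_upwards [hf2.coeFn_toLp] with x hx
  rw [hx]

theorem enorm_sq_toLp {α : Type*} [MeasurableSpace α] {μ : Measure α} {f : α → ℂ}
    (hf : MemLp f 2 μ) : ‖hf.toLp f‖ₑ ^ 2 = ∫⁻ x, ‖f x‖ₑ ^ 2 ∂μ := by
  rw [Lp.enorm_toLp, eLpNorm_eq_lintegral_rpow_enorm_toReal (by norm_num) (by norm_num)]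
  rw [← ENNReal.rpow_natCast, ← ENNReal.rpow_mul]
  simp

theorem enorm_sq_Lp {α : Type*} [MeasurableSpace α] {μ : Measure α} (f : Lp ℂ 2 μ) :
    ‖f‖ₑ ^ 2 = ∫⁻ x, ‖f x‖ₑ ^ 2 ∂μ := by
  conv_lhs => rw [← Lp.toLp_coeFn f (Lp.memLp f)]
  exact enorm_sq_toLp _

theorem memLp_two_iff {α : Type*} [MeasurableSpace α] {μ : Measure α} {f : α → ℂ}
    (hf : AEStronglyMeasurable f μ) : MemLp f 2 μ ↔ ∫⁻ x, ‖f x‖ₑ ^ 2 ∂μ < ∞ := by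
  rw [MemLp, eLpNorm_lt_top_iff_lintegral_rpow_enorm_lt_top (by norm_num) (by norm_num)]
  simp [hf]

/-- Plancherel's theorem for an integrable function, both sides being possibly infinite. -/
theorem lintegral_fourierInv_sq {f : E → ℂ} (hf : Integrable f) :
    ∫⁻ x, ‖𝓕⁻ f x‖ₑ ^ 2 = ∫⁻ x, ‖f x‖ₑ ^ 2 := by
  have hmeas : AEStronglyMeasurable (𝓕⁻ f) (volume : Measure E) :=
    (locallyIntegrable_fourierInv hf).aestronglyMeasurable
  by_cases h : MemLp f 2 volume
  · rw [← enorm_sq_toLp h]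
    have h1 : ‖(𝓕⁻ (h.toLp f) : Lp ℂ 2 (volume : Measure E))‖ₑ = ‖h.toLp f‖ₑ := by
      rw [enorm_eq_iff_norm_eq]
      exact (Lp.fourierTransformₗᵢ E ℂ).symm.norm_map _
    rw [← h1, enorm_sq_Lp]
    refine lintegral_congr_ae ?_
    filter_upwards [fourierInv_toLp_ae hf h] with x hx
    rw [hx]
  -- If f is not square integrable, neither is its transform: otherwise L² inversion, tested against
  -- Schwartz functions, would return f as an element of L². Both sides are then infinite.
  · by_cases h' : MemLp (𝓕⁻ f) 2 volume
    · refine absurd ?_ h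
      have hae : (𝓕 (h'.toLp (𝓕⁻ f)) : Lp ℂ 2 (volume : Measure E)) =ᵐ[volume] f := by
        refine ae_eq_of_schwartz_pairing ((Lp.memLp _).locallyIntegrable (by norm_num))
          hf.locallyIntegrable fun s => ?_
        rw [schwartz_pairing_fourier]
        have := integral_schwartz_fourierInv_smul (𝓕 s) hf
        rw [FourierTransform.fourierInv_fourier_eq] at this
        rw [this]
        refine integral_congr_ae ?_
        filter_upwards [h'.coeFn_toLp] with x hx
        rw [hx]
      exact (memLp_congr_ae hae).1 (Lp.memLp _)
    · rw [memLp_two_iff hf.1, not_lt_top_iff] at h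
      rw [memLp_two_iff hmeas, not_lt_top_iff] at h'
      rw [h, h']

end Fourier

end AngularSmoothing

/-! ### Plancherel in time for an injective phase. -/

namespace AngularSmoothing

open MeasureTheory
open scoped FourierTransform ENNReal

theorem lintegral_comp_smul_of_pos {E : Type*} [NormedAddCommGroup E] [NormedSpace ℝ E]
    [FiniteDimensional ℝ E] [MeasurableSpace E] [BorelSpace E] (μ : Measure E)
    [μ.IsAddHaarMeasure] (f : E → ℝ≥0∞) {r : ℝ} (hr : 0 < r) :
    ∫⁻ x, f (r • x) ∂μ = ENNReal.ofReal (r ^ (-(Module.finrank ℝ E : ℝ))) * ∫⁻ x, f x ∂μ := by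
  have h := (MeasurableEquiv.smul₀ (α := E) r hr.ne').measurableEmbedding.lintegral_map (μ := μ) f
  simp only [MeasurableEquiv.coe_smul₀] at h
  rw [← h, Measure.map_addHaar_smul μ hr.ne', lintegral_smul_measure, abs_of_pos (by positivity),
    Real.rpow_neg hr.le, Real.rpow_natCast, smul_eq_mul]

theorem enorm_div_ofReal (z : ℂ) {r : ℝ} (hr : 0 < r) :
    ‖z / (r : ℂ)‖ₑ = ‖z‖ₑ * ENNReal.ofReal r⁻¹ := by
  rw [div_eq_mul_inv, enorm_mul, ← Complex.ofReal_inv, ← ofReal_norm (((r⁻¹ : ℝ) : ℂ)),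
    Complex.norm_real, Real.norm_of_nonneg (by positivity)]

/-- Plancherel's theorem for oscillatory integrals with an injective phase on the half-line. -/
theorem lintegral_oscillatory_sq {Φ : ℝ → ℝ} (hinj : Set.InjOn Φ (Set.Ioi 0))
    (hdiff : DifferentiableOn ℝ Φ (Set.Ioi 0))
    (hderiv : ∀ᵐ ρ ∂(volume.restrict (Set.Ioi (0 : ℝ))), deriv Φ ρ ≠ 0)
    {a : ℝ → ℂ} (ha : IntegrableOn a (Set.Ioi 0)) :
    ∫⁻ t : ℝ, ‖∫ ρ in Set.Ioi (0 : ℝ), Complex.exp (Complex.I * t * Φ ρ) * a ρ‖ₑ ^ 2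
      = ENNReal.ofReal (2 * Real.pi) *
        ∫⁻ ρ in Set.Ioi (0 : ℝ), ‖a ρ‖ₑ ^ 2 * ENNReal.ofReal (|deriv Φ ρ|⁻¹) := by
  set s := Set.Ioi (0 : ℝ) with hs
  have hsm : MeasurableSet s := measurableSet_Ioi
  have hd : ∀ x ∈ s, HasDerivWithinAt Φ (deriv Φ x) s x := fun x hx =>
    ((hdiff.differentiableAt (Ioi_mem_nhds hx)).hasDerivAt).hasDerivWithinAt
  set E := Φ '' s with hE
  have hEm : MeasurableSet E :=
    measurable_image_of_fderivWithin hsm (fun x hx => (hd x hx).hasFDerivWithinAt) hinj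
  -- The substitution y = Φ(ρ) turns the oscillatory integral into an inverse Fourier integral of b,
  -- extended by zero outside the image E.
  set b : ℝ → ℂ := fun y => a (Function.invFunOn Φ s y) /
    ((|deriv Φ (Function.invFunOn Φ s y)| : ℝ) : ℂ) with hb
  have hbΦ : ∀ ρ ∈ s, b (Φ ρ) = a ρ / ((|deriv Φ ρ| : ℝ) : ℂ) := fun ρ hρ => by
    simp only [hb, hinj.leftInvOn_invFunOn hρ]
  have hbint : IntegrableOn b E := by
    rw [integrableOn_image_iff_integrableOn_abs_deriv_smul hsm hd hinj]
    refine ha.congr ?_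
    filter_upwards [hderiv, ae_restrict_mem hsm] with ρ h1 h2
    rw [hbΦ ρ h2, Complex.real_smul, mul_div_cancel₀]
    exact_mod_cast abs_ne_zero.2 h1
  have hBint : Integrable (E.indicator b) := hbint.integrable_indicator hEm
  -- The dilation by (2π)⁻¹ reconciles e^{ity} with the kernel e^{2πity}; it is the source of the
  -- factor 2π in the result.
  have key : ∀ t : ℝ, ∫ ρ in s, Complex.exp (Complex.I * t * Φ ρ) * a ρ
      = 𝓕⁻ (E.indicator b) ((2 * Real.pi)⁻¹ • t) := by
    intro t
    rw [Real.fourierInv_eq']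
    have h1 : ∀ v : ℝ, Complex.exp (((2 * Real.pi * inner ℝ v ((2 * Real.pi)⁻¹ • t) : ℝ) : ℂ)
        * Complex.I) • E.indicator b v =
        E.indicator (fun v => Complex.exp (Complex.I * t * v) * b v) v := by
      intro v
      by_cases hv : v ∈ E
      · simp only [Set.indicator_of_mem hv, smul_eq_mul]
        congr 2
        have hpi := Real.pi_ne_zero
        have : (2 * Real.pi * inner ℝ v ((2 * Real.pi)⁻¹ * t) : ℝ) = v * t := by
          simp
          field_simp
        rw [this]; push_cast; ring
      · simp [Set.indicator_of_notMem hv]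
    simp_rw [h1]
    rw [integral_indicator hEm, integral_image_eq_integral_abs_deriv_smul hsm hd hinj]
    refine integral_congr_ae ?_
    filter_upwards [hderiv, ae_restrict_mem hsm] with ρ h1 h2
    rw [hbΦ ρ h2, Complex.real_smul]
    have : ((|deriv Φ ρ| : ℝ) : ℂ) ≠ 0 := by exact_mod_cast abs_ne_zero.2 h1
    field_simp
  simp_rw [key]
  rw [lintegral_comp_smul_of_pos volume (fun t => ‖𝓕⁻ (E.indicator b) t‖ₑ ^ 2)
    (by positivity : 0 < (2 * Real.pi)⁻¹), lintegral_fourierInv_sq hBint]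
  congr 1
  · congr 1
    simp [Real.rpow_neg_one]
  · have : ∀ x, ‖E.indicator b x‖ₑ ^ 2 = E.indicator (fun x => ‖b x‖ₑ ^ 2) x := by
      intro x
      by_cases hx : x ∈ E <;> simp [hx]
    simp_rw [this]
    -- Going back to ρ, the factor |Φ'|⁻² from |b|² meets the Jacobian |Φ'|, and |Φ'|⁻¹ remains.
    rw [lintegral_indicator hEm, lintegral_image_eq_lintegral_abs_deriv_mul hsm hd hinj]
    refine lintegral_congr_ae ?_
    filter_upwards [hderiv, ae_restrict_mem hsm] with ρ h1 h2
    have hpos : 0 < |deriv Φ ρ| := abs_pos.2 h1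
    rw [hbΦ ρ h2, enorm_div_ofReal _ hpos]
    rw [mul_pow, mul_comm, mul_assoc, ← ENNReal.ofReal_pow (by positivity),
      ← ENNReal.ofReal_mul (by positivity)]
    congr 2
    field_simp

/-! ### Polar coordinates in ℝ^d. -/

section Polar

/-- The surface measure on the unit sphere of `ℝ^d`. -/
noncomputable def sphereMeasure (d : ℕ) : Measure (Metric.sphere (0 : Space d) 1) :=
  (volume : Measure (Space d)).toSphere

instance (d : ℕ) : IsFiniteMeasure (sphereMeasure d) := by
  unfold sphereMeasure; infer_instance

/-- The measure `r^{d-1} dr` on `(0,∞)`. -/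
noncomputable def radialMeasure (d : ℕ) : Measure ℝ :=
  (volume.restrict (Set.Ioi 0)).withDensity fun r => ENNReal.ofReal (r ^ (d - 1))

theorem map_volumeIoiPow (d : ℕ) :
    (Measure.volumeIoiPow (d - 1)).map (Subtype.val : Set.Ioi (0 : ℝ) → ℝ) = radialMeasure d := by
  ext s hs
  rw [Measure.map_apply measurable_subtype_coe hs, Measure.volumeIoiPow, radialMeasure,
    withDensity_apply _ (measurable_subtype_coe hs), withDensity_apply _ hs,
    ← lintegral_indicator (measurable_subtype_coe hs), ← lintegral_indicator hs]
  rw [← lintegral_subtype_comap measurableSet_Ioi]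
  rfl

instance (d : ℕ) : SFinite (radialMeasure d) := by
  rw [← map_volumeIoiPow]; infer_instance

/-- Polar coordinates in `ℝ^d`. -/
theorem measurePreserving_polar {d : ℕ} (hd : 2 ≤ d) :
    MeasurePreserving (fun p : Metric.sphere (0 : Space d) 1 × ℝ => p.2 • (p.1 : Space d))
      ((sphereMeasure d).prod (radialMeasure d)) volume := by
  have : Nontrivial (Space d) := by
    have : Nonempty (Fin d) := ⟨⟨0, by omega⟩⟩
    infer_instance
  have h1 := (volume : Measure (Space d)).measurePreserving_homeomorphUnitSphereProd
  rw [finrank_euclideanSpace_fin] at h1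
  have h2 := h1.symm (homeomorphUnitSphereProd (Space d)).toMeasurableEquiv
  have h3 : MeasurePreserving (Subtype.val : ({0}ᶜ : Set (Space d)) → Space d)
      (volume.comap Subtype.val) volume := by
    refine ⟨measurable_subtype_coe, ?_⟩
    rw [map_comap_subtype_coe (measurableSet_singleton _).compl, restrict_compl_singleton]
  have h4 := h3.comp h2
  refine ⟨by fun_prop, ?_⟩
  have h5 : (sphereMeasure d).prod (radialMeasure d) =
      ((sphereMeasure d).prod (Measure.volumeIoiPow (d - 1))).map
        (Prod.map id (Subtype.val : Set.Ioi (0 : ℝ) → ℝ)) := by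
    rw [← Measure.map_prod_map _ _ measurable_id measurable_subtype_coe, Measure.map_id,
      map_volumeIoiPow]
  rw [h5, Measure.map_map (by fun_prop) (by fun_prop)]
  exact h4.map_eq

variable {d : ℕ}

theorem lintegral_radialMeasure (f : ℝ → ℝ≥0∞) :
    ∫⁻ r, f r ∂(radialMeasure d) =
      ∫⁻ r in Set.Ioi (0 : ℝ), ENNReal.ofReal (r ^ (d - 1)) * f r := by
  rw [radialMeasure, lintegral_withDensity_eq_lintegral_mul_non_measurable]
  · rfl
  · fun_prop
  · simp

theorem lintegral_polar (hd : 2 ≤ d) {f : Space d → ℝ≥0∞} (hf : AEMeasurable f) :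
    ∫⁻ x, f x = ∫⁻ r in Set.Ioi (0 : ℝ), ENNReal.ofReal (r ^ (d - 1)) *
      ∫⁻ ω, f (r • (ω : Space d)) ∂(sphereMeasure d) := by
  have hp := measurePreserving_polar hd
  rw [← lintegral_radialMeasure, ← hp.map_eq, lintegral_map' (by rwa [hp.map_eq]) hp.aemeasurable]
  exact lintegral_prod_symm _
    ((hp.map_eq ▸ hf : AEMeasurable f (Measure.map _ _)).comp_aemeasurable hp.aemeasurable)

theorem integrable_radialMeasure_iff {f : ℝ → ℂ} :
    Integrable f (radialMeasure d) ↔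
      IntegrableOn (fun r : ℝ => ((r ^ (d - 1) : ℝ) : ℂ) * f r) (Set.Ioi 0) := by
  rw [radialMeasure, integrable_withDensity_iff_integrable_smul' (by fun_prop) (by simp)]
  refine integrable_congr ?_
  filter_upwards [ae_restrict_mem measurableSet_Ioi] with r hr
  rw [ENNReal.toReal_ofReal (pow_nonneg (le_of_lt hr) _), Complex.real_smul]

theorem integral_radialMeasure (f : ℝ → ℂ) :
    ∫ r, f r ∂(radialMeasure d) =
      ∫ r in Set.Ioi (0 : ℝ), ((r ^ (d - 1) : ℝ) : ℂ) * f r := by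
  rw [radialMeasure, integral_withDensity_eq_integral_toReal_smul (by fun_prop) (by simp)]
  refine integral_congr_ae ?_
  filter_upwards [ae_restrict_mem measurableSet_Ioi] with r hr
  rw [ENNReal.toReal_ofReal (pow_nonneg (le_of_lt hr) _), Complex.real_smul]

theorem integrable_polar (hd : 2 ≤ d) {f : Space d → ℂ} (hf : Integrable f) :
    Integrable (fun p : Metric.sphere (0 : Space d) 1 × ℝ => f (p.2 • (p.1 : Space d)))
      ((sphereMeasure d).prod (radialMeasure d)) :=
  (measurePreserving_polar hd).integrable_comp_of_integrable hf

theorem integrableOn_polar (hd : 2 ≤ d) {f : Space d → ℂ} (hf : Integrable f) :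
    IntegrableOn (fun r : ℝ => ((r ^ (d - 1) : ℝ) : ℂ) *
      ∫ ω, f (r • (ω : Space d)) ∂(sphereMeasure d)) (Set.Ioi 0) :=
  integrable_radialMeasure_iff.1 (integrable_polar hd hf).integral_prod_right

theorem integral_polar (hd : 2 ≤ d) {f : Space d → ℂ} (hf : Integrable f) :
    ∫ x, f x = ∫ r in Set.Ioi (0 : ℝ), ((r ^ (d - 1) : ℝ) : ℂ) *
      ∫ ω, f (r • (ω : Space d)) ∂(sphereMeasure d) := by
  have hp := measurePreserving_polar hd
  rw [← integral_radialMeasure, ← hp.map_eq,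
    integral_map hp.aemeasurable (by rw [hp.map_eq]; exact hf.1)]
  exact integral_prod_symm _ (integrable_polar hd hf)

/-- A null set of radii is the set of norms of a null set of points. -/
theorem quasiMeasurePreserving_norm (hd : 2 ≤ d) {c : ℝ} (hc : 0 < c) :
    Measure.QuasiMeasurePreserving (fun ξ : Space d => c * ‖ξ‖) volume
      (volume.restrict (Set.Ioi 0)) := by
  refine ⟨by fun_prop, Measure.AbsolutelyContinuous.mk fun s hs h0 => ?_⟩
  rw [Measure.map_apply (by fun_prop) hs, ← lintegral_indicator_one (by measurability),
    lintegral_polar hd (Measurable.aemeasurable (measurable_one.indicator (by measurability)))]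
  rw [Measure.restrict_apply hs] at h0
  have h1 : volume ((fun r : ℝ => c * r) ⁻¹' (s ∩ Set.Ioi 0)) = 0 := by
    rw [Real.volume_preimage_mul_left hc.ne', h0, mul_zero]
  rw [lintegral_eq_zero_iff' ?_]
  · filter_upwards [ae_restrict_mem measurableSet_Ioi,
      ae_restrict_of_ae (measure_eq_zero_iff_ae_notMem.1 h1)] with r hr hr'
    have : c * r ∉ s := fun h => hr' ⟨h, mul_pos hc hr⟩
    simp [Set.indicator, norm_smul, abs_of_pos (show (0 : ℝ) < r from hr), this]
  · refine AEMeasurable.mul (by fun_prop) ?_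
    refine Measurable.aemeasurable ?_
    refine Measurable.lintegral_prod_right' (f := fun p : ℝ × Metric.sphere (0 : Space d) 1 =>
      ((fun ξ : Space d => c * ‖ξ‖) ⁻¹' s).indicator 1 (p.1 • (p.2 : Space d))) ?_
    exact (measurable_one.indicator (by measurability)).comp (by fun_prop)

end Polar

end AngularSmoothing

namespace AngularSmoothing

open MeasureTheory
open scoped FourierTransform ENNReal

variable {d : ℕ}

/-! ### Polynomials times Gaussians and their moments. -/

section Polynomials

/-- The value of a complex polynomial at a point of `ℝ^d`. -/
noncomputable def evalAt (P : MvPolynomial (Fin d) ℂ) (x : Space d) : ℂ :=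
  MvPolynomial.eval (fun i => ((x i : ℝ) : ℂ)) P

@[simp] theorem evalAt_add (P Q : MvPolynomial (Fin d) ℂ) (x : Space d) :
    evalAt (P + Q) x = evalAt P x + evalAt Q x := by simp [evalAt]

@[simp] theorem evalAt_mul (P Q : MvPolynomial (Fin d) ℂ) (x : Space d) :
    evalAt (P * Q) x = evalAt P x * evalAt Q x := by simp [evalAt]

@[simp] theorem evalAt_zero (x : Space d) : evalAt (0 : MvPolynomial (Fin d) ℂ) x = 0 := by
  simp [evalAt]

@[simp] theorem evalAt_one (x : Space d) : evalAt (1 : MvPolynomial (Fin d) ℂ) x = 1 := by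
  simp [evalAt]

@[simp] theorem evalAt_C (c : ℂ) (x : Space d) :
    evalAt (MvPolynomial.C c : MvPolynomial (Fin d) ℂ) x = c := by simp [evalAt]

@[simp] theorem evalAt_X (i : Fin d) (x : Space d) :
    evalAt (MvPolynomial.X i) x = ((x i : ℝ) : ℂ) := by simp [evalAt]

@[simp] theorem evalAt_smul (c : ℂ) (P : MvPolynomial (Fin d) ℂ) (x : Space d) :
    evalAt (c • P) x = c * evalAt P x := by simp [evalAt, MvPolynomial.smul_eval]

@[simp] theorem evalAt_pow (P : MvPolynomial (Fin d) ℂ) (n : ℕ) (x : Space d) :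
    evalAt (P ^ n) x = evalAt P x ^ n := by simp [evalAt]

@[simp] theorem evalAt_sum {ι : Type*} (s : Finset ι) (P : ι → MvPolynomial (Fin d) ℂ)
    (x : Space d) : evalAt (∑ i ∈ s, P i) x = ∑ i ∈ s, evalAt (P i) x := by simp [evalAt]

theorem continuous_evalAt (P : MvPolynomial (Fin d) ℂ) : Continuous (evalAt P) := by
  induction P using MvPolynomial.induction_on with
  | C a => exact (continuous_const (y := a)).congr fun x => (evalAt_C a x).symm
  | add p q hp hq => exact (hp.add hq).congr fun x => (evalAt_add p q x).symm
  | mul_X p i hp =>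
    have : Continuous fun x : Space d => evalAt p x * ((x i : ℝ) : ℂ) := by fun_prop
    exact this.congr fun x => by simp

theorem hasLineDerivAt_evalAt (P : MvPolynomial (Fin d) ℂ) (i : Fin d) (x : Space d) :
    HasLineDerivAt ℝ (evalAt P) (evalAt (MvPolynomial.pderiv i P) x) x
      (EuclideanSpace.single i 1) := by
  classical
  unfold HasLineDerivAt
  induction P using MvPolynomial.induction_on with
  | C a => simpa using hasDerivAt_const (0 : ℝ) a
  | add p q hp hq => simpa using hp.fun_add hq
  | mul_X p j hp =>
    have h1 : HasDerivAt (fun t : ℝ => (((x + t • EuclideanSpace.single i (1 : ℝ)) j : ℝ) : ℂ))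
        (evalAt (MvPolynomial.pderiv i (MvPolynomial.X j)) x) 0 := by
      have : evalAt (MvPolynomial.pderiv i (MvPolynomial.X j)) x
          = (((if j = i then 1 else 0 : ℝ)) : ℂ) := by
        rw [MvPolynomial.pderiv_X]
        by_cases h : j = i
        · subst h; simp
        · simp [h]
      rw [this]
      refine HasDerivAt.ofReal_comp ?_
      have h2 : HasDerivAt (fun t : ℝ => x j + t * (if j = i then 1 else 0 : ℝ))
          (1 * (if j = i then 1 else 0 : ℝ)) 0 :=
        ((hasDerivAt_id (0 : ℝ)).mul_const _).const_add _
      simpa [Pi.single_apply] using h2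
    have h3 := hp.mul h1
    simp only [evalAt_mul, evalAt_X, MvPolynomial.pderiv_mul, evalAt_add, zero_smul, add_zero] at h3 ⊢
    exact h3

theorem evalAt_smul_of_isHomogeneous {P : MvPolynomial (Fin d) ℂ} {k : ℕ} (hP : P.IsHomogeneous k)
    (r : ℝ) (x : Space d) : evalAt P (r • x) = (r : ℂ) ^ k * evalAt P x := by
  unfold evalAt
  rw [MvPolynomial.eval_eq', MvPolynomial.eval_eq', Finset.mul_sum]
  refine Finset.sum_congr rfl fun m hm => ?_
  have hdeg : ∑ i, m i = k := by
    have := hP (MvPolynomial.mem_support_iff.1 hm)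
    rw [Finsupp.weight_apply, Finsupp.sum_fintype _ _ (by simp)] at this
    simpa using this
  simp only [PiLp.smul_apply, smul_eq_mul, Complex.ofReal_mul, mul_pow, Finset.prod_mul_distrib]
  rw [Finset.prod_pow_eq_pow_sum, hdeg]
  ring

theorem exists_evalAt_bound (P : MvPolynomial (Fin d) ℂ) :
    ∃ C : ℝ, 0 ≤ C ∧ ∃ n : ℕ, ∀ x, ‖evalAt P x‖ ≤ C * (1 + ‖x‖) ^ n := by
  induction P using MvPolynomial.induction_on with
  | C a => exact ⟨‖a‖, norm_nonneg _, 0, by simp⟩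
  | add p q hp hq =>
    obtain ⟨C, hC, n, hn⟩ := hp
    obtain ⟨D, hD, m, hm⟩ := hq
    refine ⟨C + D, by positivity, n + m, fun x => ?_⟩
    have h1 : (1 : ℝ) ≤ 1 + ‖x‖ := by simp
    rw [evalAt_add, add_mul]
    refine (norm_add_le _ _).trans (add_le_add ((hn x).trans ?_) ((hm x).trans ?_))
    · gcongr; omega
    · gcongr; omega
  | mul_X p i hp =>
    obtain ⟨C, hC, n, hn⟩ := hp
    refine ⟨C, hC, n + 1, fun x => ?_⟩
    rw [evalAt_mul, evalAt_X, norm_mul, pow_succ, ← mul_assoc, Complex.norm_real]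
    have : ‖x i‖ ≤ 1 + ‖x‖ := (PiLp.norm_apply_le x i).trans (by linarith)
    gcongr
    exact hn x

/-- One half of the Gaussian decay absorbs the polynomial, by (1+r)^n ≤ n! e^{1+r}, and the
exponential, by completing the square. The other half is kept for integrability. -/
theorem exists_pow_mul_exp_bound {β : ℝ} (hβ : 0 < β) {C : ℝ} (hC : 0 ≤ C) (γ : ℝ) (n : ℕ) :
    ∃ K : ℝ, 0 ≤ K ∧ ∀ r : ℝ, 0 ≤ r →
      C * (1 + r) ^ n * Real.exp (γ * r - β * r ^ 2) ≤ K * Real.exp (-(β / 2) * r ^ 2) := by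
  refine ⟨C * (n.factorial * Real.exp (1 + (γ + 1) ^ 2 / (2 * β))), by positivity, fun r hr => ?_⟩
  have h1 : (1 + r) ^ n ≤ n.factorial * Real.exp (1 + r) := by
    have := Real.pow_div_factorial_le_exp (1 + r) (by positivity) n
    rwa [div_le_iff₀' (by positivity)] at this
  have h2 : Real.exp (1 + r) * Real.exp (γ * r - β * r ^ 2) ≤
      Real.exp (1 + (γ + 1) ^ 2 / (2 * β)) * Real.exp (-(β / 2) * r ^ 2) := by
    rw [← Real.exp_add, ← Real.exp_add, Real.exp_le_exp]
    have : (γ + 1) ^ 2 / (2 * β) - (γ + 1) * r + β / 2 * r ^ 2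
        = (γ + 1 - β * r) ^ 2 / (2 * β) := by field_simp; ring
    have h3 : 0 ≤ (γ + 1 - β * r) ^ 2 / (2 * β) := by positivity
    linarith
  calc C * (1 + r) ^ n * Real.exp (γ * r - β * r ^ 2)
      ≤ C * (n.factorial * Real.exp (1 + r)) * Real.exp (γ * r - β * r ^ 2) := by gcongr
    _ = C * n.factorial * (Real.exp (1 + r) * Real.exp (γ * r - β * r ^ 2)) := by ring
    _ ≤ C * n.factorial *
        (Real.exp (1 + (γ + 1) ^ 2 / (2 * β)) * Real.exp (-(β / 2) * r ^ 2)) := by gcongr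
    _ = _ := by ring

/-- The Gaussian with complex parameter `b` and linear term `c ⟨w, v⟩`. -/
noncomputable def gaussianWave (b c : ℂ) (w v : Space d) : ℂ :=
  Complex.exp (-b * ‖v‖ ^ 2 + c * ((inner ℝ w v : ℝ) : ℂ))

theorem norm_gaussianWave_le (b c : ℂ) (w v : Space d) :
    ‖gaussianWave b c w v‖ ≤ Real.exp (‖c‖ * ‖w‖ * ‖v‖ - b.re * ‖v‖ ^ 2) := by
  rw [gaussianWave, Complex.norm_exp, Real.exp_le_exp]
  have h1 : (-b * (‖v‖ : ℂ) ^ 2 + c * ((inner ℝ w v : ℝ) : ℂ)).re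
      = -b.re * ‖v‖ ^ 2 + c.re * inner ℝ w v := by
    rw [← Complex.ofReal_pow, Complex.add_re, Complex.re_mul_ofReal, Complex.re_mul_ofReal]; simp
  rw [h1]
  have h2 : c.re * inner ℝ w v ≤ ‖c‖ * (‖w‖ * ‖v‖) :=
    calc c.re * inner ℝ w v ≤ |c.re * inner ℝ w v| := le_abs_self _
      _ = |c.re| * |inner ℝ w v| := abs_mul _ _
      _ ≤ ‖c‖ * (‖w‖ * ‖v‖) :=
        mul_le_mul (Complex.abs_re_le_norm c) (abs_real_inner_le_norm w v) (abs_nonneg _)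
          (norm_nonneg _)
  linarith

theorem continuous_gaussianWave (b c : ℂ) (w : Space d) :
    Continuous (gaussianWave b c w) := by
  unfold gaussianWave; fun_prop

theorem exists_evalAt_mul_gaussianWave_bound (P : MvPolynomial (Fin d) ℂ) {b : ℂ} (hb : 0 < b.re)
    (c : ℂ) (w : Space d) : ∃ K : ℝ, 0 ≤ K ∧ ∀ v,
      ‖evalAt P v * gaussianWave b c w v‖ ≤ K * Real.exp (-(b.re / 2) * ‖v‖ ^ 2) := by
  obtain ⟨C, hC, n, hn⟩ := exists_evalAt_bound P
  obtain ⟨K, hK, h⟩ := exists_pow_mul_exp_bound hb hC (‖c‖ * ‖w‖) n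
  refine ⟨K, hK, fun v => ?_⟩
  rw [norm_mul]
  exact (mul_le_mul (hn v) (norm_gaussianWave_le b c w v) (norm_nonneg _) (by positivity)).trans
    (h _ (norm_nonneg v))

theorem integrable_exp_neg_mul_norm_sq {β : ℝ} (hβ : 0 < β) :
    Integrable (fun v : Space d => Real.exp (-β * ‖v‖ ^ 2)) := by
  have h := (GaussianFourier.integrable_cexp_neg_mul_sq_norm_add (V := Space d)
    (b := (β : ℂ)) (by simpa using hβ) 0 0).norm
  refine h.congr (Filter.Eventually.of_forall fun v => ?_)
  simp only [zero_mul, add_zero]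
  rw [← Complex.ofReal_neg, ← Complex.ofReal_pow, ← Complex.ofReal_mul, Complex.norm_exp_ofReal]

theorem integrable_evalAt_mul_gaussianWave (P : MvPolynomial (Fin d) ℂ) {b : ℂ} (hb : 0 < b.re)
    (c : ℂ) (w : Space d) : Integrable fun v => evalAt P v * gaussianWave b c w v := by
  obtain ⟨K, hK, h⟩ := exists_evalAt_mul_gaussianWave_bound P hb c w
  refine Integrable.mono' ((integrable_exp_neg_mul_norm_sq (half_pos hb)).const_mul K) ?_
    (Filter.Eventually.of_forall h)
  exact ((continuous_evalAt P).mul (continuous_gaussianWave b c w)).aestronglyMeasurable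

theorem memLp_evalAt_mul_gaussianWave (P : MvPolynomial (Fin d) ℂ) {b : ℂ} (hb : 0 < b.re)
    (c : ℂ) (w : Space d) : MemLp (fun v => evalAt P v * gaussianWave b c w v) 2 volume := by
  obtain ⟨K, hK, h⟩ := exists_evalAt_mul_gaussianWave_bound P hb c w
  have hm : AEStronglyMeasurable (fun v => evalAt P v * gaussianWave b c w v) volume :=
    ((continuous_evalAt P).mul (continuous_gaussianWave b c w)).aestronglyMeasurable
  rw [← integrable_norm_rpow_iff hm (by norm_num) (by norm_num)]
  refine Integrable.mono' ((integrable_exp_neg_mul_norm_sq hb).const_mul (K ^ 2)) ?_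
    (Filter.Eventually.of_forall fun v => ?_)
  · exact (hm.norm.aemeasurable.pow_const _).aestronglyMeasurable
  · simp only [ENNReal.toReal_ofNat, Real.rpow_ofNat, norm_pow, norm_norm]
    refine (pow_le_pow_left₀ (norm_nonneg _) (h v) 2).trans (le_of_eq ?_)
    rw [mul_pow, ← Real.exp_nat_mul]
    congr 2
    push_cast; ring

theorem hasLineDerivAt_gaussianWave (b c : ℂ) (w v : Space d) (i : Fin d) :
    HasLineDerivAt ℝ (gaussianWave b c w)
      ((-(2 * b) * (v i : ℂ) + c * (w i : ℂ)) * gaussianWave b c w v) v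
      (EuclideanSpace.single i 1) := by
  unfold HasLineDerivAt
  have h1 : ∀ t : ℝ, gaussianWave b c w (v + t • EuclideanSpace.single i 1)
      = Complex.exp (-b * (((‖v‖ ^ 2 + 2 * (v i) * t + t ^ 2 : ℝ)) : ℂ)
        + c * ((inner ℝ w v + (w i) * t : ℝ) : ℂ)) := by
    intro t
    have h2 : ‖v + t • EuclideanSpace.single i (1 : ℝ)‖ ^ 2 = ‖v‖ ^ 2 + 2 * (v i) * t + t ^ 2 := by
      rw [norm_add_sq_real, inner_smul_right, EuclideanSpace.inner_single_right, norm_smul]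
      simp; ring
    rw [gaussianWave, ← Complex.ofReal_pow, h2, inner_add_right, inner_smul_right,
      EuclideanSpace.inner_single_right]
    simp [mul_comm]
  simp_rw [h1]
  have e1 : HasDerivAt (fun t : ℝ => ‖v‖ ^ 2 + 2 * (v i) * t + t ^ 2)
      (2 * v i * 1 + 2 * (0 : ℝ) ^ (2 - 1) * 1) 0 := by
    have := (((hasDerivAt_id (0 : ℝ)).const_mul (2 * v i)).const_add (‖v‖ ^ 2)).fun_add
      ((hasDerivAt_id' (0 : ℝ)).fun_pow 2)
    simpa using this
  have e2 : HasDerivAt (fun t : ℝ => (inner ℝ w v : ℝ) + (w i) * t) (w i * 1) 0 :=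
    ((hasDerivAt_id (0 : ℝ)).const_mul (w i)).const_add _
  have e3 := ((e1.ofReal_comp.const_mul (-b)).add (e2.ofReal_comp.const_mul c)).cexp
  refine e3.congr_deriv ?_
  simp [gaussianWave]
  ring

/-- The Gaussian moment `∫ P(v) e^{-b|v|² + c⟨w,v⟩} dv`. -/
noncomputable def gaussianMoment (b c : ℂ) (w : Space d) (P : MvPolynomial (Fin d) ℂ) : ℂ :=
  ∫ v, evalAt P v * gaussianWave b c w v

theorem gaussianMoment_smul (b c : ℂ) (w : Space d) (a : ℂ) (P : MvPolynomial (Fin d) ℂ) :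
    gaussianMoment b c w (a • P) = a * gaussianMoment b c w P := by
  unfold gaussianMoment
  rw [← integral_const_mul]
  simp [mul_assoc]

theorem gaussianMoment_sum {b : ℂ} (hb : 0 < b.re) (c : ℂ) (w : Space d) {ι : Type*}
    (s : Finset ι) (P : ι → MvPolynomial (Fin d) ℂ) :
    gaussianMoment b c w (∑ i ∈ s, P i) = ∑ i ∈ s, gaussianMoment b c w (P i) := by
  unfold gaussianMoment
  rw [← integral_finsetSum _ fun i _ => integrable_evalAt_mul_gaussianWave (P i) hb c w]
  simp [Finset.sum_mul]

/-- Integration by parts in the i-th direction: differentiating the wave brings down the factor -2b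
v_i + c w_i. -/
theorem gaussianMoment_X_mul {b : ℂ} (hb : 0 < b.re) (c : ℂ) (w : Space d)
    (P : MvPolynomial (Fin d) ℂ) (i : Fin d) :
    2 * b * gaussianMoment b c w (MvPolynomial.X i * P) =
      gaussianMoment b c w (MvPolynomial.pderiv i P) + c * (w i) * gaussianMoment b c w P := by
  have hP := integrable_evalAt_mul_gaussianWave P hb c w
  have hX := integrable_evalAt_mul_gaussianWave (MvPolynomial.X i * P) hb c w
  have hD := integrable_evalAt_mul_gaussianWave (MvPolynomial.pderiv i P) hb c w
  have e : ∀ v : Space d, evalAt P v * ((-(2 * b) * (v i : ℂ) + c * (w i : ℂ)) *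
      gaussianWave b c w v) = -(2 * b) * (evalAt (MvPolynomial.X i * P) v * gaussianWave b c w v)
        + c * (w i : ℂ) * (evalAt P v * gaussianWave b c w v) := by
    intro v; rw [evalAt_mul, evalAt_X]; ring
  have key := integral_bilinear_hasLineDerivAt_right_eq_neg_left_of_integrable
    (μ := (volume : Measure (Space d)))
    (B := ContinuousLinearMap.mul ℝ ℂ) (f := evalAt P) (f' := evalAt (MvPolynomial.pderiv i P))
    (g := gaussianWave b c w)
    (g' := fun v => (-(2 * b) * (v i : ℂ) + c * (w i : ℂ)) * gaussianWave b c w v)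
    (v := EuclideanSpace.single i 1) hD
    (by
      simp only [ContinuousLinearMap.mul_apply']
      simp_rw [e]
      exact (hX.const_mul _).add (hP.const_mul _)) hP
    (fun x _ => hasLineDerivAt_evalAt P i x) (fun x _ => hasLineDerivAt_gaussianWave b c w x i)
  simp only [ContinuousLinearMap.mul_apply'] at key
  simp_rw [e] at key
  rw [integral_add (hX.const_mul _) (hP.const_mul _), integral_const_mul, integral_const_mul] at key
  unfold gaussianMoment
  linear_combination -key

end Polynomials

/-! ### The Hecke identity. -/

section Hecke

/-- The commutator of two derivations is a derivation, and this one vanishes on the variables. -/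
theorem pderiv_pderiv_comm (i j : Fin d) (P : MvPolynomial (Fin d) ℂ) :
    MvPolynomial.pderiv i (MvPolynomial.pderiv j P) =
      MvPolynomial.pderiv j (MvPolynomial.pderiv i P) := by
  classical
  have h : ⁅MvPolynomial.pderiv (R := ℂ) i, MvPolynomial.pderiv (R := ℂ) j⁆ = 0 := by
    refine MvPolynomial.derivation_ext fun l => ?_
    rw [Derivation.commutator_apply, MvPolynomial.pderiv_X, MvPolynomial.pderiv_X]
    simp only [Pi.single_apply]
    split_ifs <;> simp
  have := congrArg (fun D => D P) h
  rw [Derivation.commutator_apply] at this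
  exact sub_eq_zero.1 this

theorem IsSolidHarmonic.pderiv {k : ℕ} {P : MvPolynomial (Fin d) ℂ}
    (hP : IsSolidHarmonic (k + 1) P) (i : Fin d) :
    IsSolidHarmonic k (MvPolynomial.pderiv i P) := by
  refine ⟨by simpa using hP.1.pderiv (i := i), ?_⟩
  have h := congrArg (MvPolynomial.pderiv i) hP.2
  rw [map_sum, map_zero] at h
  rw [← h]
  refine Finset.sum_congr rfl fun j _ => ?_
  rw [pderiv_pderiv_comm i j (MvPolynomial.pderiv j P), pderiv_pderiv_comm i j P]

/-- The Hecke identity: Gaussian moments of solid harmonics. -/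
theorem gaussianMoment_solidHarmonic {b : ℂ} (hb : 0 < b.re) (c : ℂ) (w : Space d) {k : ℕ}
    {P : MvPolynomial (Fin d) ℂ} (hP : IsSolidHarmonic k P) :
    gaussianMoment b c w P = (c / (2 * b)) ^ k * evalAt P w *
      (((Real.pi : ℂ) / b) ^ ((d : ℂ) / 2) * Complex.exp (c ^ 2 * ‖w‖ ^ 2 / (4 * b))) := by
  have hb0 : b ≠ 0 := by rintro rfl; simp at hb
  induction k generalizing P with
  | zero =>
    obtain ⟨a, rfl⟩ : ∃ a, P = MvPolynomial.C a :=
      ⟨_, (MvPolynomial.totalDegree_eq_zero_iff_eq_C).1 (Nat.le_zero.1 hP.1.totalDegree_le)⟩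
    unfold gaussianMoment gaussianWave
    simp only [evalAt_C, pow_zero, one_mul]
    rw [integral_const_mul, GaussianFourier.integral_cexp_neg_mul_sq_norm_add hb c w,
      finrank_euclideanSpace_fin]
  | succ k ih =>
    -- Euler's identity reduces the moment of P to moments of X_i ∂_i P, to which integration by
    -- parts applies.
    have h1 : ((k + 1 : ℕ) : ℂ) • P = ∑ i, MvPolynomial.X i * MvPolynomial.pderiv i P := by
      rw [hP.1.sum_X_mul_pderiv, Nat.cast_smul_eq_nsmul]
    have h2 := congrArg (gaussianMoment b c w) h1
    rw [gaussianMoment_smul, gaussianMoment_sum hb] at h2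
    -- The terms with ∂_i ∂_i P add up to the Laplacian of P and vanish. Only first derivatives are
    -- left; they are solid harmonics of degree k, covered by the induction hypothesis.
    have h3 : ∑ i, 2 * b * gaussianMoment b c w (MvPolynomial.X i * MvPolynomial.pderiv i P)
        = c * (∑ i, (w i : ℂ) * gaussianMoment b c w (MvPolynomial.pderiv i P)) := by
      simp_rw [gaussianMoment_X_mul hb c w]
      rw [Finset.sum_add_distrib, ← gaussianMoment_sum hb, hP.2, Finset.mul_sum]
      have : gaussianMoment b c w (0 : MvPolynomial (Fin d) ℂ) = 0 := by simp [gaussianMoment]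
      rw [this, zero_add]
      exact Finset.sum_congr rfl fun i _ => by ring
    simp_rw [fun i => ih (hP.pderiv i)] at h3
    have h4 : ((k + 1 : ℕ) : ℂ) * evalAt P w = ∑ i, (w i : ℂ) * evalAt (MvPolynomial.pderiv i P) w := by
      have := congrArg (fun Q => evalAt Q w) h1
      simpa using this
    set G := ((Real.pi : ℂ) / b) ^ ((d : ℂ) / 2) * Complex.exp (c ^ 2 * ‖w‖ ^ 2 / (4 * b))
    have h5 : ∑ i, (w i : ℂ) * ((c / (2 * b)) ^ k * evalAt (MvPolynomial.pderiv i P) w * G)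
        = (c / (2 * b)) ^ k * G * (((k + 1 : ℕ) : ℂ) * evalAt P w) := by
      rw [h4, Finset.mul_sum]
      exact Finset.sum_congr rfl fun i _ => by ring
    rw [h5, ← Finset.mul_sum, ← h2] at h3
    have hk : ((k + 1 : ℕ) : ℂ) ≠ 0 := by exact_mod_cast Nat.succ_ne_zero k
    have h6 : ((k + 1 : ℕ) : ℂ) * (2 * b) * gaussianMoment b c w P
        = ((k + 1 : ℕ) : ℂ) * (2 * b) * ((c / (2 * b)) ^ (k + 1) * evalAt P w * G) := by
      have h7 : 2 * b * (c / (2 * b)) = c := by field_simp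
      rw [pow_succ]
      linear_combination h3 - ((k + 1 : ℕ) : ℂ) * (c / (2 * b)) ^ k * evalAt P w * G * h7
    exact mul_left_cancel₀ (mul_ne_zero hk (mul_ne_zero two_ne_zero hb0)) h6

end Hecke

end AngularSmoothing

namespace AngularSmoothing

open MeasureTheory
open scoped FourierTransform ENNReal

/-! ### Orthogonal sums of closed subspaces. -/

section HilbertSum

variable {H : Type*} [NormedAddCommGroup H] [InnerProductSpace ℂ H] {V : ℕ → Submodule ℂ H}

theorem inner_eq_zero_of_mem_closure (hV : ∀ j k, j ≠ k → V j ⟂ V k) {j k : ℕ} (hjk : j ≠ k)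
    {x y : H} (hx : x ∈ (V j).topologicalClosure) (hy : y ∈ (V k).topologicalClosure) :
    inner ℂ x y = 0 := by
  have h1 : V k ≤ (V j)ᗮ := (hV k j hjk.symm)
  have h2 : (V k).topologicalClosure ≤ (V j)ᗮ :=
    Submodule.topologicalClosure_minimal _ h1 (Submodule.isClosed_orthogonal _)
  have h3 : V j ≤ (V k).topologicalClosureᗮ := fun x hx => by
    rw [Submodule.mem_orthogonal']
    intro y hy
    exact (Submodule.mem_orthogonal _ _).1 (h2 hy) x hx
  have h4 : (V j).topologicalClosure ≤ (V k).topologicalClosureᗮ :=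
    Submodule.topologicalClosure_minimal _ h3 (Submodule.isClosed_orthogonal _)
  exact (Submodule.mem_orthogonal' _ _).1 (h4 hx) y hy

variable [CompleteSpace H]

/-- The orthogonal projections onto the closures of a family of subspaces. -/
noncomputable abbrev closureProj (V : ℕ → Submodule ℂ H) (k : ℕ) : H →L[ℂ] H :=
  (V k).topologicalClosure.starProjection

theorem closureProj_of_mem {k : ℕ} {x : H} (hx : x ∈ (V k).topologicalClosure) :
    closureProj V k x = x := Submodule.starProjection_eq_self_iff.2 hx

theorem closureProj_of_mem_ne (hV : ∀ j k, j ≠ k → V j ⟂ V k) {j k : ℕ} (hjk : j ≠ k)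
    {x : H} (hx : x ∈ (V j).topologicalClosure) : closureProj V k x = 0 := by
  rw [Submodule.starProjection_apply_eq_zero_iff, Submodule.mem_orthogonal]
  intro y hy
  exact inner_eq_zero_of_mem_closure hV hjk.symm hy hx

theorem closureProj_mem (V : ℕ → Submodule ℂ H) (k : ℕ) (x : H) :
    closureProj V k x ∈ (V k).topologicalClosure := Submodule.starProjection_apply_mem _ _

/-- Orthogonal expansions are unique: the continuous projection annihilates every term but the k-th.
-/
theorem closureProj_eq_of_hasSum (hV : ∀ j k, j ≠ k → V j ⟂ V k) {c : ℕ → H}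
    (hc : ∀ k, c k ∈ (V k).topologicalClosure) {x : H} (hx : HasSum c x) (k : ℕ) :
    closureProj V k x = c k := by
  have h1 := (closureProj V k).hasSum hx
  have h2 : HasSum (fun j => closureProj V k (c j)) (closureProj V k (c k)) :=
    hasSum_single k fun j hj => closureProj_of_mem_ne hV hj (hc j)
  rw [← closureProj_of_mem (hc k)]
  exact h1.unique h2

theorem hasSum_closureProj (hV : ∀ j k, j ≠ k → V j ⟂ V k)
    (htot : ∀ x : H, (∀ k, ∀ y ∈ V k, inner ℂ y x = 0) → x = 0) (x : H) :
    HasSum (fun k => closureProj V k x) x := by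
  have hO : OrthogonalFamily ℂ (fun k => (V k).topologicalClosure)
      fun k => (V k).topologicalClosure.subtypeₗᵢ := by
    intro j k hjk v w
    exact inner_eq_zero_of_mem_closure hV hjk v.2 w.2
  have hS : IsHilbertSum ℂ (fun k => (V k).topologicalClosure)
      fun k => (V k).topologicalClosure.subtypeₗᵢ := by
    refine IsHilbertSum.mkInternal (F := fun k => (V k).topologicalClosure) hO ?_
    rw [top_le_iff, Submodule.topologicalClosure_eq_top_iff, Submodule.eq_bot_iff]
    intro y hy
    refine htot y fun k z hz => ?_
    exact (Submodule.mem_orthogonal _ _).1 hy z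
      (Submodule.mem_iSup_of_mem k (Submodule.le_topologicalClosure _ hz))
  have h1 := hS.hasSum_linearIsometryEquiv_symm (hS.linearIsometryEquiv x)
  rw [LinearIsometryEquiv.symm_apply_apply] at h1
  have h2 := closureProj_eq_of_hasSum hV (fun k => Subtype.prop _) h1
  simp only [h2]
  exact h1

theorem enorm_sq_eq_tsum_closureProj (hV : ∀ j k, j ≠ k → V j ⟂ V k)
    (htot : ∀ x : H, (∀ k, ∀ y ∈ V k, inner ℂ y x = 0) → x = 0) (x : H) :
    ‖x‖ₑ ^ 2 = ∑' k, ‖closureProj V k x‖ₑ ^ 2 := by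
  have h1 := (innerSL ℂ x).hasSum (hasSum_closureProj hV htot x)
  have h2 := Complex.reCLM.hasSum h1
  have h3 : ∀ k, Complex.reCLM (innerSL ℂ x (closureProj V k x)) = ‖closureProj V k x‖ ^ 2 := by
    intro k
    have := (V k).topologicalClosure.re_inner_starProjection_eq_normSq x
    have h5 : ‖closureProj V k x‖ = ‖(V k).topologicalClosure.orthogonalProjectionOnto x‖ := rfl
    rw [h5, ← this, innerSL_apply_apply]
    exact inner_re_symm (𝕜 := ℂ) _ _
  have h4 : Complex.reCLM (innerSL ℂ x x) = ‖x‖ ^ 2 := by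
    rw [innerSL_apply_apply]
    simp [inner_self_eq_norm_sq_to_K, ← Complex.ofReal_pow]
  simp only [h3] at h2
  rw [h4] at h2
  have e : ∀ y : H, ‖y‖ₑ ^ 2 = ENNReal.ofReal (‖y‖ ^ 2) := fun y => by
    rw [ENNReal.ofReal_pow (norm_nonneg _), ofReal_norm]
  simp_rw [e]
  rw [← ENNReal.ofReal_tsum_of_nonneg (fun k => by positivity) h2.summable, h2.tsum_eq]

/-- An operator that preserves every summand carries the expansion of x to an expansion of A x,
which is unique. This serves the Fourier transform and the radial multipliers. -/
theorem closureProj_comm (hV : ∀ j k, j ≠ k → V j ⟂ V k)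
    (htot : ∀ x : H, (∀ k, ∀ y ∈ V k, inner ℂ y x = 0) → x = 0) (A : H →L[ℂ] H)
    (hA : ∀ k, ∀ y ∈ V k, A y ∈ (V k).topologicalClosure) (k : ℕ) (x : H) :
    closureProj V k (A x) = A (closureProj V k x) := by
  have h1 := A.hasSum (hasSum_closureProj hV htot x)
  refine closureProj_eq_of_hasSum hV (c := fun k => A (closureProj V k x)) (fun k => ?_) h1 k
  have h2 : (V k).topologicalClosure ≤
      ((V k).topologicalClosure).comap (A : H →ₗ[ℂ] H) :=
    Submodule.topologicalClosure_minimal _ (fun y hy => hA k y hy)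
      ((V k).isClosed_topologicalClosure.preimage A.continuous)
  exact h2 (closureProj_mem V k x)

/-- A total family of subspaces of mutually orthogonal subspaces is dense in each of them. -/
theorem mem_closure_of_total (hV : ∀ j k, j ≠ k → V j ⟂ V k) {G : ℕ → Submodule ℂ H}
    (hG : ∀ k, G k ≤ V k) (htot : ∀ x : H, (∀ k, ∀ y ∈ G k, inner ℂ y x = 0) → x = 0)
    {k : ℕ} {x : H} (hx : x ∈ V k) : x ∈ (G k).topologicalClosure := by
  have h0 : (G k).topologicalClosure ≤ (V k).topologicalClosure :=
    Submodule.topologicalClosure_mono (hG k)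
  -- The residual is orthogonal to G k by construction, and to each other G j because it lies in the
  -- closure of V k. Totality then makes it zero.
  suffices x - (G k).topologicalClosure.starProjection x = 0 by
    rw [sub_eq_zero.1 this]
    exact Submodule.starProjection_apply_mem _ _
  refine htot _ fun j y hy => ?_
  by_cases hjk : j = k
  · subst hjk
    exact (Submodule.mem_orthogonal _ _).1 (Submodule.sub_starProjection_mem_orthogonal x) y
      (Submodule.le_topologicalClosure _ hy)
  · refine inner_eq_zero_of_mem_closure hV hjk (Submodule.le_topologicalClosure _ (hG j hy))
      (Submodule.sub_mem _ (Submodule.le_topologicalClosure _ hx)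
        (h0 (Submodule.starProjection_apply_mem _ _)))

/-- The kernel of an excluded projection is closed and contains all admitted summands; conversely,
the partial sums of the expansion of x converge to x inside the sum. -/
theorem mem_closure_iSup_iff (hV : ∀ j k, j ≠ k → V j ⟂ V k)
    (htot : ∀ x : H, (∀ k, ∀ y ∈ V k, inner ℂ y x = 0) → x = 0) (S : Set ℕ) (x : H) :
    x ∈ (⨆ k ∈ S, V k).topologicalClosure ↔ ∀ k ∉ S, closureProj V k x = 0 := by
  constructor
  · intro hx k hk
    have h1 : (⨆ k ∈ S, V k).topologicalClosure ≤ (closureProj V k : H →ₗ[ℂ] H).ker := by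
      refine Submodule.topologicalClosure_minimal _ ?_ ?_
      · refine iSup₂_le fun j hj y hy => ?_
        exact closureProj_of_mem_ne hV (j := j) (fun h => hk (by rwa [← h])) (Submodule.le_topologicalClosure _ hy)
      · exact (closureProj V k).isClosed_ker
    exact h1 hx
  · intro h
    refine (Submodule.isClosed_topologicalClosure _).mem_of_tendsto
      (hasSum_closureProj hV htot x) (Filter.Eventually.of_forall fun s => ?_)
    refine Submodule.sum_mem _ fun k _ => ?_
    by_cases hk : k ∈ S
    · exact Submodule.topologicalClosure_mono (le_iSup₂_of_le k hk le_rfl) (closureProj_mem V k x)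
    · rw [h k hk]; exact Submodule.zero_mem _

end HilbertSum
end AngularSmoothing

namespace AngularSmoothing

open MeasureTheory
open scoped FourierTransform ENNReal

variable {d : ℕ}

/-! ### The Fischer decomposition of polynomials. -/

section Fischer

open MvPolynomial

/-- The Laplacian of a polynomial. -/
noncomputable def polyLaplacian (P : MvPolynomial (Fin d) ℂ) : MvPolynomial (Fin d) ℂ :=
  ∑ i, pderiv i (pderiv i P)

/-- The polynomial `|x|²`. -/
noncomputable def normSqPoly (d : ℕ) : MvPolynomial (Fin d) ℂ := ∑ i, X i ^ 2

theorem evalAt_normSqPoly (x : Space d) : evalAt (normSqPoly d) x = ((‖x‖ ^ 2 : ℝ) : ℂ) := by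
  rw [EuclideanSpace.norm_sq_eq]
  simp [normSqPoly]

theorem normSqPoly_isHomogeneous : (normSqPoly d).IsHomogeneous 2 :=
  IsHomogeneous.sum _ _ _ fun i _ => by simpa using (isHomogeneous_X ℂ i).pow 2

theorem polyLaplacian_add (P Q : MvPolynomial (Fin d) ℂ) :
    polyLaplacian (P + Q) = polyLaplacian P + polyLaplacian Q := by
  simp [polyLaplacian, Finset.sum_add_distrib]

theorem polyLaplacian_smul (c : ℂ) (P : MvPolynomial (Fin d) ℂ) :
    polyLaplacian (c • P) = c • polyLaplacian P := by
  simp [polyLaplacian, Finset.smul_sum]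

theorem pderiv_normSqPoly (i : Fin d) : pderiv i (normSqPoly d) = 2 * X i := by
  classical
  rw [normSqPoly, map_sum, Finset.sum_eq_single i]
  · rw [pderiv_pow, pderiv_X_self]; simp
  · intro j _ hj
    rw [pderiv_pow, pderiv_X_of_ne hj]; simp
  · simp

/-- Leibniz' rule gives 2d q from Δ|x|² and a mixed term 4 ∑ x_i ∂_i q, which is 4n q by Euler's
identity. -/
theorem polyLaplacian_normSq_mul {n : ℕ} {q : MvPolynomial (Fin d) ℂ} (hq : q.IsHomogeneous n) :
    polyLaplacian (normSqPoly d * q) =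
      ((2 * d + 4 * n : ℕ) : ℂ) • q + normSqPoly d * polyLaplacian q := by
  have h1 : ∀ i, pderiv i (pderiv i (normSqPoly d * q)) =
      2 * q + 4 * (X i * pderiv i q) + normSqPoly d * pderiv i (pderiv i q) := by
    intro i
    have h2 : pderiv i (2 : MvPolynomial (Fin d) ℂ) = 0 := by
      rw [show (2 : MvPolynomial (Fin d) ℂ) = C 2 from (map_ofNat C 2).symm, pderiv_C]
    simp only [pderiv_mul, map_add, pderiv_normSqPoly, h2, pderiv_X_self]
    ring
  unfold polyLaplacian
  simp_rw [h1]
  rw [Finset.sum_add_distrib, Finset.sum_add_distrib, ← Finset.mul_sum, ← Finset.mul_sum,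
    ← Finset.mul_sum, hq.sum_X_mul_pderiv, Nat.cast_smul_eq_nsmul]
  simp only [Finset.sum_const, Finset.card_univ, Fintype.card_fin, nsmul_eq_mul]
  push_cast
  ring

/-- Only the positivity of the constant is used: it allows division, hence inversion of the
Laplacian on such products. -/
theorem exists_polyLaplacian_pow_mul (hd : 2 ≤ d) {m : ℕ} {h : MvPolynomial (Fin d) ℂ}
    (hh : IsSolidHarmonic m h) (j : ℕ) :
    ∃ c : ℕ, 0 < c ∧
      polyLaplacian (normSqPoly d ^ (j + 1) * h) = (c : ℂ) • (normSqPoly d ^ j * h) := by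
  have hhom : ∀ j, (normSqPoly d ^ j * h).IsHomogeneous (2 * j + m) := fun j =>
    (normSqPoly_isHomogeneous.pow j).mul hh.1
  induction j with
  | zero =>
    refine ⟨2 * d + 4 * m, by omega, ?_⟩
    rw [zero_add, pow_one, polyLaplacian_normSq_mul hh.1, pow_zero, one_mul,
      show polyLaplacian h = 0 from hh.2, mul_zero, add_zero]
  | succ j ih =>
    obtain ⟨c, hc, h1⟩ := ih
    refine ⟨2 * d + 4 * (2 * (j + 1) + m) + c, by omega, ?_⟩
    rw [pow_succ' _ (j + 1), mul_assoc, polyLaplacian_normSq_mul (hhom (j + 1)), h1, mul_smul_comm,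
      ← mul_assoc, ← pow_succ', ← add_smul]
    push_cast
    rfl

/-- Combinations of products `|x|^{2 j} h` of degree `n`, with `h` a solid harmonic. -/
noncomputable def fischerSpan (d n : ℕ) : Submodule ℂ (MvPolynomial (Fin d) ℂ) :=
  Submodule.span ℂ {p | ∃ j m h, 2 * j + m = n ∧ IsSolidHarmonic m h ∧ p = normSqPoly d ^ j * h}

theorem fischerSpan_le (n : ℕ) : fischerSpan d n ≤ homogeneousSubmodule (Fin d) ℂ n := by
  refine Submodule.span_le.2 ?_
  rintro p ⟨j, m, h, rfl, hh, rfl⟩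
  exact (normSqPoly_isHomogeneous.pow j).mul hh.1

/-- The Laplacian lowers the power of |x|² by one up to a nonzero constant, so raising the power and
dividing gives a right inverse. -/
theorem exists_mem_fischerSpan_polyLaplacian (hd : 2 ≤ d) {n : ℕ} {q : MvPolynomial (Fin d) ℂ}
    (hq : q ∈ fischerSpan d n) : ∃ q' ∈ fischerSpan d (n + 2), polyLaplacian q' = q := by
  induction hq using Submodule.span_induction with
  | mem p hp =>
    obtain ⟨j, m, h, rfl, hh, rfl⟩ := hp
    obtain ⟨c, hc, h1⟩ := exists_polyLaplacian_pow_mul hd hh j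
    refine ⟨(c : ℂ)⁻¹ • (normSqPoly d ^ (j + 1) * h), Submodule.smul_mem _ _
      (Submodule.subset_span ⟨j + 1, m, h, by ring, hh, rfl⟩), ?_⟩
    rw [polyLaplacian_smul, h1, smul_smul, inv_mul_cancel₀ (by exact_mod_cast hc.ne'), one_smul]
  | zero => exact ⟨0, Submodule.zero_mem _, by simp [polyLaplacian]⟩
  | add p q _ _ hp hq =>
    obtain ⟨p', hp', rfl⟩ := hp
    obtain ⟨q', hq', rfl⟩ := hq
    exact ⟨p' + q', Submodule.add_mem _ hp' hq', polyLaplacian_add _ _⟩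
  | smul c p _ hp =>
    obtain ⟨p', hp', rfl⟩ := hp
    exact ⟨c • p', Submodule.smul_mem _ _ hp', polyLaplacian_smul _ _⟩

/-- The Fischer decomposition. -/
theorem mem_fischerSpan (hd : 2 ≤ d) {n : ℕ} {p : MvPolynomial (Fin d) ℂ}
    (hp : p.IsHomogeneous n) : p ∈ fischerSpan d n := by
  have hharm : ∀ {n : ℕ} {p : MvPolynomial (Fin d) ℂ}, IsSolidHarmonic n p →
      p ∈ fischerSpan d n := fun {n p} h =>
    Submodule.subset_span ⟨0, n, p, by simp, h, by simp⟩
  induction n using Nat.strong_induction_on generalizing p with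
  | _ n ih =>
    have hlap : (polyLaplacian p).IsHomogeneous (n - 1 - 1) :=
      IsHomogeneous.sum _ _ _ fun i _ => hp.pderiv.pderiv
    obtain hn | ⟨m, rfl⟩ : n < 2 ∨ ∃ m, n = m + 2 := by
      rcases Nat.lt_or_ge n 2 with h | h
      · exact Or.inl h
      · exact Or.inr ⟨n - 2, by omega⟩
    · refine hharm ⟨hp, Finset.sum_eq_zero fun i _ => ?_⟩
      have h1 : (pderiv i p).IsHomogeneous 0 := by
        have := hp.pderiv (i := i)
        rwa [show n - 1 = 0 by omega] at this
      obtain ⟨a, ha⟩ : ∃ a, pderiv i p = C a :=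
        ⟨_, totalDegree_eq_zero_iff_eq_C.1 (Nat.le_zero.1 h1.totalDegree_le)⟩
      rw [ha, pderiv_C]
    -- By induction Δp lies in the span two degrees lower and has a preimage q in the span of degree
    -- m + 2; then p - q is harmonic.
    · obtain ⟨q, hq, hq'⟩ := exists_mem_fischerSpan_polyLaplacian hd (ih m (by omega) hlap)
      have h2 : IsSolidHarmonic (m + 2) (p - q) := by
        refine ⟨hp.sub (fischerSpan_le _ hq), ?_⟩
        have : polyLaplacian (p - q) = 0 := by
          rw [sub_eq_add_neg, ← neg_one_smul ℂ q, polyLaplacian_add, polyLaplacian_smul, hq']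
          simp
        exact this
      have := Submodule.add_mem _ (hharm h2) hq
      rwa [sub_add_cancel] at this

/-- A linear condition that holds for all `|x|^{2 j} h`, `h` harmonic, holds for all polynomials. -/
theorem polynomial_induction_harmonic (hd : 2 ≤ d) (S : Submodule ℂ (MvPolynomial (Fin d) ℂ))
    (hS : ∀ j m h, IsSolidHarmonic m h → normSqPoly d ^ j * h ∈ S)
    (p : MvPolynomial (Fin d) ℂ) : p ∈ S := by
  have h1 : ∀ n, fischerSpan d n ≤ S := fun n => Submodule.span_le.2 (by
    rintro p ⟨j, m, h, -, hh, rfl⟩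
    exact hS j m h hh)
  rw [← sum_homogeneousComponent p]
  exact Submodule.sum_mem _ fun n _ =>
    h1 n (mem_fischerSpan hd (homogeneousComponent_isHomogeneous n p))

end Fischer

end AngularSmoothing

namespace AngularSmoothing

open MeasureTheory
open scoped FourierTransform ENNReal

variable {d : ℕ}

/-! ### Totality of solid harmonics times Gaussians. -/

section Completeness

theorem gaussianWave_zero (b : ℝ) (v : Space d) :
    gaussianWave (b : ℂ) 0 0 v = ((Real.exp (-b * ‖v‖ ^ 2) : ℝ) : ℂ) := by
  simp [gaussianWave]

theorem memLp_exp_neg_mul_norm_sq {β : ℝ} (hβ : 0 < β) :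
    MemLp (fun v : Space d => Real.exp (-β * ‖v‖ ^ 2)) 2 volume := by
  have h := (memLp_evalAt_mul_gaussianWave (d := d) 1 (b := (β : ℂ)) (by simpa using hβ) 0 0).norm
  refine h.ae_eq (Filter.Eventually.of_forall fun v => ?_)
  simp only [evalAt_one, one_mul]
  rw [gaussianWave_zero, Complex.norm_real, Real.norm_of_nonneg (Real.exp_pos _).le]

theorem integrable_exp_neg_mul_norm {β : ℝ} (hβ : 0 < β) (K : ℝ) {F : Space d → ℂ}
    (hF : MemLp F 2 volume) :
    Integrable (fun v => K * Real.exp (-β * ‖v‖ ^ 2) * ‖F v‖) :=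
  ((memLp_exp_neg_mul_norm_sq hβ).const_mul K).integrable_mul hF.norm

/-- The pairing of `P(x) e^{-b|x|²}` with a function `F`. -/
noncomputable def gaussianPairing (F : Space d → ℂ) (b : ℝ) (P : MvPolynomial (Fin d) ℂ) : ℂ :=
  ∫ v, evalAt P v * gaussianWave (b : ℂ) 0 0 v * F v

theorem integrable_gaussianPairing {F : Space d → ℂ} (hF : MemLp F 2 volume) {b : ℝ} (hb : 0 < b)
    (P : MvPolynomial (Fin d) ℂ) :
    Integrable fun v => evalAt P v * gaussianWave (b : ℂ) 0 0 v * F v :=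
  (memLp_evalAt_mul_gaussianWave P (b := (b : ℂ)) (by simpa using hb) 0 0).integrable_mul hF

/-- Differentiation in the Gaussian parameter produces a factor -|x|². The derivative is dominated
uniformly on the half-line beyond b/2 by the Gaussian with parameter b/2. -/
theorem hasDerivAt_gaussianPairing {F : Space d → ℂ} (hF : MemLp F 2 volume) {b : ℝ} (hb : 0 < b)
    (P : MvPolynomial (Fin d) ℂ) :
    HasDerivAt (fun b => gaussianPairing F b P)
      (-gaussianPairing F b (normSqPoly d * P)) b := by
  obtain ⟨K, hK, hbd⟩ := exists_evalAt_mul_gaussianWave_bound (normSqPoly d * P)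
    (b := ((b / 2 : ℝ) : ℂ)) (by simpa using hb) 0 0
  have key := hasDerivAt_integral_of_dominated_loc_of_deriv_le (μ := (volume : Measure (Space d)))
    (F := fun (s : ℝ) v => evalAt P v * gaussianWave (s : ℂ) 0 0 v * F v)
    (F' := fun (s : ℝ) v => -(evalAt (normSqPoly d * P) v * gaussianWave (s : ℂ) 0 0 v * F v))
    (x₀ := b) (s := Set.Ioi (b / 2)) (Ioi_mem_nhds (by linarith))
    (bound := fun v => K * Real.exp (-(b / 4) * ‖v‖ ^ 2) * ‖F v‖) ?_
    (integrable_gaussianPairing hF hb P) ?_ ?_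
    (integrable_exp_neg_mul_norm (by positivity) K hF) ?_
  · have := key.2
    rw [integral_neg] at this
    exact this
  · exact Filter.Eventually.of_forall fun s =>
      (((continuous_evalAt P).mul (continuous_gaussianWave _ _ _)).aestronglyMeasurable).mul hF.1
  · exact (integrable_gaussianPairing hF hb _).1.neg
  · refine Filter.Eventually.of_forall fun v s hs => ?_
    have h1 := hbd v
    rw [norm_mul, gaussianWave_zero, Complex.norm_real, Real.norm_of_nonneg (Real.exp_pos _).le] at h1
    rw [norm_neg, norm_mul, norm_mul, gaussianWave_zero, Complex.norm_real,
      Real.norm_of_nonneg (Real.exp_pos _).le]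
    refine mul_le_mul_of_nonneg_right ?_ (norm_nonneg _)
    have h2 : -(((b / 2 : ℝ) : ℂ).re / 2) = -(b / 4) := by simp; ring
    rw [h2] at h1
    refine le_trans ?_ h1
    have : b / 2 < s := hs
    gcongr
  · refine Filter.Eventually.of_forall fun v s hs => ?_
    have h1 : HasDerivAt (fun s : ℝ => gaussianWave (s : ℂ) 0 0 v)
        (-(((‖v‖ ^ 2 : ℝ) : ℂ)) * gaussianWave (s : ℂ) 0 0 v) s := by
      simp_rw [gaussianWave_zero]
      have h2 : HasDerivAt (fun s : ℝ => Real.exp (-s * ‖v‖ ^ 2))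
          (Real.exp (-s * ‖v‖ ^ 2) * (-1 * ‖v‖ ^ 2)) s :=
        ((hasDerivAt_id s).neg.mul_const _).exp
      refine h2.ofReal_comp.congr_deriv ?_
      push_cast; ring
    refine ((h1.const_mul (evalAt P v)).mul_const (F v)).congr_deriv ?_
    rw [evalAt_mul, evalAt_normSqPoly]
    ring

/-- Since the pairing vanishes for all b > 0, so do its derivatives in b, each of which adds a
factor |x|². This reaches all |x|^{2j} h with h harmonic, and the Fischer decomposition reaches all
polynomials. -/
theorem gaussianPairing_eq_zero (hd : 2 ≤ d) {F : Space d → ℂ} (hF : MemLp F 2 volume)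
    (h : ∀ k P, IsSolidHarmonic k P → ∀ b : ℝ, 0 < b → gaussianPairing F b P = 0)
    {b : ℝ} (hb : 0 < b) (P : MvPolynomial (Fin d) ℂ) : gaussianPairing F b P = 0 := by
  have h1 : ∀ j k P, IsSolidHarmonic k P → ∀ b : ℝ, 0 < b →
      gaussianPairing F b (normSqPoly d ^ j * P) = 0 := by
    intro j k P hP
    induction j with
    | zero => simpa using h k P hP
    | succ j ih =>
      intro b hb
      have h2 := hasDerivAt_gaussianPairing hF hb (normSqPoly d ^ j * P)
      have h3 : HasDerivAt (fun b => gaussianPairing F b (normSqPoly d ^ j * P)) 0 b := by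
        refine (hasDerivAt_const b (0 : ℂ)).congr_of_eventuallyEq ?_
        filter_upwards [Ioi_mem_nhds hb] with s hs using ih s hs
      have h4 := h2.unique h3
      rw [neg_eq_zero, ← mul_assoc, ← pow_succ'] at h4
      exact h4
  let S : Submodule ℂ (MvPolynomial (Fin d) ℂ) :=
    { carrier := {P | gaussianPairing F b P = 0}
      zero_mem' := by simp [gaussianPairing]
      add_mem' := by
        intro P Q hP hQ
        simp only [Set.mem_ofPred_eq, gaussianPairing, evalAt_add, add_mul] at hP hQ ⊢
        rw [integral_add (integrable_gaussianPairing hF hb P) (integrable_gaussianPairing hF hb Q),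
          hP, hQ, add_zero]
      smul_mem' := by
        intro c P hP
        simp only [Set.mem_ofPred_eq, gaussianPairing, evalAt_smul, mul_assoc] at hP ⊢
        rw [integral_const_mul, hP, mul_zero] }
  exact polynomial_induction_harmonic hd S (fun j m h hh => h1 j m h hh b hb) P

/-- The polynomial `x ↦ ⟨w, x⟩`. -/
noncomputable def innerPoly (w : Space d) : MvPolynomial (Fin d) ℂ :=
  ∑ i, MvPolynomial.C ((w i : ℝ) : ℂ) * MvPolynomial.X i

theorem evalAt_innerPoly (w x : Space d) : evalAt (innerPoly w) x = ((inner ℝ w x : ℝ) : ℂ) := by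
  simp [innerPoly, PiLp.inner_apply, mul_comm]

/-- The partial sums of the power series of e^{-2πi⟨v,w⟩} are polynomials in v, so each of them
pairs to zero; the Gaussian permits passage to the limit. -/
theorem fourier_eq_zero_of_gaussianPairing {F : Space d → ℂ} (hF : MemLp F 2 volume)
    {b : ℝ} (hb : 0 < b) (h : ∀ P, gaussianPairing F b P = 0) (w : Space d) :
    𝓕 (fun v => gaussianWave (b : ℂ) 0 0 v * F v) w = 0 := by
  rw [Real.fourier_eq']
  set z : Space d → ℂ := fun v => ((-2 * Real.pi * inner ℝ v w : ℝ) : ℂ) * Complex.I with hz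
  have hnz : ∀ v, ‖z v‖ ≤ 2 * Real.pi * ‖w‖ * ‖v‖ := by
    intro v
    simp only [hz, norm_mul, Complex.norm_I, mul_one, Complex.norm_real, norm_neg, Real.norm_eq_abs,
      abs_two, abs_of_pos Real.pi_pos]
    have := abs_real_inner_le_norm v w
    have hpi := Real.pi_pos
    calc 2 * Real.pi * |inner ℝ v w| ≤ 2 * Real.pi * (‖v‖ * ‖w‖) := by gcongr
      _ = _ := by ring
  -- All partial sums are bounded by e^{2π|w||v|}, which half of the Gaussian absorbs; no polynomial
  -- factor is present, hence the exponent 0.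
  obtain ⟨K, hK, hbd⟩ := exists_pow_mul_exp_bound hb zero_le_one (2 * Real.pi * ‖w‖) 0
  have hlim := tendsto_integral_of_dominated_convergence (μ := (volume : Measure (Space d)))
    (F := fun (N : ℕ) v => (∑ n ∈ Finset.range N, z v ^ n / n.factorial) *
      (gaussianWave (b : ℂ) 0 0 v * F v))
    (f := fun v => Complex.exp (z v) * (gaussianWave (b : ℂ) 0 0 v * F v))
    (fun v => K * Real.exp (-(b / 2) * ‖v‖ ^ 2) * ‖F v‖) ?_
    (integrable_exp_neg_mul_norm (by positivity) K hF) ?_ ?_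
  · have h0 : ∀ N : ℕ, ∫ v, (∑ n ∈ Finset.range N, z v ^ n / n.factorial) *
        (gaussianWave (b : ℂ) 0 0 v * F v) = 0 := by
      intro N
      refine Eq.trans ?_ (h (∑ n ∈ Finset.range N, MvPolynomial.C ((n.factorial : ℂ)⁻¹) *
        (MvPolynomial.C (-2 * Real.pi * Complex.I) * innerPoly w) ^ n))
      refine integral_congr_ae (Filter.Eventually.of_forall fun v => ?_)
      simp only [evalAt_sum, evalAt_mul, evalAt_C, evalAt_pow, evalAt_innerPoly]
      have e : z v = -2 * Real.pi * Complex.I * ((inner ℝ w v : ℝ) : ℂ) := by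
        simp only [hz, real_inner_comm v w]
        push_cast; ring
      simp_rw [mul_assoc (∑ n ∈ Finset.range N, _), e, div_eq_inv_mul]
    simp_rw [h0] at hlim
    exact (tendsto_nhds_unique hlim tendsto_const_nhds)
  · intro N
    refine AEStronglyMeasurable.mul ?_
      ((continuous_gaussianWave _ _ _).aestronglyMeasurable.mul hF.1)
    refine Continuous.aestronglyMeasurable ?_
    fun_prop
  · intro N
    refine Filter.Eventually.of_forall fun v => ?_
    rw [norm_mul, norm_mul, ← mul_assoc]
    refine mul_le_mul_of_nonneg_right ?_ (norm_nonneg _)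
    have h1 : ‖∑ n ∈ Finset.range N, z v ^ n / n.factorial‖ ≤
        Real.exp (2 * Real.pi * ‖w‖ * ‖v‖) := by
      refine (norm_sum_le _ _).trans ?_
      refine le_trans ?_ (Real.sum_le_exp_of_nonneg (by positivity) N)
      refine Finset.sum_le_sum fun n _ => ?_
      rw [norm_div, norm_pow, Complex.norm_natCast]
      gcongr
      exact hnz v
    have h2 := hbd ‖v‖ (norm_nonneg v)
    rw [gaussianWave_zero, Complex.norm_real, Real.norm_of_nonneg (Real.exp_pos _).le]
    refine (mul_le_mul_of_nonneg_right h1 (Real.exp_pos _).le).trans ?_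
    rw [← Real.exp_add]
    simpa [sub_eq_add_neg] using h2
  · refine Filter.Eventually.of_forall fun v => ?_
    have := (NormedSpace.expSeries_div_hasSum_exp (z v)).tendsto_sum_nat
    rw [← Complex.exp_eq_exp_ℂ] at this
    exact this.mul_const _

/-- Solid harmonics times Gaussians are total in `L²(ℝ^d)`. -/
theorem ae_eq_zero_of_gaussianPairing (hd : 2 ≤ d) {F : Space d → ℂ} (hF : MemLp F 2 volume)
    (h : ∀ k P, IsSolidHarmonic k P → ∀ b : ℝ, 0 < b → gaussianPairing F b P = 0) :
    F =ᵐ[volume] 0 := by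
  -- F times a Gaussian is in L¹ ∩ L² and its transform vanishes, so the product is zero by
  -- Plancherel. The Gaussian has no zeros, so F = 0.
  have h1 := fourier_eq_zero_of_gaussianPairing hF one_pos
    (fun P => gaussianPairing_eq_zero hd hF h one_pos P)
  have h_int : Integrable fun v => gaussianWave ((1 : ℝ) : ℂ) 0 0 v * F v := by
    simpa using integrable_gaussianPairing hF one_pos 1
  have hL2 : MemLp (fun v => gaussianWave ((1 : ℝ) : ℂ) 0 0 v * F v) 2 volume := by
    refine hF.of_le h_int.1 (Filter.Eventually.of_forall fun v => ?_)
    rw [norm_mul, gaussianWave_zero, Complex.norm_real, Real.norm_of_nonneg (Real.exp_pos _).le]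
    refine mul_le_of_le_one_left (norm_nonneg _) ?_
    rw [Real.exp_le_one_iff]
    have := sq_nonneg ‖v‖
    linarith
  have h2 : (𝓕 (hL2.toLp _) : L2 d) = 0 := by
    rw [Lp.eq_zero_iff_ae_eq_zero]
    filter_upwards [fourier_toLp_ae h_int hL2] with w hw
    rw [hw, h1]
    rfl
  have h3 : hL2.toLp _ = 0 := by
    rw [← norm_eq_zero, ← Lp.norm_fourier_eq, h2, norm_zero]
  have h4 := hL2.coeFn_toLp
  rw [h3] at h4
  filter_upwards [h4, Lp.coeFn_zero (E := ℂ) (p := 2) (μ := (volume : Measure (Space d)))] with v hv hv'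
  rw [hv'] at hv
  have : gaussianWave ((1 : ℝ) : ℂ) 0 0 v ≠ 0 := Complex.exp_ne_zero _
  exact (mul_eq_zero.1 hv.symm).resolve_left this

end Completeness

end AngularSmoothing

namespace AngularSmoothing

open MeasureTheory
open scoped FourierTransform ENNReal ComplexConjugate

variable {d : ℕ}

/-! ### Orthogonality of degrees and invariance under the Fourier transform. -/

section Orthogonality

/-- The product of a polynomial and a Gaussian as an element of `L²(ℝ^d)`. -/
noncomputable def gaussianL2 (P : MvPolynomial (Fin d) ℂ) {b : ℝ} (hb : 0 < b) : L2 d :=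
  (memLp_evalAt_mul_gaussianWave P (b := (b : ℂ)) (by simpa using hb) 0 0).toLp _

theorem coeFn_gaussianL2 (P : MvPolynomial (Fin d) ℂ) {b : ℝ} (hb : 0 < b) :
    gaussianL2 P hb =ᵐ[volume] fun v => evalAt P v * gaussianWave (b : ℂ) 0 0 v :=
  MemLp.coeFn_toLp _

theorem fourier_evalAt_mul_gaussianWave (P : MvPolynomial (Fin d) ℂ) (b : ℂ) (w : Space d) :
    𝓕 (fun v => evalAt P v * gaussianWave b 0 0 v) w =
      gaussianMoment b (-2 * Real.pi * Complex.I) w P := by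
  rw [Real.fourier_eq', gaussianMoment]
  refine integral_congr_ae (Filter.Eventually.of_forall fun v => ?_)
  simp only [gaussianWave, smul_eq_mul]
  rw [mul_left_comm, ← Complex.exp_add]
  congr 2
  rw [real_inner_comm]
  push_cast; ring

theorem fourierInv_evalAt_mul_gaussianWave (P : MvPolynomial (Fin d) ℂ) (b : ℂ) (w : Space d) :
    𝓕⁻ (fun v => evalAt P v * gaussianWave b 0 0 v) w =
      gaussianMoment b (2 * Real.pi * Complex.I) w P := by
  rw [Real.fourierInv_eq', gaussianMoment]
  refine integral_congr_ae (Filter.Eventually.of_forall fun v => ?_)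
  simp only [gaussianWave, smul_eq_mul]
  rw [mul_left_comm, ← Complex.exp_add]
  congr 2
  rw [real_inner_comm]
  push_cast; ring

/-- The Hecke identity with c = -2πi keeps P and sends the Gaussian parameter b to π²/b. Both
orthogonality and the Fourier invariance of each degree rest on this. -/
theorem fourier_gaussianL2 {k : ℕ} {P : MvPolynomial (Fin d) ℂ} (hP : IsSolidHarmonic k P)
    {b c : ℝ} (hb : 0 < b) (hc : 0 < c) (hbc : b * c = Real.pi ^ 2) :
    (𝓕 (gaussianL2 P hb) : L2 d) =
      ((-2 * Real.pi * Complex.I / (2 * b)) ^ k * ((Real.pi : ℂ) / b) ^ ((d : ℂ) / 2))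
        • gaussianL2 P hc := by
  have hb' : 0 < (b : ℂ).re := by simpa using hb
  refine Lp.ext ?_
  filter_upwards [fourier_toLp_ae (integrable_evalAt_mul_gaussianWave P hb' 0 0)
    (memLp_evalAt_mul_gaussianWave P hb' 0 0), Lp.coeFn_smul ((-2 * Real.pi * Complex.I / (2 * b)) ^ k
      * ((Real.pi : ℂ) / b) ^ ((d : ℂ) / 2)) (gaussianL2 P hc), coeFn_gaussianL2 P hc] with w h1 h2 h3
  rw [gaussianL2, h1, h2, Pi.smul_apply, h3, fourier_evalAt_mul_gaussianWave,
    gaussianMoment_solidHarmonic hb' _ _ hP, smul_eq_mul, gaussianWave]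
  have h4 : (-2 * Real.pi * Complex.I) ^ 2 * (‖w‖ : ℂ) ^ 2 / (4 * b) =
      -(c : ℂ) * (‖w‖ : ℂ) ^ 2 + 0 * ((inner ℝ (0 : Space d) w : ℝ) : ℂ) := by
    have hb0 : (b : ℂ) ≠ 0 := by exact_mod_cast hb.ne'
    have h5 : (b : ℂ) * c = (Real.pi : ℂ) ^ 2 := by exact_mod_cast hbc
    rw [mul_pow, mul_pow, Complex.I_sq, zero_mul, add_zero]
    field_simp
    linear_combination (-4 * (‖w‖ : ℂ) ^ 2) * (-h5)
  rw [h4]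
  ring

theorem integrable_conj_mul_gaussian (P Q : MvPolynomial (Fin d) ℂ) {b c : ℝ} (hb : 0 < b)
    (hc : 0 < c) : Integrable (fun v : Space d => conj (evalAt P v) * evalAt Q v *
      ((Real.exp (-(b + c) * ‖v‖ ^ 2) : ℝ) : ℂ)) := by
  have h := (memLp_evalAt_mul_gaussianWave P (b := (b : ℂ)) (by simpa using hb) 0 0).star.integrable_mul
    (memLp_evalAt_mul_gaussianWave Q (b := (c : ℂ)) (by simpa using hc) 0 0)
  refine h.congr (Filter.Eventually.of_forall fun v => ?_)
  simp only [Pi.mul_apply, Pi.star_apply, star_mul', gaussianWave_zero, RCLike.star_def,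
    Complex.conj_ofReal]
  have : Real.exp (-(b + c) * ‖v‖ ^ 2) = Real.exp (-b * ‖v‖ ^ 2) * Real.exp (-c * ‖v‖ ^ 2) := by
    rw [← Real.exp_add]; ring_nf
  rw [this]; push_cast; ring

theorem inner_gaussianL2 (P Q : MvPolynomial (Fin d) ℂ) {b c : ℝ} (hb : 0 < b) (hc : 0 < c) :
    inner ℂ (gaussianL2 P hb) (gaussianL2 Q hc) = ∫ v : Space d, conj (evalAt P v) * evalAt Q v *
      ((Real.exp (-(b + c) * ‖v‖ ^ 2) : ℝ) : ℂ) := by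
  rw [L2.inner_def]
  refine integral_congr_ae ?_
  filter_upwards [coeFn_gaussianL2 P hb, coeFn_gaussianL2 Q hc] with v h1 h2
  rw [h1, h2, RCLike.inner_apply, gaussianWave_zero, gaussianWave_zero, map_mul, Complex.conj_ofReal]
  have : Real.exp (-(b + c) * ‖v‖ ^ 2) = Real.exp (-b * ‖v‖ ^ 2) * Real.exp (-c * ‖v‖ ^ 2) := by
    rw [← Real.exp_add]; ring_nf
  rw [this]; push_cast; ring

/-- The parameters 2π and π/2 are exchanged by b ↦ π²/b, while the inner product depends only on
their sum. Parseval therefore multiplies it by a constant of modulus 2^{l-k}, which is not 1 when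
the degrees differ. -/
theorem inner_gaussianL2_eq_zero {k l : ℕ} (hkl : k ≠ l) {P Q : MvPolynomial (Fin d) ℂ}
    (hP : IsSolidHarmonic k P) (hQ : IsSolidHarmonic l Q) :
    inner ℂ (gaussianL2 P Real.two_pi_pos) (gaussianL2 Q Real.pi_div_two_pos) = 0 := by
  have hpi := Real.pi_pos
  have h1 := Lp.inner_fourier_eq (gaussianL2 P Real.two_pi_pos) (gaussianL2 Q Real.pi_div_two_pos)
  rw [fourier_gaussianL2 hP Real.two_pi_pos Real.pi_div_two_pos (by ring),
    fourier_gaussianL2 hQ Real.pi_div_two_pos Real.two_pi_pos (by ring),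
    inner_smul_left, inner_smul_right] at h1
  have h2 : inner ℂ (gaussianL2 P Real.pi_div_two_pos) (gaussianL2 Q Real.two_pi_pos) =
      inner ℂ (gaussianL2 P Real.two_pi_pos) (gaussianL2 Q Real.pi_div_two_pos) := by
    rw [inner_gaussianL2, inner_gaussianL2, add_comm]
  rw [h2] at h1
  set m := inner ℂ (gaussianL2 P Real.two_pi_pos) (gaussianL2 Q Real.pi_div_two_pos)
  by_contra hm
  have h3 := congrArg norm h1
  have hmn : ‖m‖ ≠ 0 := norm_ne_zero_iff.2 hm
  have e1 : (Real.pi : ℂ) / ((2 * Real.pi : ℝ) : ℂ) = ((1 / 2 : ℝ) : ℂ) := by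
    have : (Real.pi : ℂ) ≠ 0 := by exact_mod_cast hpi.ne'
    push_cast; field_simp
  have e2 : (Real.pi : ℂ) / ((Real.pi / 2 : ℝ) : ℂ) = ((2 : ℝ) : ℂ) := by
    have : (Real.pi : ℂ) ≠ 0 := by exact_mod_cast hpi.ne'
    push_cast; field_simp
  have e3 : ∀ x : ℝ, 0 < x → ‖((x : ℝ) : ℂ) ^ ((d : ℂ) / 2)‖ = x ^ ((d : ℝ) / 2) := fun x hx => by
    rw [Complex.norm_cpow_eq_rpow_re_of_pos hx]; simp
  have e4 : ∀ b : ℝ, 0 < b → ‖-2 * (Real.pi : ℂ) * Complex.I / (2 * (b : ℂ))‖ = Real.pi / b := by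
    intro b hb
    rw [norm_div, norm_mul, norm_mul, norm_mul, Complex.norm_I, norm_neg, Complex.norm_ofNat,
      Complex.norm_real, Complex.norm_real, Real.norm_of_nonneg hpi.le, Real.norm_of_nonneg hb.le]
    field_simp
  rw [norm_mul, norm_mul, RCLike.norm_conj, norm_mul, norm_mul, norm_pow, norm_pow,
    e4 _ Real.two_pi_pos, e4 _ Real.pi_div_two_pos, e1, e2, e3 _ (by norm_num), e3 _ (by norm_num)]
    at h3
  have e5 : Real.pi / (2 * Real.pi) = 1 / 2 := by field_simp
  have e6 : Real.pi / (Real.pi / 2) = 2 := by field_simp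
  have e7 : (1 / 2 : ℝ) ^ ((d : ℝ) / 2) * 2 ^ ((d : ℝ) / 2) = 1 := by
    rw [← Real.mul_rpow (by norm_num) (by norm_num)]; norm_num
  rw [e5, e6] at h3
  have h4 : (1 / 2 : ℝ) ^ k * 2 ^ l = 1 := by
    have h5 : ((1 / 2 : ℝ) ^ k * 2 ^ l) * ‖m‖ = 1 * ‖m‖ := by
      calc ((1 / 2 : ℝ) ^ k * 2 ^ l) * ‖m‖
          = ((1 / 2 : ℝ) ^ k * 2 ^ l) * ((1 / 2 : ℝ) ^ ((d : ℝ) / 2) * 2 ^ ((d : ℝ) / 2)) * ‖m‖ := by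
            rw [e7, mul_one]
        _ = 1 * ‖m‖ := by rw [one_mul]; linear_combination h3
    exact mul_right_cancel₀ hmn h5
  rw [one_div, inv_pow, inv_mul_eq_one₀ (by positivity)] at h4
  exact hkl (pow_right_injective₀ (by norm_num : (0 : ℝ) < 2) (by norm_num) h4)

/-- Solid harmonics of different degrees are orthogonal on the sphere. -/
theorem integral_sphere_conj_mul_eq_zero (hd : 2 ≤ d) {k l : ℕ} (hkl : k ≠ l)
    {P Q : MvPolynomial (Fin d) ℂ} (hP : IsSolidHarmonic k P) (hQ : IsSolidHarmonic l Q) :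
    ∫ ω, conj (evalAt P (ω : Space d)) * evalAt Q (ω : Space d) ∂(sphereMeasure d) = 0 := by
  have h_int := integrable_conj_mul_gaussian P Q Real.two_pi_pos Real.pi_div_two_pos
  have h1 := inner_gaussianL2_eq_zero hkl hP hQ
  rw [inner_gaussianL2, integral_polar hd h_int] at h1
  set s := 2 * Real.pi + Real.pi / 2 with hs
  have hs0 : 0 < s := by positivity
  set c := ∫ ω, conj (evalAt P (ω : Space d)) * evalAt Q (ω : Space d) ∂(sphereMeasure d)
  have h2 : ∀ r ∈ Set.Ioi (0 : ℝ), ((r ^ (d - 1) : ℝ) : ℂ) * ∫ ω : Metric.sphere (0 : Space d) 1,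
      conj (evalAt P (r • (ω : Space d))) * evalAt Q (r • (ω : Space d)) *
        ((Real.exp (-s * ‖r • (ω : Space d)‖ ^ 2) : ℝ) : ℂ) ∂(sphereMeasure d)
      = ((r ^ (d - 1) * r ^ (k + l) * Real.exp (-s * r ^ 2) : ℝ) : ℂ) * c := by
    intro r hr
    have hr : 0 < r := hr
    have : ∀ ω : Metric.sphere (0 : Space d) 1,
        conj (evalAt P (r • (ω : Space d))) * evalAt Q (r • (ω : Space d)) *
        ((Real.exp (-s * ‖r • (ω : Space d)‖ ^ 2) : ℝ) : ℂ) =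
        ((r ^ (k + l) * Real.exp (-s * r ^ 2) : ℝ) : ℂ) *
          (conj (evalAt P (ω : Space d)) * evalAt Q (ω : Space d)) := by
      intro ω
      have hω : ‖r • (ω : Space d)‖ = r := by
        rw [norm_smul, norm_eq_of_mem_sphere, mul_one, Real.norm_of_nonneg hr.le]
      rw [hω, evalAt_smul_of_isHomogeneous hP.1, evalAt_smul_of_isHomogeneous hQ.1, map_mul, map_pow,
        Complex.conj_ofReal]
      push_cast; ring
    simp_rw [this]
    rw [integral_const_mul]
    push_cast; ring
  rw [setIntegral_congr_fun measurableSet_Ioi h2, integral_mul_const] at h1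
  -- The inner product splits into a radial Gaussian integral, which is positive, and the integral
  -- over the sphere, which must therefore vanish.
  refine (mul_eq_zero.1 h1).resolve_left ?_
  rw [integral_complex_ofReal]
  have hpos : 0 < ∫ r in Set.Ioi (0 : ℝ), r ^ (d - 1) * r ^ (k + l) * Real.exp (-s * r ^ 2) := by
    have h3 : ∀ r ∈ Set.Ioi (0 : ℝ), r ^ (d - 1) * r ^ (k + l) * Real.exp (-s * r ^ 2) =
        r ^ ((d - 1 + (k + l) : ℕ) : ℝ) * Real.exp (-s * r ^ (2 : ℝ)) := by
      intro r _
      rw [Real.rpow_natCast, pow_add _ (d - 1), Real.rpow_two]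
    rw [setIntegral_congr_fun measurableSet_Ioi h3,
      integral_rpow_mul_exp_neg_mul_rpow (by norm_num) ?_ hs0]
    · have : 0 < Real.Gamma ((((d - 1 + (k + l) : ℕ) : ℝ) + 1) / 2) :=
        Real.Gamma_pos_of_pos (by positivity)
      positivity
    · exact lt_of_lt_of_le (by norm_num) (Nat.cast_nonneg _)
  exact_mod_cast hpos.ne.symm

/-- On every sphere centred at the origin, `w` is a spherical harmonic of degree `k`. -/
def IsAngular (k : ℕ) (w : Space d → ℂ) : Prop :=
  ∀ r : ℝ, 0 < r → ∃ P, IsSolidHarmonic k P ∧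
    ∀ ω : Metric.sphere (0 : Space d) 1, w (r • (ω : Space d)) = evalAt P (ω : Space d)

/-- The functions are orthogonal on each sphere separately, so their dependence on the radius may be
arbitrary. -/
theorem inner_eq_zero_of_isAngular (hd : 2 ≤ d) {k l : ℕ} (hkl : k ≠ l) {w w' : Space d → ℂ}
    (hw : IsAngular k w) (hw' : IsAngular l w') {f g : L2 d} (hf : f =ᵐ[volume] w)
    (hg : g =ᵐ[volume] w') : inner ℂ f g = 0 := by
  have h_int : Integrable (fun x => conj (w x) * w' x) := by
    refine (L2.integrable_inner (𝕜 := ℂ) f g).congr ?_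
    filter_upwards [hf, hg] with x h1 h2
    rw [h1, h2, RCLike.inner_apply, mul_comm]
  have h1 : inner ℂ f g = ∫ x, conj (w x) * w' x := by
    rw [L2.inner_def]
    refine integral_congr_ae ?_
    filter_upwards [hf, hg] with x h1 h2
    rw [h1, h2, RCLike.inner_apply, mul_comm]
  rw [h1, integral_polar hd h_int]
  have h2 : ∀ r ∈ Set.Ioi (0 : ℝ), ((r ^ (d - 1) : ℝ) : ℂ) * ∫ ω : Metric.sphere (0 : Space d) 1,
      conj (w (r • (ω : Space d))) * w' (r • (ω : Space d)) ∂(sphereMeasure d) = 0 := by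
    intro r hr
    obtain ⟨P, hP, hP'⟩ := hw r hr
    obtain ⟨Q, hQ, hQ'⟩ := hw' r hr
    simp_rw [hP', hQ']
    rw [integral_sphere_conj_mul_eq_zero hd hkl hP hQ, mul_zero]
  rw [setIntegral_congr_fun measurableSet_Ioi h2, integral_zero]

theorem IsSolidHarmonic.smul {k : ℕ} {P : MvPolynomial (Fin d) ℂ} (hP : IsSolidHarmonic k P)
    (c : ℂ) : IsSolidHarmonic k (c • P) := by
  refine ⟨?_, ?_⟩
  · rw [MvPolynomial.smul_eq_C_mul]
    simpa using (MvPolynomial.isHomogeneous_C (Fin d) c).mul hP.1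
  · simp only [Derivation.map_smul]
    rw [← Finset.smul_sum, hP.2, smul_zero]

theorem IsSolidHarmonic.add {k : ℕ} {P Q : MvPolynomial (Fin d) ℂ} (hP : IsSolidHarmonic k P)
    (hQ : IsSolidHarmonic k Q) : IsSolidHarmonic k (P + Q) := by
  refine ⟨hP.1.add hQ.1, ?_⟩
  simp only [map_add]
  rw [Finset.sum_add_distrib, hP.2, hQ.2, add_zero]

theorem isSolidHarmonic_zero (k : ℕ) : IsSolidHarmonic k (0 : MvPolynomial (Fin d) ℂ) :=
  ⟨MvPolynomial.isHomogeneous_zero _ _ _, by simp⟩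

theorem isAngular_evalAt_mul {k : ℕ} {P : MvPolynomial (Fin d) ℂ} (hP : IsSolidHarmonic k P)
    (g : ℝ → ℂ) : IsAngular k fun ξ : Space d => evalAt P ξ * g ‖ξ‖ := by
  intro r hr
  refine ⟨((r : ℂ) ^ k * g r) • P, hP.smul _, fun ω => ?_⟩
  have hω : ‖r • (ω : Space d)‖ = r := by
    rw [norm_smul, norm_eq_of_mem_sphere, mul_one, Real.norm_of_nonneg hr.le]
  simp only [hω, evalAt_smul_of_isHomogeneous hP.1, evalAt_smul]
  ring

theorem harmonicSpace_isOrtho (hd : 2 ≤ d) (k l : ℕ) (hkl : k ≠ l) :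
    harmonicSpace d k ⟂ harmonicSpace d l := by
  rw [harmonicSpace, harmonicSpace, Submodule.isOrtho_span]
  rintro f ⟨P, f₀, hP, -, hf⟩ g ⟨Q, g₀, hQ, -, hg⟩
  refine inner_eq_zero_of_isAngular hd hkl (isAngular_evalAt_mul hP
      fun r => f₀ r * ((r ^ (-(d : ℝ) / 2 - (k : ℝ) + 1 / 2) : ℝ) : ℂ))
    (isAngular_evalAt_mul hQ fun r => g₀ r * ((r ^ (-(d : ℝ) / 2 - (l : ℝ) + 1 / 2) : ℝ) : ℂ))
    (hf.trans (Filter.Eventually.of_forall fun ξ => ?_))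
    (hg.trans (Filter.Eventually.of_forall fun ξ => ?_))
  · simp only [evalAt, mul_assoc]
  · simp only [evalAt, mul_assoc]

theorem gaussianL2_mem_harmonicSpace (hd : 2 ≤ d) {k : ℕ} {P : MvPolynomial (Fin d) ℂ}
    (hP : IsSolidHarmonic k P) {b : ℝ} (hb : 0 < b) : gaussianL2 P hb ∈ harmonicSpace d k := by
  -- The radial factor carries the power r^{d/2+k-1/2}, which cancels the weight in the definition
  -- of 𝔥_k away from the origin.
  refine Submodule.subset_span ⟨P, fun r => ((r ^ ((d : ℝ) / 2 + k - 1 / 2) *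
    Real.exp (-b * r ^ 2) : ℝ) : ℂ), hP, ?_, ?_⟩
  · have hm : Measurable fun r : ℝ => ((r ^ ((d : ℝ) / 2 + k - 1 / 2) *
        Real.exp (-b * r ^ 2) : ℝ) : ℂ) := by fun_prop
    rw [← integrable_norm_rpow_iff hm.aestronglyMeasurable (by norm_num) (by norm_num)]
    refine (integrableOn_rpow_mul_exp_neg_mul_sq (b := 2 * b) (by positivity)
      (s := (d : ℝ) + 2 * k - 1) ?_).congr ?_
    · have : (2 : ℝ) ≤ d := by exact_mod_cast hd
      have h2 : (0 : ℝ) ≤ k := Nat.cast_nonneg k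
      linarith
    · filter_upwards [ae_restrict_mem measurableSet_Ioi] with r hr
      have hr : 0 < r := hr
      simp only [ENNReal.toReal_ofNat, Real.rpow_ofNat, Complex.norm_real, norm_mul, Real.norm_eq_abs,
        Real.abs_exp, mul_pow, sq_abs]
      rw [← Real.exp_nat_mul, ← Real.rpow_mul_natCast hr.le]
      congr 2 <;> push_cast <;> ring
  · have : Nontrivial (Space d) := by
      have : Nonempty (Fin d) := ⟨⟨0, by omega⟩⟩
      infer_instance
    filter_upwards [coeFn_gaussianL2 P hb, Measure.ae_ne volume (0 : Space d)] with v hv hv0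
    have hpos : 0 < ‖v‖ := norm_pos_iff.2 hv0
    rw [hv, gaussianWave_zero]
    have h1 : ‖v‖ ^ ((d : ℝ) / 2 + k - 1 / 2) * ‖v‖ ^ (-(d : ℝ) / 2 - k + 1 / 2) = 1 := by
      rw [← Real.rpow_add hpos]
      ring_nf
      exact Real.rpow_zero _
    have h2 : ((‖v‖ ^ ((d : ℝ) / 2 + k - 1 / 2) : ℝ) : ℂ) *
        ((‖v‖ ^ (-(d : ℝ) / 2 - k + 1 / 2) : ℝ) : ℂ) = 1 := by
      rw [← Complex.ofReal_mul, h1, Complex.ofReal_one]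
    rw [Complex.ofReal_mul]
    change evalAt P v * _ = evalAt P v * _ * _
    linear_combination (-evalAt P v * ((Real.exp (-b * ‖v‖ ^ 2) : ℝ) : ℂ)) * h2

/-- The span of products of solid harmonics of degree `k` with Gaussians. -/
noncomputable def gaussianSpace (d k : ℕ) : Submodule ℂ (L2 d) :=
  Submodule.span ℂ {f | ∃ (P : MvPolynomial (Fin d) ℂ) (b : ℝ) (hb : 0 < b),
    IsSolidHarmonic k P ∧ f = gaussianL2 P hb}

theorem gaussianSpace_le (hd : 2 ≤ d) (k : ℕ) : gaussianSpace d k ≤ harmonicSpace d k := by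
  refine Submodule.span_le.2 ?_
  rintro f ⟨P, b, hb, hP, rfl⟩
  exact gaussianL2_mem_harmonicSpace hd hP hb

theorem gaussianSpace_total (hd : 2 ≤ d) (f : L2 d)
    (hf : ∀ k, ∀ y ∈ gaussianSpace d k, inner ℂ y f = 0) : f = 0 := by
  -- The pairing with Gaussians is bilinear while the inner product is sesquilinear, so totality is
  -- applied to the conjugate of f.
  have h1 : (fun x => conj (f x)) =ᵐ[volume] (0 : Space d → ℂ) := by
    refine ae_eq_zero_of_gaussianPairing hd (Lp.memLp f).star fun k P hP b hb => ?_
    have h2 := hf k _ (Submodule.subset_span ⟨P, b, hb, hP, rfl⟩)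
    have h3 := congrArg conj h2
    rw [inner_conj_symm, map_zero, L2.inner_def] at h3
    rw [← h3]
    refine integral_congr_ae ?_
    filter_upwards [coeFn_gaussianL2 P hb] with v hv
    rw [hv, RCLike.inner_apply]
  rw [Lp.eq_zero_iff_ae_eq_zero]
  filter_upwards [h1] with x hx
  simpa using hx

theorem harmonicSpace_total (hd : 2 ≤ d) (f : L2 d)
    (hf : ∀ k, ∀ y ∈ harmonicSpace d k, inner ℂ y f = 0) : f = 0 :=
  gaussianSpace_total hd f fun k y hy => hf k y (gaussianSpace_le hd k hy)

theorem hasSum_harmonicProj (hd : 2 ≤ d) (f : L2 d) :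
    HasSum (fun k => harmonicProj d k f) f :=
  hasSum_closureProj (harmonicSpace_isOrtho hd) (harmonicSpace_total hd) f

theorem enorm_sq_eq_tsum_harmonicProj (hd : 2 ≤ d) (f : L2 d) :
    ‖f‖ₑ ^ 2 = ∑' k, ‖harmonicProj d k f‖ₑ ^ 2 :=
  enorm_sq_eq_tsum_closureProj (harmonicSpace_isOrtho hd) (harmonicSpace_total hd) f

/-- Gaussians times solid harmonics of degree k are dense in 𝔥_k, and the Hecke identity keeps their
degree, so the Fourier transform preserves the closure of each 𝔥_k. -/
theorem harmonicProj_fourier (hd : 2 ≤ d) (k : ℕ) (f : L2 d) :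
    harmonicProj d k (𝓕 f : L2 d) = (𝓕 (harmonicProj d k f) : L2 d) := by
  refine closureProj_comm (harmonicSpace_isOrtho hd) (harmonicSpace_total hd)
    ((Lp.fourierTransformₗᵢ (Space d) ℂ).toContinuousLinearEquiv : L2 d →L[ℂ] L2 d)
    (fun k y hy => ?_) k f
  have h1 := mem_closure_of_total (harmonicSpace_isOrtho hd) (gaussianSpace_le hd)
    (gaussianSpace_total hd) hy
  set A : L2 d →L[ℂ] L2 d :=
    ((Lp.fourierTransformₗᵢ (Space d) ℂ).toContinuousLinearEquiv : L2 d →L[ℂ] L2 d)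
  have h2 : (gaussianSpace d k).topologicalClosure ≤
      ((harmonicSpace d k).topologicalClosure).comap (A : L2 d →ₗ[ℂ] L2 d) := by
    refine Submodule.topologicalClosure_minimal _ (Submodule.span_le.2 ?_)
      ((harmonicSpace d k).isClosed_topologicalClosure.preimage A.continuous)
    rintro f ⟨P, b, hb, hP, rfl⟩
    have hc : 0 < Real.pi ^ 2 / b := by have := Real.pi_pos; positivity
    have h3 : A (gaussianL2 P hb) = _ := fourier_gaussianL2 hP hb hc (by field_simp)
    change A (gaussianL2 P hb) ∈ (harmonicSpace d k).topologicalClosure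
    rw [h3]
    exact Submodule.le_topologicalClosure _
      (Submodule.smul_mem _ _ (gaussianL2_mem_harmonicSpace hd hP hc))
  exact h2 h1

end Orthogonality

end AngularSmoothing

namespace AngularSmoothing

open MeasureTheory
open scoped FourierTransform ENNReal ComplexConjugate

variable {d : ℕ}

/-! ### Reduction of the space-time integral to the unit sphere. -/

section OscillatoryEnergy

/-- The hypotheses on the dispersion relation `φ` and the smoothing function `ψ`. -/
structure IsSmoothingPair (τ : ℝ) (φ ψ : ℝ → ℝ) : Prop where
  injOn : Set.InjOn φ (Set.Ioi 0)
  differentiableOn : DifferentiableOn ℝ φ (Set.Ioi 0)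
  deriv_ne_zero : ∀ᵐ ρ ∂(volume.restrict (Set.Ioi (0 : ℝ))), deriv φ ρ ≠ 0
  aemeasurable : AEMeasurable ψ (volume.restrict (Set.Ioi (0 : ℝ)))
  sq_eq : ∀ ρ : ℝ, 0 < ρ → ψ ρ ^ 2 = |deriv φ ρ| * ρ ^ (1 - τ)

/-- The Fourier extension operator of the unit sphere. -/
noncomputable def sphereExt (h : Space d → ℂ) (x : Space d) : ℂ :=
  ∫ ω : Metric.sphere (0 : Space d) 1, h ω *
    Complex.exp (2 * Real.pi * Complex.I * ((inner ℝ x (ω : Space d) : ℝ) : ℂ)) ∂(sphereMeasure d)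

/-- The weighted `L²` norm of the Fourier extension of a function on the unit sphere. -/
noncomputable def sphereEnergy (τ : ℝ) (h : Space d → ℂ) : ℝ≥0∞ :=
  ∫⁻ x, ‖sphereExt h x‖ₑ ^ 2 * ENNReal.ofReal (‖x‖ ^ (-τ))

/-- The space-time function whose spatial Fourier transform at time `t` is
`e^{itφ(2π|ξ|)} V(ξ)`. -/
noncomputable def waveField (φ : ℝ → ℝ) (V : Space d → ℂ) (t : ℝ) (x : Space d) : ℂ :=
  𝓕⁻ (fun ξ : Space d => Complex.exp (Complex.I * t * φ (2 * Real.pi * ‖ξ‖)) * V ξ) x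

theorem waveField_eq (φ : ℝ → ℝ) (V : Space d → ℂ) (t : ℝ) (x : Space d) :
    waveField φ V t x = ∫ ξ, Complex.exp (Complex.I * t * φ (2 * Real.pi * ‖ξ‖)) *
      (V ξ * Complex.exp (2 * Real.pi * Complex.I * ((inner ℝ x ξ : ℝ) : ℂ))) := by
  rw [waveField, Real.fourierInv_eq']
  refine integral_congr_ae (Filter.Eventually.of_forall fun ξ => ?_)
  simp only [smul_eq_mul]
  rw [real_inner_comm, mul_comm, mul_assoc]
  congr 3
  push_cast; ring

/-- Joint measurability is needed for Tonelli's theorem. Replacing φ and V by measurable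
representatives does not change the integral at any (t, x). -/
theorem stronglyMeasurable_waveField {φ : ℝ → ℝ} {V : Space d → ℂ}
    (hφ : AEMeasurable (fun ξ : Space d => φ (2 * Real.pi * ‖ξ‖)))
    (hV : AEStronglyMeasurable V) :
    StronglyMeasurable (Function.uncurry (waveField φ V)) := by
  have h1 : Function.uncurry (waveField φ V) = fun p : ℝ × Space d =>
      ∫ ξ, Complex.exp (Complex.I * p.1 * (hφ.mk _ ξ : ℝ)) *
      (hV.mk _ ξ * Complex.exp (2 * Real.pi * Complex.I * ((inner ℝ p.2 ξ : ℝ) : ℂ))) := by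
    ext ⟨t, x⟩
    rw [Function.uncurry, waveField_eq]
    refine integral_congr_ae ?_
    filter_upwards [hφ.ae_eq_mk, hV.ae_eq_mk] with ξ h1 h2
    simp only [h1, h2]
  rw [h1]
  refine StronglyMeasurable.integral_prod_right'
    (f := fun q : (ℝ × Space d) × Space d => Complex.exp (Complex.I * q.1.1 * (hφ.mk _ q.2 : ℝ)) *
      (hV.mk _ q.2 * Complex.exp (2 * Real.pi * Complex.I * ((inner ℝ q.1.2 q.2 : ℝ) : ℂ)))) ?_
  have m1 : Measurable fun q : (ℝ × Space d) × Space d => hφ.mk _ q.2 :=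
    hφ.measurable_mk.comp measurable_snd
  have m2 : Measurable fun q : (ℝ × Space d) × Space d => hV.mk _ q.2 :=
    hV.stronglyMeasurable_mk.measurable.comp measurable_snd
  refine Measurable.stronglyMeasurable ?_
  refine Measurable.mul ?_ (m2.mul ?_)
  · fun_prop
  · fun_prop

theorem stronglyMeasurable_sphereExt_smul {W : Space d → ℂ} (hW : Measurable W) :
    StronglyMeasurable fun p : ℝ × Space d =>
      sphereExt (fun ω => W (p.1 • ω)) (p.1 • p.2) := by
  refine StronglyMeasurable.integral_prod_right'
    (f := fun q : (ℝ × Space d) × Metric.sphere (0 : Space d) 1 => W (q.1.1 • (q.2 : Space d)) *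
      Complex.exp (2 * Real.pi * Complex.I * ((inner ℝ (q.1.1 • q.1.2) (q.2 : Space d) : ℝ) : ℂ))) ?_
  refine Measurable.stronglyMeasurable ?_
  refine Measurable.mul (hW.comp (by fun_prop)) ?_
  fun_prop

theorem IsSmoothingPair.aemeasurable_comp_norm {τ : ℝ} {φ ψ : ℝ → ℝ} (h : IsSmoothingPair τ φ ψ)
    (hd : 2 ≤ d) : AEMeasurable (fun ξ : Space d => φ (2 * Real.pi * ‖ξ‖)) :=
  (h.differentiableOn.continuousOn.aemeasurable measurableSet_Ioi).comp_quasiMeasurePreserving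
    (quasiMeasurePreserving_norm hd Real.two_pi_pos)

theorem IsSmoothingPair.aemeasurable_comp_norm' {τ : ℝ} {φ ψ : ℝ → ℝ} (h : IsSmoothingPair τ φ ψ)
    (hd : 2 ≤ d) : AEMeasurable (fun ξ : Space d => ψ (2 * Real.pi * ‖ξ‖)) :=
  h.aemeasurable.comp_quasiMeasurePreserving (quasiMeasurePreserving_norm hd Real.two_pi_pos)

theorem quasiMeasurePreserving_mul_left {c : ℝ} (hc : 0 < c) :
    Measure.QuasiMeasurePreserving (fun ρ : ℝ => c * ρ) (volume.restrict (Set.Ioi 0))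
      (volume.restrict (Set.Ioi 0)) := by
  refine ⟨by fun_prop, Measure.AbsolutelyContinuous.mk fun s hs h0 => ?_⟩
  rw [Measure.restrict_apply hs] at h0
  rw [Measure.map_apply (by fun_prop) hs, Measure.restrict_apply (by measurability)]
  have h1 : volume ((fun r : ℝ => c * r) ⁻¹' (s ∩ Set.Ioi 0)) = 0 := by
    rw [Real.volume_preimage_mul_left hc.ne', h0, mul_zero]
  refine measure_mono_null (fun r hr => ?_) h1
  exact ⟨hr.1, mul_pos hc hr.2⟩

/-- The time phase is constant on spheres |ξ| = ρ and leaves the angular integral. What remains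
inside is the extension operator applied to W(ρ·). -/
theorem waveField_polar (hd : 2 ≤ d) {τ : ℝ} {φ ψ : ℝ → ℝ} (h : IsSmoothingPair τ φ ψ)
    {W : Space d → ℂ} (hV : Integrable fun ξ : Space d => (ψ (2 * Real.pi * ‖ξ‖) : ℂ) * W ξ)
    (x : Space d) :
    IntegrableOn (fun ρ : ℝ => ((ρ ^ (d - 1) * ψ (2 * Real.pi * ρ) : ℝ) : ℂ) *
      sphereExt (fun ω => W (ρ • ω)) (ρ • x)) (Set.Ioi 0) ∧
    ∀ t : ℝ, waveField φ (fun ξ => (ψ (2 * Real.pi * ‖ξ‖) : ℂ) * W ξ) t x =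
      ∫ ρ in Set.Ioi (0 : ℝ), Complex.exp (Complex.I * t * φ (2 * Real.pi * ρ)) *
        (((ρ ^ (d - 1) * ψ (2 * Real.pi * ρ) : ℝ) : ℂ) *
          sphereExt (fun ω => W (ρ • ω)) (ρ • x)) := by
  have h_int : ∀ t : ℝ, Integrable (fun ξ : Space d =>
      Complex.exp (Complex.I * t * φ (2 * Real.pi * ‖ξ‖)) * ((ψ (2 * Real.pi * ‖ξ‖) : ℂ) * W ξ *
        Complex.exp (2 * Real.pi * Complex.I * ((inner ℝ x ξ : ℝ) : ℂ)))) := by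
    intro t
    have m1 := h.aemeasurable_comp_norm hd
    refine hV.mono ?_ (Filter.Eventually.of_forall fun ξ => le_of_eq ?_)
    · refine AEStronglyMeasurable.mul ?_ (hV.1.mul ?_)
      · exact (Complex.measurable_exp.comp_aemeasurable
          ((Complex.measurable_ofReal.comp_aemeasurable m1).const_mul _)).aestronglyMeasurable
      · exact AEMeasurable.aestronglyMeasurable (by fun_prop)
    · have e1 : Complex.I * t * φ (2 * Real.pi * ‖ξ‖) =
          ((t * φ (2 * Real.pi * ‖ξ‖) : ℝ) : ℂ) * Complex.I := by push_cast; ring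
      have e2 : 2 * Real.pi * Complex.I * ((inner ℝ x ξ : ℝ) : ℂ) =
          ((2 * Real.pi * inner ℝ x ξ : ℝ) : ℂ) * Complex.I := by push_cast; ring
      rw [e1, e2, norm_mul, norm_mul (_ * _), Complex.norm_exp_ofReal_mul_I,
        Complex.norm_exp_ofReal_mul_I, one_mul, mul_one]
  have hpol : ∀ t : ℝ, ∀ ρ ∈ Set.Ioi (0 : ℝ), ((ρ ^ (d - 1) : ℝ) : ℂ) *
      ∫ ω : Metric.sphere (0 : Space d) 1,
        Complex.exp (Complex.I * t * φ (2 * Real.pi * ‖ρ • (ω : Space d)‖)) *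
        ((ψ (2 * Real.pi * ‖ρ • (ω : Space d)‖) : ℂ) * W (ρ • (ω : Space d)) *
        Complex.exp (2 * Real.pi * Complex.I * ((inner ℝ x (ρ • (ω : Space d)) : ℝ) : ℂ)))
          ∂(sphereMeasure d) =
      Complex.exp (Complex.I * t * φ (2 * Real.pi * ρ)) *
        (((ρ ^ (d - 1) * ψ (2 * Real.pi * ρ) : ℝ) : ℂ) *
          sphereExt (fun ω => W (ρ • ω)) (ρ • x)) := by
    intro t ρ hρ
    have hρ : 0 < ρ := hρ
    have e : ∀ ω : Metric.sphere (0 : Space d) 1, ‖ρ • (ω : Space d)‖ = ρ := fun ω => by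
      rw [norm_smul, norm_eq_of_mem_sphere, mul_one, Real.norm_of_nonneg hρ.le]
    simp_rw [e, inner_smul_right, sphereExt, inner_smul_left, RCLike.conj_to_real]
    rw [← integral_const_mul, ← integral_const_mul, ← integral_const_mul]
    refine integral_congr_ae (Filter.Eventually.of_forall fun ω => ?_)
    push_cast
    ring
  constructor
  · refine (integrableOn_polar hd (h_int 0)).congr_fun (fun ρ hρ => ?_) measurableSet_Ioi
    have := hpol 0 ρ hρ
    simp only [Complex.ofReal_zero, mul_zero, zero_mul, Complex.exp_zero, one_mul] at this ⊢
    exact this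
  · intro t
    rw [waveField_eq, integral_polar hd (h_int t)]
    exact setIntegral_congr_fun measurableSet_Ioi (hpol t)

/-- Plancherel in t produces the factor 1/|φ'|, and the smoothing relation for ψ² removes it. The
right-hand side no longer involves φ or ψ. -/
theorem lintegral_waveField_sq (hd : 2 ≤ d) {τ : ℝ} {φ ψ : ℝ → ℝ} (h : IsSmoothingPair τ φ ψ)
    {W : Space d → ℂ} (hV : Integrable fun ξ : Space d => (ψ (2 * Real.pi * ‖ξ‖) : ℂ) * W ξ)
    (x : Space d) :
    ∫⁻ t, ‖waveField φ (fun ξ => (ψ (2 * Real.pi * ‖ξ‖) : ℂ) * W ξ) t x‖ₑ ^ 2 =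
      ENNReal.ofReal ((2 * Real.pi) ^ (1 - τ)) * ∫⁻ ρ in Set.Ioi (0 : ℝ),
        ENNReal.ofReal (ρ ^ (2 * (d : ℝ) - 1 - τ)) *
          ‖sphereExt (fun ω => W (ρ • ω)) (ρ • x)‖ₑ ^ 2 := by
  obtain ⟨h_int, heq⟩ := waveField_polar hd h hV x
  have hpi := Real.two_pi_pos
  have hmaps : ∀ ρ ∈ Set.Ioi (0 : ℝ), 2 * Real.pi * ρ ∈ Set.Ioi (0 : ℝ) :=
    fun ρ hρ => mul_pos hpi hρ
  have hder : ∀ ρ ∈ Set.Ioi (0 : ℝ), HasDerivAt (fun ρ => φ (2 * Real.pi * ρ))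
      (2 * Real.pi * deriv φ (2 * Real.pi * ρ)) ρ := by
    intro ρ hρ
    have h1 := (h.differentiableOn.differentiableAt (Ioi_mem_nhds (hmaps ρ hρ))).hasDerivAt
    have h2 := h1.scomp ρ ((hasDerivAt_id ρ).const_mul (2 * Real.pi))
    simpa [Function.comp_def] using h2
  have hne : ∀ᵐ ρ ∂(volume.restrict (Set.Ioi (0 : ℝ))), deriv φ (2 * Real.pi * ρ) ≠ 0 :=
    (quasiMeasurePreserving_mul_left hpi).ae h.deriv_ne_zero
  have key := lintegral_oscillatory_sq (Φ := fun ρ => φ (2 * Real.pi * ρ))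
    (fun a ha b hb hab => mul_left_cancel₀ hpi.ne' (h.injOn (hmaps a ha) (hmaps b hb) hab))
    (fun ρ hρ => (hder ρ hρ).differentiableAt.differentiableWithinAt)
    (by
      filter_upwards [hne, ae_restrict_mem measurableSet_Ioi] with ρ h1 h2
      rw [(hder ρ h2).deriv]
      exact mul_ne_zero hpi.ne' h1) h_int
  simp_rw [heq]
  rw [key, ← lintegral_const_mul' _ _ ENNReal.ofReal_ne_top,
    ← lintegral_const_mul' _ _ ENNReal.ofReal_ne_top]
  refine lintegral_congr_ae ?_
  filter_upwards [hne, ae_restrict_mem measurableSet_Ioi] with ρ h1 h2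
  have hρ : 0 < ρ := h2
  rw [(hder ρ h2).deriv, enorm_mul, mul_pow, ← ofReal_norm (((_ : ℝ) : ℂ)), Complex.norm_real,
    ← ENNReal.ofReal_pow (norm_nonneg _), Real.norm_eq_abs, sq_abs]
  have hd1 : 0 < |deriv φ (2 * Real.pi * ρ)| := abs_pos.2 h1
  -- The phase is φ(2πρ), whose derivative has a factor 2π that cancels the one from Plancherel. The
  -- surviving (2π)^{1-τ} comes from ψ(2πρ)².
  have e : 2 * Real.pi * ((ρ ^ (d - 1) * ψ (2 * Real.pi * ρ)) ^ 2 *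
      |2 * Real.pi * deriv φ (2 * Real.pi * ρ)|⁻¹) =
      (2 * Real.pi) ^ (1 - τ) * ρ ^ (2 * (d : ℝ) - 1 - τ) := by
    rw [mul_pow, h.sq_eq _ (hmaps ρ h2), abs_mul, abs_of_pos hpi, Real.mul_rpow hpi.le hρ.le]
    have e1 : ρ ^ (2 * (d : ℝ) - 1 - τ) = (ρ ^ (d - 1)) ^ 2 * ρ ^ (1 - τ) := by
      rw [← pow_mul, ← Real.rpow_natCast, ← Real.rpow_add hρ]
      congr 1
      rw [Nat.cast_mul, Nat.cast_sub (by omega)]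
      push_cast; ring
    rw [e1]
    field_simp
  calc _ = ENNReal.ofReal (2 * Real.pi * ((ρ ^ (d - 1) * ψ (2 * Real.pi * ρ)) ^ 2 *
      |2 * Real.pi * deriv φ (2 * Real.pi * ρ)|⁻¹)) *
        ‖sphereExt (fun ω => W (ρ • ω)) (ρ • x)‖ₑ ^ 2 := by
        rw [ENNReal.ofReal_mul hpi.le, ENNReal.ofReal_mul
          (p := (ρ ^ (d - 1) * ψ (2 * Real.pi * ρ)) ^ 2) (by positivity)]
        ring
    _ = _ := by
        rw [e, ENNReal.ofReal_mul (by positivity)]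
        ring

theorem lintegral_sphereExt_smul {τ : ℝ} (h : Space d → ℂ) {ρ : ℝ} (hρ : 0 < ρ) :
    ∫⁻ x, ‖sphereExt h (ρ • x)‖ₑ ^ 2 * ENNReal.ofReal (‖x‖ ^ (-τ)) =
      ENNReal.ofReal (ρ ^ (τ - d)) * sphereEnergy τ h := by
  have h1 : ∀ x : Space d, ‖sphereExt h (ρ • x)‖ₑ ^ 2 * ENNReal.ofReal (‖x‖ ^ (-τ)) =
      ENNReal.ofReal (ρ ^ τ) *
        (‖sphereExt h (ρ • x)‖ₑ ^ 2 * ENNReal.ofReal (‖ρ • x‖ ^ (-τ))) := by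
    intro x
    have : ‖x‖ ^ (-τ) = ρ ^ τ * ‖ρ • x‖ ^ (-τ) := by
      rw [norm_smul, Real.norm_of_nonneg hρ.le, Real.mul_rpow hρ.le (norm_nonneg x), ← mul_assoc,
        ← Real.rpow_add hρ]
      simp
    rw [this, ENNReal.ofReal_mul (by positivity)]
    ring
  simp_rw [h1]
  rw [lintegral_const_mul' _ _ ENNReal.ofReal_ne_top,
    lintegral_comp_smul_of_pos volume
      (fun y => ‖sphereExt h y‖ₑ ^ 2 * ENNReal.ofReal (‖y‖ ^ (-τ))) hρ,
    finrank_euclideanSpace_fin, ← mul_assoc, ← ENNReal.ofReal_mul (by positivity),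
    ← Real.rpow_add hρ, ← sub_eq_add_neg]
  rfl

/-- The weighted space-time integral in terms of the extension operator of the sphere. -/
theorem weightedIntegral_waveField (hd : 2 ≤ d) {τ : ℝ} {φ ψ : ℝ → ℝ}
    (h : IsSmoothingPair τ φ ψ) {W : Space d → ℂ} (hW : Measurable W)
    (hV : Integrable fun ξ : Space d => (ψ (2 * Real.pi * ‖ξ‖) : ℂ) * W ξ) :
    weightedIntegral τ (waveField φ fun ξ => (ψ (2 * Real.pi * ‖ξ‖) : ℂ) * W ξ) =
      ENNReal.ofReal ((2 * Real.pi) ^ (1 - τ)) * ∫⁻ ρ in Set.Ioi (0 : ℝ),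
        ENNReal.ofReal (ρ ^ (d - 1)) * sphereEnergy τ fun ω => W (ρ • ω) := by
  have hm := (stronglyMeasurable_waveField (h.aemeasurable_comp_norm hd) hV.1).measurable
  have hw : Measurable fun x : Space d => ENNReal.ofReal (‖x‖ ^ (-τ)) := by fun_prop
  rw [weightedIntegral, lintegral_lintegral_swap]
  · have h1 : ∀ x : Space d, ∫⁻ t, ‖waveField φ (fun ξ => (ψ (2 * Real.pi * ‖ξ‖) : ℂ) * W ξ) t x‖ₑ ^ 2
        * ENNReal.ofReal (‖x‖ ^ (-τ)) = ENNReal.ofReal ((2 * Real.pi) ^ (1 - τ)) *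
        ∫⁻ ρ in Set.Ioi (0 : ℝ), ENNReal.ofReal (ρ ^ (2 * (d : ℝ) - 1 - τ)) *
          ‖sphereExt (fun ω => W (ρ • ω)) (ρ • x)‖ₑ ^ 2 * ENNReal.ofReal (‖x‖ ^ (-τ)) := by
      intro x
      rw [lintegral_mul_const' _ _ ENNReal.ofReal_ne_top, lintegral_waveField_sq hd h hV x,
        lintegral_mul_const' _ _ ENNReal.ofReal_ne_top, mul_assoc]
    simp_rw [h1]
    rw [lintegral_const_mul' _ _ ENNReal.ofReal_ne_top, lintegral_lintegral_swap]
    · congr 1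
      refine setLIntegral_congr_fun measurableSet_Ioi fun ρ hρ => ?_
      have hρ : 0 < ρ := hρ
      simp_rw [mul_assoc]
      -- Scaling in x contributes ρ^{τ-d}; together with ρ^{2d-1-τ} this is the polar weight
      -- ρ^{d-1}.
      rw [lintegral_const_mul' _ _ ENNReal.ofReal_ne_top, lintegral_sphereExt_smul _ hρ, ← mul_assoc,
        ← ENNReal.ofReal_mul (by positivity), ← Real.rpow_add hρ]
      congr 2
      rw [← Real.rpow_natCast, Nat.cast_sub (by omega)]
      congr 1
      push_cast; ring
    · refine Measurable.aemeasurable ?_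
      have m1 := (stronglyMeasurable_sphereExt_smul hW).measurable.comp measurable_swap
      have m2 : Measurable fun p : Space d × ℝ =>
          ‖sphereExt (fun ω => W (p.2 • ω)) (p.2 • p.1)‖ₑ := m1.enorm
      refine Measurable.mul (Measurable.mul ?_ (m2.pow_const 2)) (hw.comp measurable_fst)
      fun_prop
  · refine Measurable.aemeasurable ?_
    have m2 : Measurable fun p : ℝ × Space d =>
        ‖waveField φ (fun ξ => (ψ (2 * Real.pi * ‖ξ‖) : ℂ) * W ξ) p.1 p.2‖ₑ := hm.enorm
    exact (m2.pow_const 2).mul (hw.comp measurable_snd)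

end OscillatoryEnergy

end AngularSmoothing

namespace AngularSmoothing

open MeasureTheory
open scoped FourierTransform ENNReal ComplexConjugate

variable {d : ℕ}

/-! ### Gamma integrals. -/

section GammaIntegrals

theorem lintegral_rpow_mul_exp {p q b : ℝ} (hp : 0 < p) (hq : -1 < q) (hb : 0 < b) :
    ∫⁻ r in Set.Ioi (0 : ℝ), ENNReal.ofReal (r ^ q * Real.exp (-b * r ^ p)) =
      ENNReal.ofReal (b ^ (-(q + 1) / p) * (1 / p) * Real.Gamma ((q + 1) / p)) := by
  rw [← integral_rpow_mul_exp_neg_mul_rpow hp hq hb,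
    ofReal_integral_eq_lintegral_ofReal (integrableOn_rpow_mul_exp_neg_mul_rpow hq hp hb)]
  filter_upwards [ae_restrict_mem measurableSet_Ioi] with r hr
  have hr : 0 < r := hr
  positivity

theorem lintegral_exp_neg_mul_sq {b : ℝ} (hb : 0 < b) :
    ∫⁻ t : ℝ, ENNReal.ofReal (Real.exp (-b * t ^ 2)) = ENNReal.ofReal (√(Real.pi / b)) := by
  rw [← integral_gaussian b, ofReal_integral_eq_lintegral_ofReal (integrable_exp_neg_mul_sq hb)
    (Filter.Eventually.of_forall fun t => (Real.exp_pos _).le)]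

/-- (1+t²)^{-s} is written as a Gamma integral in u. Integrating the Gaussian in t first leaves a
Gamma integral with exponent lowered by 1/2. -/
theorem lintegral_one_add_sq_rpow {s : ℝ} (hs : 1 / 2 < s) :
    ∫⁻ t : ℝ, ENNReal.ofReal ((1 + t ^ 2) ^ (-s)) =
      ENNReal.ofReal (√Real.pi * Real.Gamma (s - 1 / 2) / Real.Gamma s) := by
  have hΓ : 0 < Real.Gamma s := Real.Gamma_pos_of_pos (by linarith)
  have h1 : ∀ t : ℝ, ENNReal.ofReal ((1 + t ^ 2) ^ (-s)) = ENNReal.ofReal (Real.Gamma s)⁻¹ *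
      ∫⁻ u in Set.Ioi (0 : ℝ), ENNReal.ofReal (u ^ (s - 1) * Real.exp (-(1 + t ^ 2) * u)) := by
    intro t
    have h2 := lintegral_rpow_mul_exp (p := 1) (q := s - 1) (b := 1 + t ^ 2) one_pos (by linarith)
      (by positivity)
    simp only [Real.rpow_one] at h2
    rw [h2, ← ENNReal.ofReal_mul (by positivity)]
    congr 1
    rw [show -(s - 1 + 1) / 1 = -s by ring, show (s - 1 + 1) / 1 = s by ring]
    field_simp
  simp_rw [h1]
  rw [lintegral_const_mul' _ _ ENNReal.ofReal_ne_top, lintegral_lintegral_swap]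
  · have h3 : ∀ u ∈ Set.Ioi (0 : ℝ), ∫⁻ t : ℝ, ENNReal.ofReal (u ^ (s - 1) *
        Real.exp (-(1 + t ^ 2) * u)) =
        ENNReal.ofReal √Real.pi * ENNReal.ofReal (u ^ (s - 3 / 2) * Real.exp (-1 * u ^ (1 : ℝ))) := by
      intro u hu
      have hu : 0 < u := hu
      have h4 : ∀ t : ℝ, ENNReal.ofReal (u ^ (s - 1) * Real.exp (-(1 + t ^ 2) * u)) =
          ENNReal.ofReal (u ^ (s - 1) * Real.exp (-u)) * ENNReal.ofReal (Real.exp (-u * t ^ 2)) := by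
        intro t
        rw [← ENNReal.ofReal_mul (by positivity), mul_assoc, ← Real.exp_add]
        congr 3; ring
      simp_rw [h4]
      rw [lintegral_const_mul' _ _ ENNReal.ofReal_ne_top, lintegral_exp_neg_mul_sq hu,
        ← ENNReal.ofReal_mul (by positivity), ← ENNReal.ofReal_mul (by positivity)]
      congr 1
      have h5 : u ^ (s - 3 / 2) = u ^ (s - 1) * (√u)⁻¹ := by
        rw [Real.sqrt_eq_rpow, ← Real.rpow_neg hu.le, ← Real.rpow_add hu]
        congr 1; ring
      rw [h5, Real.sqrt_div Real.pi_pos.le, Real.rpow_one, neg_one_mul]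
      field_simp
    rw [setLIntegral_congr_fun measurableSet_Ioi h3, lintegral_const_mul' _ _ ENNReal.ofReal_ne_top,
      lintegral_rpow_mul_exp one_pos (by linarith) one_pos, ← ENNReal.ofReal_mul (by positivity),
      ← ENNReal.ofReal_mul (by positivity)]
    congr 1
    rw [Real.one_rpow, show (s - 3 / 2 + 1) / 1 = s - 1 / 2 by ring]
    field_simp
  · refine Measurable.aemeasurable ?_
    refine Measurable.ennreal_ofReal ?_
    fun_prop

end GammaIntegrals

/-! ### The Schrödinger test case and the Funk–Hecke formula. -/

section SphereEnergy

theorem sphereExt_const_mul (c : ℂ) (h : Space d → ℂ) (x : Space d) :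
    sphereExt (fun ω => c * h ω) x = c * sphereExt h x := by
  simp only [sphereExt, mul_assoc, integral_const_mul]

theorem sphereExt_congr {h h' : Space d → ℂ}
    (hh : ∀ ω : Metric.sphere (0 : Space d) 1, h ω = h' ω) : sphereExt h = sphereExt h' := by
  ext x
  simp only [sphereExt, hh]

theorem sphereEnergy_const_mul (τ : ℝ) (c : ℂ) (h : Space d → ℂ) :
    sphereEnergy τ (fun ω => c * h ω) = ‖c‖ₑ ^ 2 * sphereEnergy τ h := by
  unfold sphereEnergy
  rw [← lintegral_const_mul' _ _ (by simp)]
  simp_rw [sphereExt_const_mul, enorm_mul, mul_pow, mul_assoc]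

theorem integrable_sphere {f : Space d → ℂ} (hf : Continuous f) :
    Integrable (fun ω : Metric.sphere (0 : Space d) 1 => f ω) (sphereMeasure d) :=
  (hf.comp continuous_subtype_val).integrable_of_hasCompactSupport
    (HasCompactSupport.of_compactSpace _)

theorem continuous_sphereExt {h : Space d → ℂ} (hh : Continuous h) : Continuous (sphereExt h) := by
  unfold sphereExt
  have : Continuous (Function.uncurry fun (x : Space d) (ω : Metric.sphere (0 : Space d) 1) =>
      h ω * Complex.exp (2 * Real.pi * Complex.I * ((inner ℝ x (ω : Space d) : ℝ) : ℂ))) := by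
    unfold Function.uncurry
    fun_prop
  have h2 := continuous_parametric_integral_of_continuous (μ := sphereMeasure d) this
    (isCompact_univ (X := Metric.sphere (0 : Space d) 1))
  simpa using h2

/-- The dispersion relation of the Schrödinger equation. -/
noncomputable def schrodingerPhase (ρ : ℝ) : ℝ := ρ ^ 2 / (4 * Real.pi)

/-- The smoothing function of the Schrödinger equation. -/
noncomputable def schrodingerSmoothing (τ ρ : ℝ) : ℝ := √(ρ / (2 * Real.pi) * ρ ^ (1 - τ))

theorem isSmoothingPair_schrodinger (τ : ℝ) :
    IsSmoothingPair τ schrodingerPhase (schrodingerSmoothing τ) := by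
  have hpi := Real.pi_pos
  have hder : ∀ ρ, HasDerivAt schrodingerPhase (ρ / (2 * Real.pi)) ρ := by
    intro ρ
    refine ((hasDerivAt_pow 2 ρ).div_const (4 * Real.pi)).congr_deriv ?_
    field_simp
    norm_num
    ring
  refine ⟨?_, ?_, ?_, ?_, ?_⟩
  · intro a ha b hb hab
    have ha : 0 < a := ha
    have hb : 0 < b := hb
    simp only [schrodingerPhase] at hab
    have h1 : a ^ 2 = b ^ 2 := by
      field_simp at hab
      exact hab
    exact (pow_left_inj₀ ha.le hb.le two_ne_zero).1 h1
  · exact fun ρ _ => (hder ρ).differentiableAt.differentiableWithinAt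
  · filter_upwards [ae_restrict_mem measurableSet_Ioi] with ρ hρ
    have hρ : 0 < ρ := hρ
    rw [(hder ρ).deriv]
    positivity
  · refine Measurable.aemeasurable ?_
    unfold schrodingerSmoothing
    fun_prop
  · intro ρ hρ
    rw [schrodingerSmoothing, Real.sq_sqrt (by positivity), (hder ρ).deriv, abs_of_pos (by positivity)]

/-- The profile whose Schrödinger evolution is, after smoothing, a Gaussian wave packet. -/
noncomputable def testProfile (τ : ℝ) (P : MvPolynomial (Fin d) ℂ) (ξ : Space d) : ℂ :=
  evalAt P ξ * ((Real.exp (-Real.pi * ‖ξ‖ ^ 2) / schrodingerSmoothing τ (2 * Real.pi * ‖ξ‖) : ℝ) : ℂ)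

theorem measurable_testProfile (τ : ℝ) (P : MvPolynomial (Fin d) ℂ) :
    Measurable (testProfile τ P) := by
  have := (continuous_evalAt P).measurable
  unfold testProfile schrodingerSmoothing
  fun_prop

theorem schrodingerSmoothing_pos {τ ρ : ℝ} (hρ : 0 < ρ) : 0 < schrodingerSmoothing τ ρ := by
  have := Real.pi_pos
  unfold schrodingerSmoothing
  positivity

theorem schrodingerSmoothing_mul_testProfile (hd : 2 ≤ d) (τ : ℝ) (P : MvPolynomial (Fin d) ℂ) :
    (fun ξ : Space d => (schrodingerSmoothing τ (2 * Real.pi * ‖ξ‖) : ℂ) * testProfile τ P ξ)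
      =ᵐ[volume] fun ξ => evalAt P ξ * gaussianWave (Real.pi : ℂ) 0 0 ξ := by
  have : Nontrivial (Space d) := by
    have : Nonempty (Fin d) := ⟨⟨0, by omega⟩⟩
    infer_instance
  filter_upwards [Measure.ae_ne volume (0 : Space d)] with v hv0
  have hpos : 0 < ‖v‖ := norm_pos_iff.2 hv0
  have h1 := schrodingerSmoothing_pos (τ := τ) (mul_pos Real.two_pi_pos hpos)
  have h2 : (schrodingerSmoothing τ (2 * Real.pi * ‖v‖) : ℂ) ≠ 0 := by exact_mod_cast h1.ne'
  rw [gaussianWave_zero, testProfile]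
  push_cast
  field_simp

theorem integrable_testProfile (hd : 2 ≤ d) (τ : ℝ) (P : MvPolynomial (Fin d) ℂ) :
    Integrable fun ξ : Space d =>
      (schrodingerSmoothing τ (2 * Real.pi * ‖ξ‖) : ℂ) * testProfile τ P ξ :=
  (integrable_evalAt_mul_gaussianWave P (b := (Real.pi : ℂ)) (by simpa using Real.pi_pos) 0 0).congr
    (schrodingerSmoothing_mul_testProfile hd τ P).symm

theorem waveField_congr_ae {φ : ℝ → ℝ} {V V' : Space d → ℂ} (h : V =ᵐ[volume] V') :
    waveField φ V = waveField φ V' := by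
  ext t x
  rw [waveField_eq, waveField_eq]
  refine integral_congr_ae ?_
  filter_upwards [h] with ξ hξ
  rw [hξ]

/-- This is the Hecke identity with b = π(1-it) and c = 2πi. The decisive feature is the form P(x)
times a function of |x|. -/
theorem waveField_testProfile (hd : 2 ≤ d) (τ : ℝ) {k : ℕ} {P : MvPolynomial (Fin d) ℂ}
    (hP : IsSolidHarmonic k P) (t : ℝ) (x : Space d) :
    waveField schrodingerPhase (fun ξ => (schrodingerSmoothing τ (2 * Real.pi * ‖ξ‖) : ℂ) *
      testProfile τ P ξ) t x =
    (Complex.I / (1 - t * Complex.I)) ^ k * evalAt P x * ((1 / (1 - t * Complex.I)) ^ ((d : ℂ) / 2) *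
      Complex.exp (-(Real.pi / (1 - t * Complex.I)) * ‖x‖ ^ 2)) := by
  have hpi : (Real.pi : ℂ) ≠ 0 := by exact_mod_cast Real.pi_ne_zero
  have hz : (1 - t * Complex.I : ℂ) ≠ 0 := by
    intro h
    have := congrArg Complex.re h
    simp at this
  rw [waveField_congr_ae (schrodingerSmoothing_mul_testProfile hd τ P), waveField]
  -- The phase ρ²/4π at ρ = 2π|ξ| is π|ξ|², so time evolution only changes the Gaussian parameter
  -- from π to π(1-it).
  have h1 : (fun ξ : Space d => Complex.exp (Complex.I * t * schrodingerPhase (2 * Real.pi * ‖ξ‖)) *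
      (evalAt P ξ * gaussianWave (Real.pi : ℂ) 0 0 ξ)) =
      fun ξ => evalAt P ξ * gaussianWave (Real.pi * (1 - t * Complex.I)) 0 0 ξ := by
    ext ξ
    rw [mul_left_comm, gaussianWave, gaussianWave, ← Complex.exp_add]
    congr 2
    simp only [schrodingerPhase]
    push_cast
    field_simp
    ring
  rw [h1, fourierInv_evalAt_mul_gaussianWave, gaussianMoment_solidHarmonic _ _ _ hP]
  · congr 2
    · congr 1
      field_simp
    · congr 1
      field_simp
    · congr 1
      rw [mul_pow, mul_pow, Complex.I_sq]
      field_simp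
      ring
  · simpa using Real.pi_pos

theorem testProfile_smul (τ : ℝ) {k : ℕ} {P : MvPolynomial (Fin d) ℂ}
    (hP : IsSolidHarmonic k P) {ρ : ℝ} (hρ : 0 < ρ) (ω : Metric.sphere (0 : Space d) 1) :
    testProfile τ P (ρ • (ω : Space d)) = ((ρ ^ k * (Real.exp (-Real.pi * ρ ^ 2) /
      schrodingerSmoothing τ (2 * Real.pi * ρ)) : ℝ) : ℂ) * evalAt P (ω : Space d) := by
  have e : ‖ρ • (ω : Space d)‖ = ρ := by
    rw [norm_smul, norm_eq_of_mem_sphere, mul_one, Real.norm_of_nonneg hρ.le]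
  rw [testProfile, e, evalAt_smul_of_isHomogeneous hP.1]
  push_cast; ring

/-- The Funk–Hecke formula, in the form of a proportionality. -/
theorem sphereExt_proportional (hd : 2 ≤ d) {k : ℕ} {P : MvPolynomial (Fin d) ℂ}
    (hP : IsSolidHarmonic k P) {x y : Space d} (hxy : ‖x‖ = ‖y‖) :
    evalAt P y * sphereExt (evalAt P) x = evalAt P x * sphereExt (evalAt P) y := by
  -- No weighted norm is evaluated here, so the exponent is immaterial.
  set τ : ℝ := 1
  set ψ := schrodingerSmoothing τ with hψ
  have hpair := isSmoothingPair_schrodinger τ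
  have hV := integrable_testProfile hd τ P
  obtain ⟨ix, ex⟩ := waveField_polar hd hpair hV x
  obtain ⟨iy, ey⟩ := waveField_polar hd hpair hV y
  have hpi := Real.two_pi_pos
  set m : ℝ → ℝ := fun ρ => ρ ^ (d - 1) * ψ (2 * Real.pi * ρ) *
    (ρ ^ k * (Real.exp (-Real.pi * ρ ^ 2) / ψ (2 * Real.pi * ρ))) with hm
  have hA : ∀ ρ ∈ Set.Ioi (0 : ℝ), ∀ z : Space d,
      ((ρ ^ (d - 1) * ψ (2 * Real.pi * ρ) : ℝ) : ℂ) *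
      sphereExt (fun ω => testProfile τ P (ρ • ω)) (ρ • z) =
        (m ρ : ℂ) * sphereExt (evalAt P) (ρ • z) := by
    intro ρ hρ z
    rw [sphereExt_congr (h' := fun ω => ((ρ ^ k * (Real.exp (-Real.pi * ρ ^ 2) /
        ψ (2 * Real.pi * ρ)) : ℝ) : ℂ) * evalAt P ω) (fun ω => testProfile_smul τ hP hρ ω),
      sphereExt_const_mul, ← mul_assoc, ← Complex.ofReal_mul]
  -- This combination is the amplitude of P(y) times the wave at x minus P(x) times the wave at y.
  have ia : IntegrableOn (fun ρ : ℝ => evalAt P y * (((ρ ^ (d - 1) * ψ (2 * Real.pi * ρ) : ℝ) : ℂ) *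
      sphereExt (fun ω => testProfile τ P (ρ • ω)) (ρ • x)) -
      evalAt P x * (((ρ ^ (d - 1) * ψ (2 * Real.pi * ρ) : ℝ) : ℂ) *
      sphereExt (fun ω => testProfile τ P (ρ • ω)) (ρ • y))) (Set.Ioi 0) :=
    (ix.const_mul _).sub (iy.const_mul _)
  have hinj : Set.InjOn (fun ρ => schrodingerPhase (2 * Real.pi * ρ)) (Set.Ioi 0) :=
    fun a ha b hb hab => mul_left_cancel₀ hpi.ne'
      (hpair.injOn (mul_pos hpi ha : (0 : ℝ) < _) (mul_pos hpi hb : (0 : ℝ) < _) hab)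
  have hder : ∀ ρ, HasDerivAt (fun ρ => schrodingerPhase (2 * Real.pi * ρ)) (2 * Real.pi * ρ) ρ := by
    intro ρ
    have h1 : (fun ρ => schrodingerPhase (2 * Real.pi * ρ)) = fun ρ => Real.pi * ρ ^ 2 := by
      ext ρ
      simp only [schrodingerPhase]
      have := Real.pi_pos
      field_simp
      ring
    rw [h1]
    refine ((hasDerivAt_pow 2 ρ).const_mul Real.pi).congr_deriv ?_
    push_cast; ring
  have key := lintegral_oscillatory_sq hinj
    (fun ρ _ => (hder ρ).differentiableAt.differentiableWithinAt)
    (by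
      filter_upwards [ae_restrict_mem measurableSet_Ioi] with ρ hρ
      rw [(hder ρ).deriv]
      exact (mul_pos hpi hρ).ne') ia
  -- Since ‖x‖ = ‖y‖, the explicit evolution has the same radial factor at both points, so the
  -- combination vanishes at every time. Plancherel in t then makes the amplitude vanish for almost
  -- every ρ.
  have hzero : ∀ t : ℝ, ∫ ρ in Set.Ioi (0 : ℝ), Complex.exp (Complex.I * t *
      schrodingerPhase (2 * Real.pi * ρ)) *
      (evalAt P y * (((ρ ^ (d - 1) * ψ (2 * Real.pi * ρ) : ℝ) : ℂ) *
      sphereExt (fun ω => testProfile τ P (ρ • ω)) (ρ • x)) -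
      evalAt P x * (((ρ ^ (d - 1) * ψ (2 * Real.pi * ρ) : ℝ) : ℂ) *
      sphereExt (fun ω => testProfile τ P (ρ • ω)) (ρ • y))) = 0 := by
    intro t
    have hb : ∀ f : ℝ → ℂ, IntegrableOn f (Set.Ioi 0) → IntegrableOn (fun ρ : ℝ =>
        Complex.exp (Complex.I * t * schrodingerPhase (2 * Real.pi * ρ)) * f ρ) (Set.Ioi 0) := by
      intro f hf
      refine Integrable.bdd_mul hf (c := 1) ?_ ?_
      · unfold schrodingerPhase
        exact Continuous.aestronglyMeasurable (by fun_prop)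
      · refine Filter.Eventually.of_forall fun ρ => ?_
        have e1 : Complex.I * t * schrodingerPhase (2 * Real.pi * ρ) =
          ((t * schrodingerPhase (2 * Real.pi * ρ) : ℝ) : ℂ) * Complex.I := by push_cast; ring
        rw [e1, Complex.norm_exp_ofReal_mul_I]
    simp_rw [mul_sub, mul_left_comm _ (evalAt P _)]
    rw [integral_sub ((hb _ ix).const_mul _) ((hb _ iy).const_mul _), integral_const_mul,
      integral_const_mul, ← ex t, ← ey t, waveField_testProfile hd τ hP, waveField_testProfile hd τ hP,
      hxy]
    ring
  simp_rw [hzero] at key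
  simp only [enorm_zero, ne_eq, OfNat.ofNat_ne_zero, not_false_eq_true, zero_pow, lintegral_zero]
    at key
  have h0 := (mul_eq_zero.1 key.symm).resolve_left (by simpa using Real.pi_pos)
  replace h0 := (lintegral_eq_zero_iff' ((ia.1.enorm.pow_const 2).mul
    (measurable_deriv _).abs.inv.ennreal_ofReal.aemeasurable)).1 h0
  have hD : Continuous fun ρ : ℝ => evalAt P y * sphereExt (evalAt P) (ρ • x) -
      evalAt P x * sphereExt (evalAt P) (ρ • y) := by
    have := continuous_sphereExt (continuous_evalAt P)
    fun_prop
  -- After division by the positive factor m ρ, continuity in ρ removes the null set, and ρ = 1 is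
  -- admissible.
  have h1 : Set.EqOn (fun ρ : ℝ => evalAt P y * sphereExt (evalAt P) (ρ • x) -
      evalAt P x * sphereExt (evalAt P) (ρ • y)) (fun _ => 0) (Set.Ioi 0) := by
    refine Measure.eqOn_open_of_ae_eq (μ := volume) ?_ isOpen_Ioi hD.continuousOn continuousOn_const
    filter_upwards [h0, ae_restrict_mem measurableSet_Ioi] with ρ h0 hρ
    have hρ' : 0 < ρ := hρ
    have hψpos : 0 < ψ (2 * Real.pi * ρ) := schrodingerSmoothing_pos (mul_pos hpi hρ')
    have hmpos : 0 < m ρ := by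
      simp only [hm]
      positivity
    have hdpos : 0 < |deriv (fun ρ => schrodingerPhase (2 * Real.pi * ρ)) ρ|⁻¹ := by
      rw [(hder ρ).deriv]
      positivity
    simp only [Pi.mul_apply, Pi.inv_apply, Pi.zero_apply] at h0
    have h2 := (mul_eq_zero.1 h0).resolve_right (ENNReal.ofReal_pos.2 hdpos).ne'
    rw [sq_eq_zero_iff, enorm_eq_zero, hA ρ hρ, hA ρ hρ, mul_left_comm, mul_left_comm (evalAt P x),
      ← mul_sub] at h2
    exact (mul_eq_zero.1 h2).resolve_left (by exact_mod_cast hmpos.ne')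
  have h2 := h1 (Set.mem_Ioi.2 one_pos)
  simp only [one_smul] at h2
  exact sub_eq_zero.1 h2

end SphereEnergy

end AngularSmoothing

namespace AngularSmoothing

open MeasureTheory
open scoped FourierTransform ENNReal ComplexConjugate

variable {d : ℕ}

/-! ### The eigenvalues of the sphere energy. -/

section SphereEnergyValue

/-- The constant `β_k` without the factor `|θ(μ_k)|²`. -/
noncomputable def angularConst (d : ℕ) (τ : ℝ) (k : ℕ) : ℝ :=
  Real.pi * (2 : ℝ) ^ (2 - τ) *
    (Real.Gamma (τ - 1) * Real.Gamma ((k : ℝ) + ((d : ℝ) - τ) / 2) /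
      (Real.Gamma (τ / 2) ^ 2 * Real.Gamma ((k : ℝ) + ((d : ℝ) + τ) / 2 - 1)))

theorem beta_eq (τ : ℝ) (θ : ℝ → ℂ) (k : ℕ) :
    beta d τ θ k = ENNReal.ofReal (angularConst d τ k * ‖θ (sphereEigenvalue d k)‖ ^ 2) := rfl

/-- Legendre's duplication formula at τ/2 - 1/2. The right-hand side is the form in which the time
integral of the Gaussian wave produces the constant. -/
theorem angularConst_eq {τ : ℝ} (hτ : 1 < τ) (k : ℕ) :
    angularConst d τ k = √Real.pi * Real.Gamma (τ / 2 - 1 / 2) / Real.Gamma (τ / 2) *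
      (Real.Gamma ((k : ℝ) + ((d : ℝ) - τ) / 2) / Real.Gamma ((k : ℝ) + ((d : ℝ) + τ) / 2 - 1)) := by
  have h := Real.Gamma_mul_Gamma_add_half (τ / 2 - 1 / 2)
  rw [show τ / 2 - 1 / 2 + 1 / 2 = τ / 2 by ring, show 2 * (τ / 2 - 1 / 2) = τ - 1 by ring,
    show 1 - (τ - 1) = 2 - τ by ring] at h
  have h0 : Real.Gamma (τ / 2) ≠ 0 := (Real.Gamma_pos_of_pos (by linarith)).ne'
  have h1 : √Real.pi * Real.Gamma (τ / 2 - 1 / 2) / Real.Gamma (τ / 2) =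
      Real.pi * 2 ^ (2 - τ) * Real.Gamma (τ - 1) / Real.Gamma (τ / 2) ^ 2 := by
    rw [div_eq_div_iff h0 (pow_ne_zero 2 h0)]
    have hs := Real.mul_self_sqrt Real.pi_pos.le
    calc _ = √Real.pi * (Real.Gamma (τ / 2 - 1 / 2) * Real.Gamma (τ / 2)) * Real.Gamma (τ / 2) := by
          ring
      _ = (√Real.pi * √Real.pi) * 2 ^ (2 - τ) * Real.Gamma (τ - 1) * Real.Gamma (τ / 2) := by
          rw [h]; ring
      _ = _ := by rw [hs]
  rw [h1, angularConst]
  ring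

theorem angularConst_pos {τ : ℝ} (hτ : τ ∈ Set.Ioo (1 : ℝ) d) (k : ℕ) : 0 < angularConst d τ k := by
  obtain ⟨h1, h2⟩ := hτ
  have hk : (0 : ℝ) ≤ k := Nat.cast_nonneg k
  have g1 := Real.Gamma_pos_of_pos (show 0 < τ - 1 by linarith)
  have g2 := Real.Gamma_pos_of_pos (show 0 < τ / 2 by linarith)
  have g3 := Real.Gamma_pos_of_pos (show 0 < (k : ℝ) + ((d : ℝ) - τ) / 2 by linarith)
  have g4 := Real.Gamma_pos_of_pos (show 0 < (k : ℝ) + ((d : ℝ) + τ) / 2 - 1 by linarith)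
  have := Real.pi_pos
  unfold angularConst
  positivity

/-- In polar coordinates the radial integrand is r^{d-1+2k-τ} e^{-br²}; the condition τ < d makes it
integrable at 0 even for k = 0. -/
theorem lintegral_evalAt_sq_mul_gaussian (hd : 2 ≤ d) {k : ℕ} {P : MvPolynomial (Fin d) ℂ}
    (hP : P.IsHomogeneous k) {b τ : ℝ} (hb : 0 < b) (hτ : τ < d) :
    ∫⁻ x : Space d, ‖evalAt P x‖ₑ ^ 2 * ENNReal.ofReal (Real.exp (-b * ‖x‖ ^ 2)) *
      ENNReal.ofReal (‖x‖ ^ (-τ)) =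
    ENNReal.ofReal (b ^ (-((k : ℝ) + (d - τ) / 2)) * (1 / 2) * Real.Gamma ((k : ℝ) + (d - τ) / 2)) *
      ∫⁻ ω, ‖evalAt P (ω : Space d)‖ₑ ^ 2 ∂(sphereMeasure d) := by
  have hm := (continuous_evalAt P).measurable
  rw [lintegral_polar hd (Measurable.aemeasurable (by fun_prop))]
  have hk : (0 : ℝ) ≤ k := Nat.cast_nonneg k
  have hq : (-1 : ℝ) < d - 1 + 2 * k - τ := by linarith
  have h1 := lintegral_rpow_mul_exp (p := 2) (q := d - 1 + 2 * k - τ) two_pos hq hb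
  rw [show -((d : ℝ) - 1 + 2 * k - τ + 1) / 2 = -((k : ℝ) + (d - τ) / 2) by ring,
    show ((d : ℝ) - 1 + 2 * k - τ + 1) / 2 = (k : ℝ) + (d - τ) / 2 by ring] at h1
  rw [← h1, ← lintegral_mul_const' _ _ ?_]
  · refine setLIntegral_congr_fun measurableSet_Ioi fun r hr => ?_
    have hr : 0 < r := hr
    have e : ∀ ω : Metric.sphere (0 : Space d) 1, ‖r • (ω : Space d)‖ = r := fun ω => by
      rw [norm_smul, norm_eq_of_mem_sphere, mul_one, Real.norm_of_nonneg hr.le]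
    have e2 : ∀ ω : Metric.sphere (0 : Space d) 1, ‖evalAt P (r • (ω : Space d))‖ₑ ^ 2 *
        ENNReal.ofReal (Real.exp (-b * ‖r • (ω : Space d)‖ ^ 2)) *
        ENNReal.ofReal (‖r • (ω : Space d)‖ ^ (-τ)) =
        ENNReal.ofReal (r ^ (2 * k) * Real.exp (-b * r ^ 2) * r ^ (-τ)) *
          ‖evalAt P (ω : Space d)‖ₑ ^ 2 := by
      intro ω
      have e3 : ‖((r : ℂ) ^ k)‖ₑ = ENNReal.ofReal (r ^ k) := by
        rw [← ofReal_norm, norm_pow, Complex.norm_of_nonneg hr.le]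
      rw [e, evalAt_smul_of_isHomogeneous hP, enorm_mul, e3, mul_pow,
        ← ENNReal.ofReal_pow (by positivity), ENNReal.ofReal_mul (by positivity),
        ENNReal.ofReal_mul (by positivity), ← pow_mul, mul_comm k 2]
      ring
    simp only [e2]
    rw [lintegral_const_mul' _ _ ENNReal.ofReal_ne_top, ← mul_assoc,
      ← ENNReal.ofReal_mul (by positivity)]
    congr 2
    have e4 : r ^ ((d : ℝ) - 1 + 2 * k - τ) = r ^ (d - 1) * r ^ (2 * k) * r ^ (-τ) := by
      rw [← pow_add, ← Real.rpow_natCast, ← Real.rpow_add hr]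
      congr 1
      push_cast [Nat.cast_sub (by omega : 1 ≤ d)]
      ring
    rw [e4, Real.rpow_two]
    ring
  · have hc := ((continuous_evalAt P).comp continuous_subtype_val :
      Continuous fun ω : Metric.sphere (0 : Space d) 1 => evalAt P (ω : Space d))
    have := memLp_two_iff (μ := sphereMeasure d) hc.aestronglyMeasurable
    refine (this.1 ?_).ne
    exact hc.memLp_of_hasCompactSupport (HasCompactSupport.of_compactSpace _)

/-- The modulus of the explicit wave, from |1-it|² = 1+t² and Re 1/(1-it) = 1/(1+t²). -/
theorem enorm_sq_waveField_testProfile (hd : 2 ≤ d) (τ : ℝ) {k : ℕ} {P : MvPolynomial (Fin d) ℂ}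
    (hP : IsSolidHarmonic k P) (t : ℝ) (x : Space d) :
    ‖waveField schrodingerPhase (fun ξ => (schrodingerSmoothing τ (2 * Real.pi * ‖ξ‖) : ℂ) *
      testProfile τ P ξ) t x‖ₑ ^ 2 =
    ENNReal.ofReal ((1 + t ^ 2) ^ (-((k : ℝ) + d / 2))) * (‖evalAt P x‖ₑ ^ 2 *
      ENNReal.ofReal (Real.exp (-(2 * Real.pi / (1 + t ^ 2)) * ‖x‖ ^ 2))) := by
  have hn : (0 : ℝ) < 1 + t ^ 2 := by positivity
  set z : ℂ := 1 - t * Complex.I with hz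
  have hnz : Complex.normSq z = 1 + t ^ 2 := by
    simp [hz, Complex.normSq_apply]; ring
  have hzn : ‖z‖ ^ 2 = 1 + t ^ 2 := by rw [← Complex.normSq_eq_norm_sq, hnz]
  have hz0 : 0 < ‖z‖ := by
    rcases (norm_nonneg z).lt_or_eq with h | h
    · exact h
    · rw [← h] at hzn; nlinarith
  have hz1 : ‖z‖ = (1 + t ^ 2) ^ (1 / 2 : ℝ) := by
    rw [← hzn, ← Real.rpow_natCast, ← Real.rpow_mul hz0.le]; norm_num
  have hre : (1 / z).re = 1 / (1 + t ^ 2) := by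
    rw [one_div, Complex.inv_re, hnz]; simp [hz]
  rw [waveField_testProfile hd τ hP]
  rw [← ofReal_norm, ← ofReal_norm (evalAt P x), ← ENNReal.ofReal_pow (norm_nonneg _),
    ← ENNReal.ofReal_pow (norm_nonneg _), ← ENNReal.ofReal_mul (by positivity),
    ← ENNReal.ofReal_mul (by positivity)]
  congr 1
  have hcp : ‖(1 / z) ^ ((d : ℂ) / 2)‖ = ‖1 / z‖ ^ ((d : ℝ) / 2) := by
    rw [show ((d : ℂ) / 2) = (((d : ℝ) / 2 : ℝ) : ℂ) by push_cast; rfl, Complex.norm_cpow_real]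
  have hexp : ‖Complex.exp (-(Real.pi / z) * ‖x‖ ^ 2)‖ =
      Real.exp (-(Real.pi / (1 + t ^ 2)) * ‖x‖ ^ 2) := by
    rw [Complex.norm_exp]
    congr 1
    have e : -(Real.pi / z : ℂ) * ‖x‖ ^ 2 = ((-Real.pi * ‖x‖ ^ 2 : ℝ) : ℂ) * (1 / z) := by
      push_cast; ring
    rw [e, Complex.re_ofReal_mul, hre]
    ring
  rw [norm_mul, norm_mul, norm_mul, hcp, hexp, norm_pow, norm_div, norm_div, Complex.norm_I, norm_one,
    mul_pow, mul_pow, mul_pow]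
  have e1 : ((1 / ‖z‖) ^ k) ^ 2 * ((1 / ‖z‖) ^ ((d : ℝ) / 2)) ^ 2 =
      (1 + t ^ 2) ^ (-((k : ℝ) + d / 2)) := by
    have e2 : 1 / ‖z‖ = (1 + t ^ 2) ^ (-(1 / 2) : ℝ) := by
      rw [hz1, Real.rpow_neg hn.le, one_div]
    rw [e2]
    generalize (1 + t ^ 2 : ℝ) = n at hn
    rw [← Real.rpow_natCast, ← Real.rpow_natCast, ← Real.rpow_natCast, ← Real.rpow_mul hn.le,
      ← Real.rpow_mul hn.le, ← Real.rpow_mul hn.le, ← Real.rpow_mul hn.le, ← Real.rpow_add hn]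
    congr 1
    push_cast; ring
  have e3 : Real.exp (-(Real.pi / (1 + t ^ 2)) * ‖x‖ ^ 2) ^ 2 =
      Real.exp (-(2 * Real.pi / (1 + t ^ 2)) * ‖x‖ ^ 2) := by
    rw [← Real.exp_nat_mul]
    congr 1
    push_cast; ring
  rw [← e1, e3]
  ring

/-- The spatial integral scales like (1+t²)^{k+(d-τ)/2} against the amplitude (1+t²)^{-k-d/2}. The
time integrand is thus (1+t²)^{-τ/2}, which is integrable because τ > 1. -/
theorem weightedIntegral_testProfile (hd : 2 ≤ d) {τ : ℝ} (hτ : τ ∈ Set.Ioo (1 : ℝ) d) {k : ℕ}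
    {P : MvPolynomial (Fin d) ℂ} (hP : IsSolidHarmonic k P) :
    weightedIntegral τ (waveField schrodingerPhase
      (fun ξ : Space d => (schrodingerSmoothing τ (2 * Real.pi * ‖ξ‖) : ℂ) * testProfile τ P ξ)) =
    ENNReal.ofReal ((2 * Real.pi) ^ (-((k : ℝ) + (d - τ) / 2)) * (1 / 2) *
      Real.Gamma ((k : ℝ) + (d - τ) / 2) *
      (√Real.pi * Real.Gamma (τ / 2 - 1 / 2) / Real.Gamma (τ / 2))) *
      ∫⁻ ω, ‖evalAt P (ω : Space d)‖ₑ ^ 2 ∂(sphereMeasure d) := by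
  obtain ⟨hτ1, hτ2⟩ := hτ
  have hpi := Real.pi_pos
  have hk : (0 : ℝ) ≤ k := Nat.cast_nonneg k
  have g3 := Real.Gamma_pos_of_pos (show 0 < (k : ℝ) + ((d : ℝ) - τ) / 2 by linarith)
  have h1 : ∀ t : ℝ, ∫⁻ x : Space d, ‖waveField schrodingerPhase (fun ξ : Space d =>
      (schrodingerSmoothing τ (2 * Real.pi * ‖ξ‖) : ℂ) * testProfile τ P ξ) t x‖ₑ ^ 2 *
      ENNReal.ofReal (‖x‖ ^ (-τ)) =
      ENNReal.ofReal ((1 + t ^ 2) ^ (-(τ / 2))) * (ENNReal.ofReal ((2 * Real.pi) ^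
        (-((k : ℝ) + (d - τ) / 2)) * (1 / 2) * Real.Gamma ((k : ℝ) + (d - τ) / 2)) *
        ∫⁻ ω, ‖evalAt P (ω : Space d)‖ₑ ^ 2 ∂(sphereMeasure d)) := by
    intro t
    have hn : (0 : ℝ) < 1 + t ^ 2 := by positivity
    simp_rw [enorm_sq_waveField_testProfile hd τ hP, mul_assoc]
    rw [lintegral_const_mul' _ _ ENNReal.ofReal_ne_top]
    simp_rw [← mul_assoc]
    rw [lintegral_evalAt_sq_mul_gaussian hd hP.1 (by positivity) hτ2, ← mul_assoc,
      ← ENNReal.ofReal_mul (by positivity), ← ENNReal.ofReal_mul (by positivity)]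
    congr 2
    rw [Real.div_rpow (by positivity) hn.le]
    have e : (1 + t ^ 2 : ℝ) ^ (-((k : ℝ) + d / 2)) =
        (1 + t ^ 2) ^ (-(τ / 2)) * (1 + t ^ 2) ^ (-((k : ℝ) + (d - τ) / 2)) := by
      rw [← Real.rpow_add hn]; congr 1; ring
    rw [e]
    have := Real.rpow_pos_of_pos hn (-((k : ℝ) + (d - τ) / 2))
    field_simp
  rw [weightedIntegral]
  simp_rw [h1]
  rw [lintegral_mul_const _ (by fun_prop), lintegral_one_add_sq_rpow (by linarith), ← mul_assoc,
    ← ENNReal.ofReal_mul' (by positivity), mul_comm (_ / _)]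

/-- For the Schrödinger test profile `weightedIntegral_waveField` can be solved for the sphere
energy: the left side is explicit, and on the right every sphere carries a multiple of P, so the
ρ-integral is a Gamma integral. -/
theorem sphereEnergy_solidHarmonic (hd : 2 ≤ d) {τ : ℝ} (hτ : τ ∈ Set.Ioo (1 : ℝ) d) {k : ℕ}
    {P : MvPolynomial (Fin d) ℂ} (hP : IsSolidHarmonic k P) :
    ENNReal.ofReal ((2 * Real.pi) ^ (1 - τ)) * sphereEnergy τ (evalAt P) =
      ENNReal.ofReal (angularConst d τ k) *
        ∫⁻ ω, ‖evalAt P (ω : Space d)‖ₑ ^ 2 ∂(sphereMeasure d) := by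
  have h1 := weightedIntegral_waveField hd (isSmoothingPair_schrodinger τ) (measurable_testProfile τ P)
    (integrable_testProfile hd τ P)
  rw [weightedIntegral_testProfile hd hτ hP] at h1
  obtain ⟨hτ1, hτ2⟩ := hτ
  have hpi := Real.pi_pos
  have hpi2 := Real.two_pi_pos
  have hk : (0 : ℝ) ≤ k := Nat.cast_nonneg k
  have g3 := Real.Gamma_pos_of_pos (show 0 < (k : ℝ) + ((d : ℝ) - τ) / 2 by linarith)
  have g4 := Real.Gamma_pos_of_pos (show 0 < (k : ℝ) + ((d : ℝ) + τ) / 2 - 1 by linarith)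
  have g5 := Real.Gamma_pos_of_pos (show 0 < τ / 2 by linarith)
  have g6 := Real.Gamma_pos_of_pos (show 0 < τ / 2 - 1 / 2 by linarith)
  have h2 : ∀ ρ ∈ Set.Ioi (0 : ℝ), ENNReal.ofReal (ρ ^ (d - 1)) *
      sphereEnergy τ (fun ω : Space d => testProfile τ P (ρ • ω)) =
      ENNReal.ofReal ((2 * Real.pi) ^ (τ - 1)) * sphereEnergy τ (evalAt P) *
      ENNReal.ofReal (ρ ^ ((d : ℝ) + 2 * k + τ - 3) * Real.exp (-(2 * Real.pi) * ρ ^ (2 : ℝ))) := by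
    intro ρ hρ
    have hρ : 0 < ρ := hρ
    have e0 : sphereEnergy τ (fun ω : Space d => testProfile τ P (ρ • ω)) =
        sphereEnergy τ (fun ω => ((ρ ^ k * (Real.exp (-Real.pi * ρ ^ 2) /
          schrodingerSmoothing τ (2 * Real.pi * ρ)) : ℝ) : ℂ) * evalAt P ω) := by
      unfold sphereEnergy
      rw [sphereExt_congr (h' := fun ω => ((ρ ^ k * (Real.exp (-Real.pi * ρ ^ 2) /
          schrodingerSmoothing τ (2 * Real.pi * ρ)) : ℝ) : ℂ) * evalAt P ω)
        (fun ω => testProfile_smul τ hP hρ ω)]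
    have hsm := schrodingerSmoothing_pos (τ := τ) (mul_pos hpi2 hρ)
    rw [e0, sphereEnergy_const_mul, ← ofReal_norm, Complex.norm_of_nonneg (by positivity),
      ← ENNReal.ofReal_pow (by positivity), ← mul_assoc, ← ENNReal.ofReal_mul (by positivity),
      mul_right_comm (ENNReal.ofReal _), ← ENNReal.ofReal_mul (by positivity)]
    congr 2
    have e1 : schrodingerSmoothing τ (2 * Real.pi * ρ) ^ 2 =
        (2 * Real.pi) ^ (1 - τ) * ρ ^ (2 - τ) := by
      rw [schrodingerSmoothing, Real.sq_sqrt (by positivity), Real.mul_rpow hpi2.le hρ.le,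
        show 2 - τ = 1 + (1 - τ) by ring, Real.rpow_add hρ, Real.rpow_one]
      field_simp
    have e2 : Real.exp (-Real.pi * ρ ^ 2) ^ 2 = Real.exp (-(2 * Real.pi) * ρ ^ (2 : ℝ)) := by
      rw [← Real.exp_nat_mul, Real.rpow_two]; congr 1; push_cast; ring
    have e3 : ρ ^ ((d : ℝ) + 2 * k + τ - 3) = ρ ^ (d - 1) * (ρ ^ k) ^ 2 * (ρ ^ (2 - τ))⁻¹ := by
      rw [← pow_mul, ← pow_add, ← Real.rpow_natCast, ← Real.rpow_neg hρ.le, ← Real.rpow_add hρ]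
      congr 1
      push_cast [Nat.cast_sub (by omega : 1 ≤ d)]
      ring
    rw [mul_pow, div_pow, e1, e2, e3, show τ - 1 = -(1 - τ) by ring, Real.rpow_neg hpi2.le]
    field_simp
  rw [setLIntegral_congr_fun measurableSet_Ioi h2, lintegral_const_mul _ (by fun_prop),
    lintegral_rpow_mul_exp two_pos (by linarith) hpi2,
    show -((d : ℝ) + 2 * k + τ - 3 + 1) / 2 = -((k : ℝ) + (d - τ) / 2) + (1 - τ) by ring,
    show ((d : ℝ) + 2 * k + τ - 3 + 1) / 2 = (k : ℝ) + (d + τ) / 2 - 1 by ring] at h1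
  set S := ∫⁻ ω, ‖evalAt P (ω : Space d)‖ₑ ^ 2 ∂(sphereMeasure d)
  set q := sphereEnergy τ (evalAt P)
  set X : ℝ := (2 * Real.pi) ^ (-((k : ℝ) + (d - τ) / 2)) * (1 / 2) *
    Real.Gamma ((k : ℝ) + (d + τ) / 2 - 1) with hX
  have hXpos : 0 < X := by positivity
  -- X is the radial Gamma integral without its power of 2π. It is positive and finite, so it can be
  -- cancelled.
  have e4 : ENNReal.ofReal X * (ENNReal.ofReal (angularConst d τ k) * S) =
      ENNReal.ofReal X * (ENNReal.ofReal ((2 * Real.pi) ^ (1 - τ)) * q) := by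
    rw [← mul_assoc, ← ENNReal.ofReal_mul hXpos.le]
    refine Eq.trans ?_ (h1.trans ?_)
    · congr 2
      rw [angularConst_eq hτ1, hX]
      generalize Real.Gamma ((k : ℝ) + (d + τ) / 2 - 1) = G at g4
      field_simp
    · have e5 : ((2 * Real.pi) ^ (-((k : ℝ) + (d - τ) / 2) + (1 - τ)) * (1 / 2) *
          Real.Gamma ((k : ℝ) + (d + τ) / 2 - 1)) = X * (2 * Real.pi) ^ (1 - τ) := by
        rw [Real.rpow_add hpi2, hX]; ring
      have e6 : ENNReal.ofReal ((2 * Real.pi) ^ (1 - τ)) * ENNReal.ofReal ((2 * Real.pi) ^ (τ - 1))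
          = 1 := by
        rw [← ENNReal.ofReal_mul (by positivity), ← Real.rpow_add hpi2]
        simp
      rw [e5, ENNReal.ofReal_mul hXpos.le]
      calc _ = (ENNReal.ofReal ((2 * Real.pi) ^ (1 - τ)) * ENNReal.ofReal ((2 * Real.pi) ^ (τ - 1))) *
            (ENNReal.ofReal X * (ENNReal.ofReal ((2 * Real.pi) ^ (1 - τ)) * q)) := by ring
        _ = _ := by rw [e6, one_mul]
  exact ((ENNReal.mul_right_inj (ENNReal.ofReal_pos.2 hXpos).ne' ENNReal.ofReal_ne_top).1 e4).symm

end SphereEnergyValue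

end AngularSmoothing

namespace AngularSmoothing

open MeasureTheory
open scoped FourierTransform ENNReal ComplexConjugate

variable {d : ℕ}

/-! ### Additivity of the sphere energy over degrees. -/

section SphereEnergySum

/-- The Funk–Hecke formula. -/
theorem exists_sphereExt_eq_mul (hd : 2 ≤ d) {k : ℕ} {P : MvPolynomial (Fin d) ℂ}
    (hP : IsSolidHarmonic k P) {r : ℝ} (hr : 0 < r) :
    ∃ c : ℂ, ∀ ω : Metric.sphere (0 : Space d) 1,
      sphereExt (evalAt P) (r • (ω : Space d)) = c * evalAt P (ω : Space d) := by
  by_cases h0 : ∀ ω : Metric.sphere (0 : Space d) 1, evalAt P (ω : Space d) = 0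
  · refine ⟨0, fun ω => ?_⟩
    simp [sphereExt, h0]
  · push Not at h0
    obtain ⟨η, hη⟩ := h0
    refine ⟨sphereExt (evalAt P) (r • (η : Space d)) / evalAt P (η : Space d), fun ω => ?_⟩
    have h1 := sphereExt_proportional hd hP (x := r • (ω : Space d)) (y := r • (η : Space d))
      (by rw [norm_smul, norm_smul, norm_eq_of_mem_sphere, norm_eq_of_mem_sphere])
    rw [evalAt_smul_of_isHomogeneous hP.1, evalAt_smul_of_isHomogeneous hP.1, mul_assoc, mul_assoc]
      at h1
    have hrk : (r : ℂ) ^ k ≠ 0 := pow_ne_zero _ (by exact_mod_cast hr.ne')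
    have h2 := mul_left_cancel₀ hrk h1
    field_simp
    linear_combination h2

theorem enorm_sq_sum_of_pairwise_orthogonal {E ι : Type*} [NormedAddCommGroup E]
    [InnerProductSpace ℂ E] (s : Finset ι) (f : ι → E)
    (h : ∀ i j, i ≠ j → inner ℂ (f i) (f j) = 0) :
    ‖∑ i ∈ s, f i‖ₑ ^ 2 = ∑ i ∈ s, ‖f i‖ₑ ^ 2 := by
  classical
  induction s using Finset.induction_on with
  | empty => simp
  | insert i s hi ih =>
    have h1 : inner ℂ (f i) (∑ j ∈ s, f j) = 0 := by
      rw [inner_sum]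
      exact Finset.sum_eq_zero fun j hj => h i j (fun hij => hi (hij ▸ hj))
    have h2 := norm_add_sq_eq_norm_sq_add_norm_sq_of_inner_eq_zero _ _ h1
    rw [Finset.sum_insert hi, Finset.sum_insert hi, ← ih, ← ofReal_norm, ← ofReal_norm, ← ofReal_norm,
      ← ENNReal.ofReal_pow (norm_nonneg _), ← ENNReal.ofReal_pow (norm_nonneg _),
      ← ENNReal.ofReal_pow (norm_nonneg _), ← ENNReal.ofReal_add (by positivity) (by positivity)]
    congr 1
    nlinarith

theorem memLp_two_sphere {f : Space d → ℂ} (hf : Continuous f) :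
    MemLp (fun ω : Metric.sphere (0 : Space d) 1 => f ω) 2 (sphereMeasure d) :=
  (hf.comp continuous_subtype_val).memLp_of_hasCompactSupport (HasCompactSupport.of_compactSpace _)

theorem lintegral_sphere_sum_sq (hd : 2 ≤ d) (s : Finset ℕ) {P : ℕ → MvPolynomial (Fin d) ℂ}
    (hP : ∀ k, IsSolidHarmonic k (P k)) :
    ∫⁻ ω, ‖∑ k ∈ s, evalAt (P k) (ω : Space d)‖ₑ ^ 2 ∂(sphereMeasure d) =
      ∑ k ∈ s, ∫⁻ ω, ‖evalAt (P k) (ω : Space d)‖ₑ ^ 2 ∂(sphereMeasure d) := by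
  have hm := fun k => memLp_two_sphere (continuous_evalAt (P k))
  have h := enorm_sq_sum_of_pairwise_orthogonal s (fun k => (hm k).toLp _) (by
    intro k l hkl
    rw [L2.inner_def, ← integral_sphere_conj_mul_eq_zero hd hkl (hP k) (hP l)]
    refine integral_congr_ae ?_
    filter_upwards [(hm k).coeFn_toLp, (hm l).coeFn_toLp] with ω h1 h2
    rw [h1, h2, RCLike.inner_apply, mul_comm])
  simp_rw [enorm_sq_Lp] at h
  rw [show (∫⁻ ω, ‖∑ k ∈ s, evalAt (P k) (ω : Space d)‖ₑ ^ 2 ∂(sphereMeasure d)) =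
    ∫⁻ ω, ‖((∑ k ∈ s, (hm k).toLp _ : Lp ℂ 2 (sphereMeasure d)) : _ → ℂ) ω‖ₑ ^ 2
      ∂(sphereMeasure d) from ?_, h]
  · refine Finset.sum_congr rfl fun k _ => lintegral_congr_ae ?_
    filter_upwards [(hm k).coeFn_toLp] with ω h1
    rw [h1]
  · refine lintegral_congr_ae ?_
    have h3 : ∀ᵐ ω ∂(sphereMeasure d), ∀ k, ((hm k).toLp _ : _ → ℂ) ω = evalAt (P k) (ω : Space d) :=
      ae_all_iff.2 fun k => (hm k).coeFn_toLp
    filter_upwards [h3, Lp.coeFn_finsetSum s fun k => (hm k).toLp _] with ω h1 h2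
    rw [h2]
    simp [h1]

theorem sphereExt_sum (s : Finset ℕ) {f : ℕ → Space d → ℂ} (hf : ∀ k, Continuous (f k))
    (x : Space d) :
    sphereExt (fun ω => ∑ k ∈ s, f k ω) x = ∑ k ∈ s, sphereExt (f k) x := by
  unfold sphereExt
  simp_rw [Finset.sum_mul]
  refine integral_finsetSum s fun k _ => ?_
  exact integrable_sphere (f := fun ω => f k ω *
    Complex.exp (2 * Real.pi * Complex.I * ((inner ℝ x ω : ℝ) : ℂ))) ((hf k).mul (by fun_prop))

/-- By Funk–Hecke each extension restricts, on the sphere of radius r, to a multiple of its own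
harmonic, so different degrees stay orthogonal. -/
theorem lintegral_sphere_sphereExt_sum_sq (hd : 2 ≤ d) (s : Finset ℕ)
    {P : ℕ → MvPolynomial (Fin d) ℂ} (hP : ∀ k, IsSolidHarmonic k (P k)) {r : ℝ} (hr : 0 < r) :
    ∫⁻ ω, ‖∑ k ∈ s, sphereExt (evalAt (P k)) (r • (ω : Space d))‖ₑ ^ 2 ∂(sphereMeasure d) =
      ∑ k ∈ s, ∫⁻ ω, ‖sphereExt (evalAt (P k)) (r • (ω : Space d))‖ₑ ^ 2 ∂(sphereMeasure d) := by
  choose c hc using fun k => exists_sphereExt_eq_mul hd (hP k) hr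
  have := lintegral_sphere_sum_sq hd s (P := fun k => c k • P k) fun k => (hP k).smul _
  simpa [evalAt_smul, hc] using this

theorem sphereEnergy_sum (hd : 2 ≤ d) (τ : ℝ) (s : Finset ℕ)
    {P : ℕ → MvPolynomial (Fin d) ℂ} (hP : ∀ k, IsSolidHarmonic k (P k)) :
    sphereEnergy τ (fun ω => ∑ k ∈ s, evalAt (P k) ω) = ∑ k ∈ s, sphereEnergy τ (evalAt (P k)) := by
  have hc := fun k => continuous_evalAt (P k)
  have hm := fun k => (continuous_sphereExt (hc k)).measurable
  unfold sphereEnergy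
  simp_rw [sphereExt_sum s hc]
  have hpol : ∀ f : Space d → ℂ, Measurable f →
      ∫⁻ x, ‖f x‖ₑ ^ 2 * ENNReal.ofReal (‖x‖ ^ (-τ)) =
      ∫⁻ r in Set.Ioi (0 : ℝ), ENNReal.ofReal (r ^ (d - 1)) * ENNReal.ofReal (r ^ (-τ)) *
        ∫⁻ ω, ‖f (r • (ω : Space d))‖ₑ ^ 2 ∂(sphereMeasure d) := by
    intro f hf
    rw [lintegral_polar hd (Measurable.aemeasurable (by fun_prop))]
    refine setLIntegral_congr_fun measurableSet_Ioi fun r hr => ?_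
    have hr : 0 < r := hr
    have e : ∀ ω : Metric.sphere (0 : Space d) 1, ‖r • (ω : Space d)‖ = r := fun ω => by
      rw [norm_smul, norm_eq_of_mem_sphere, mul_one, Real.norm_of_nonneg hr.le]
    simp only [e]
    rw [lintegral_mul_const' _ _ ENNReal.ofReal_ne_top]
    ring
  have hms : Measurable fun x : Space d => ∑ k ∈ s, sphereExt (evalAt (P k)) x := by fun_prop
  rw [hpol _ hms]
  simp_rw [hpol _ (hm _)]
  rw [← lintegral_finsetSum']
  · refine setLIntegral_congr_fun measurableSet_Ioi fun r hr => ?_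
    rw [lintegral_sphere_sphereExt_sum_sq hd s hP hr, Finset.mul_sum]
  · intro k _
    refine Measurable.aemeasurable (Measurable.mul (by fun_prop) ?_)
    refine Measurable.lintegral_prod_right' (f := fun p : ℝ × Metric.sphere (0 : Space d) 1 =>
      ‖sphereExt (evalAt (P k)) (p.1 • (p.2 : Space d))‖ₑ ^ 2) ?_
    have := hm k
    fun_prop

end SphereEnergySum

/-! ### Diagonalisation for finite angular sums. -/

section AngularWaves

/-- Consecutive constants have ratio (k+(d-τ)/2)/(k+(d+τ)/2-1), which is at most 1 because τ > 1.
Without θ the smoothing operator is therefore bounded. -/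
theorem angularConst_le (hd : 2 ≤ d) {τ : ℝ} (hτ : τ ∈ Set.Ioo (1 : ℝ) d) (k : ℕ) :
    angularConst d τ k ≤ angularConst d τ 0 := by
  induction k with
  | zero => rfl
  | succ k ih =>
    refine le_trans ?_ ih
    have hpos := angularConst_pos hτ k
    obtain ⟨h1, h2⟩ := hτ
    have hd' : (2 : ℝ) ≤ d := by exact_mod_cast hd
    have hk : (0 : ℝ) ≤ k := Nat.cast_nonneg k
    have ha : 0 < (k : ℝ) + ((d : ℝ) - τ) / 2 := by linarith
    have hb : 0 < (k : ℝ) + ((d : ℝ) + τ) / 2 - 1 := by linarith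
    have e : angularConst d τ (k + 1) = angularConst d τ k *
        (((k : ℝ) + ((d : ℝ) - τ) / 2) / ((k : ℝ) + ((d : ℝ) + τ) / 2 - 1)) := by
      unfold angularConst
      push_cast
      rw [show (k : ℝ) + 1 + ((d : ℝ) - τ) / 2 = (k : ℝ) + ((d : ℝ) - τ) / 2 + 1 by ring,
        show (k : ℝ) + 1 + ((d : ℝ) + τ) / 2 - 1 = (k : ℝ) + ((d : ℝ) + τ) / 2 - 1 + 1 by ring,
        Real.Gamma_add_one ha.ne', Real.Gamma_add_one hb.ne']
      simp only [div_eq_mul_inv, mul_inv]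
      ring
    rw [e]
    refine mul_le_of_le_one_right hpos.le ((div_le_one hb).2 (by linarith))

/-- The eigenvalue of the sphere energy does not depend on ρ, so it leaves the radial integral,
which reassembles the L² norm of each component. -/
theorem weightedIntegral_sum_isAngular (hd : 2 ≤ d) {τ : ℝ} (hτ : τ ∈ Set.Ioo (1 : ℝ) d)
    {φ ψ : ℝ → ℝ} (h : IsSmoothingPair τ φ ψ) (s : Finset ℕ) {w : ℕ → Space d → ℂ}
    (hw : ∀ k, IsAngular k (w k)) (hm : ∀ k, Measurable (w k))
    (hV : Integrable fun ξ : Space d => (ψ (2 * Real.pi * ‖ξ‖) : ℂ) * ∑ k ∈ s, w k ξ) :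
    weightedIntegral τ (waveField φ fun ξ => (ψ (2 * Real.pi * ‖ξ‖) : ℂ) * ∑ k ∈ s, w k ξ) =
      ∑ k ∈ s, ENNReal.ofReal (angularConst d τ k) * ∫⁻ ξ, ‖w k ξ‖ₑ ^ 2 := by
  rw [weightedIntegral_waveField hd h (by fun_prop) hV,
    ← lintegral_const_mul' _ _ ENNReal.ofReal_ne_top]
  have h1 : ∀ ρ ∈ Set.Ioi (0 : ℝ), ENNReal.ofReal ((2 * Real.pi) ^ (1 - τ)) *
      (ENNReal.ofReal (ρ ^ (d - 1)) * sphereEnergy τ fun ω : Space d => ∑ k ∈ s, w k (ρ • ω)) =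
      ∑ k ∈ s, ENNReal.ofReal (angularConst d τ k) * (ENNReal.ofReal (ρ ^ (d - 1)) *
        ∫⁻ ω, ‖w k (ρ • (ω : Space d))‖ₑ ^ 2 ∂(sphereMeasure d)) := by
    intro ρ hρ
    choose P hP hPw using fun k => hw k ρ hρ
    have e : sphereEnergy τ (fun ω : Space d => ∑ k ∈ s, w k (ρ • ω)) =
        sphereEnergy τ fun ω => ∑ k ∈ s, evalAt (P k) ω := by
      unfold sphereEnergy
      rw [sphereExt_congr (h' := fun ω => ∑ k ∈ s, evalAt (P k) ω)]
      exact fun ω => Finset.sum_congr rfl fun k _ => hPw k ω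
    rw [e, sphereEnergy_sum hd τ s hP, mul_left_comm, Finset.mul_sum, Finset.mul_sum]
    refine Finset.sum_congr rfl fun k _ => ?_
    rw [sphereEnergy_solidHarmonic hd hτ (hP k), mul_left_comm]
    simp_rw [hPw]
  rw [setLIntegral_congr_fun measurableSet_Ioi h1, lintegral_finsetSum']
  · refine Finset.sum_congr rfl fun k _ => ?_
    have := hm k
    rw [lintegral_const_mul' _ _ ENNReal.ofReal_ne_top,
      lintegral_polar hd (Measurable.aemeasurable (by fun_prop))]
  · intro k _
    refine Measurable.aemeasurable (Measurable.const_mul (Measurable.mul (by fun_prop) ?_) _)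
    refine Measurable.lintegral_prod_right' (f := fun p : ℝ × Metric.sphere (0 : Space d) 1 =>
      ‖w k (p.1 • (p.2 : Space d))‖ₑ ^ 2) ?_
    have := hm k
    fun_prop

end AngularWaves

end AngularSmoothing

namespace AngularSmoothing

open MeasureTheory
open scoped FourierTransform ENNReal ComplexConjugate

variable {d : ℕ}

/-! ### Functions of pure angular degree and radial multipliers. -/

section AngularFunctions

theorem IsAngular.add {k : ℕ} {w w' : Space d → ℂ} (hw : IsAngular k w) (hw' : IsAngular k w') :
    IsAngular k (w + w') := by
  intro r hr
  obtain ⟨P, hP, h⟩ := hw r hr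
  obtain ⟨Q, hQ, h'⟩ := hw' r hr
  exact ⟨P + Q, hP.add hQ, fun ω => by simp [h, h']⟩

theorem IsAngular.mul_radial {k : ℕ} {w : Space d → ℂ} (hw : IsAngular k w) (m : ℝ → ℂ) :
    IsAngular k fun ξ => m ‖ξ‖ * w ξ := by
  intro r hr
  obtain ⟨P, hP, h⟩ := hw r hr
  refine ⟨m r • P, hP.smul _, fun ω => ?_⟩
  simp only [h, evalAt_smul, norm_smul]
  rw [norm_eq_of_mem_sphere, mul_one, Real.norm_of_nonneg hr.le]

theorem isAngular_zero (k : ℕ) : IsAngular k (0 : Space d → ℂ) :=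
  fun _ _ => ⟨0, isSolidHarmonic_zero k, fun ω => by simp⟩

theorem exists_isAngular_of_mem_harmonicSpace {k : ℕ} {f : L2 d} (hf : f ∈ harmonicSpace d k) :
    ∃ w, IsAngular k w ∧ f =ᵐ[volume] w := by
  induction hf using Submodule.span_induction with
  | mem f hf =>
    obtain ⟨P, f₀, hP, -, hf⟩ := hf
    refine ⟨_, isAngular_evalAt_mul hP
      fun r => f₀ r * ((r ^ (-(d : ℝ) / 2 - (k : ℝ) + 1 / 2) : ℝ) : ℂ),
      hf.trans (Filter.Eventually.of_forall fun ξ => ?_)⟩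
    simp only [evalAt, mul_assoc]
  | zero => exact ⟨0, isAngular_zero k, Lp.coeFn_zero _ _ _⟩
  | add f g _ _ ihf ihg =>
    obtain ⟨w, hw, h⟩ := ihf
    obtain ⟨w', hw', h'⟩ := ihg
    exact ⟨w + w', hw.add hw', (Lp.coeFn_add f g).trans (h.add h')⟩
  | smul c f _ ih =>
    obtain ⟨w, hw, h⟩ := ih
    refine ⟨_, hw.mul_radial fun _ => c, (Lp.coeFn_smul c f).trans ?_⟩
    filter_upwards [h] with ξ hξ
    simp [hξ]

theorem harmonicProj_of_isAngular_ne (hd : 2 ≤ d) {k l : ℕ} (hkl : k ≠ l) {w : Space d → ℂ}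
    (hw : IsAngular k w) {f : L2 d} (hf : f =ᵐ[volume] w) : harmonicProj d l f = 0 := by
  have h1 : harmonicSpace d l ≤ (Submodule.span ℂ {f})ᗮ := by
    intro g hg
    rw [Submodule.mem_orthogonal_singleton_iff_inner_right]
    obtain ⟨w', hw', h'⟩ := exists_isAngular_of_mem_harmonicSpace hg
    exact inner_eq_zero_of_isAngular hd hkl hw hw' hf h'
  have h2 : (harmonicSpace d l).topologicalClosure ≤ (Submodule.span ℂ {f})ᗮ :=
    Submodule.topologicalClosure_minimal _ h1 (Submodule.isClosed_orthogonal _)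
  rw [harmonicProj, Submodule.starProjection_apply_eq_zero_iff, Submodule.mem_orthogonal]
  intro y hy
  exact Submodule.mem_orthogonal_singleton_iff_inner_left.1 (h2 hy)

/-- All other projections vanish, so the expansion of f consists of its k-th term. This avoids
expanding w in a basis of harmonics with radial coefficients. -/
theorem harmonicProj_of_isAngular (hd : 2 ≤ d) {k : ℕ} {w : Space d → ℂ}
    (hw : IsAngular k w) {f : L2 d} (hf : f =ᵐ[volume] w) : harmonicProj d k f = f :=
  (hasSum_single k fun _ hl => harmonicProj_of_isAngular_ne hd (Ne.symm hl) hw hf).unique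
    (hasSum_harmonicProj hd f)

theorem mem_closure_harmonicSpace_of_isAngular (hd : 2 ≤ d) {k : ℕ} {w : Space d → ℂ}
    (hw : IsAngular k w) {f : L2 d} (hf : f =ᵐ[volume] w) :
    f ∈ (harmonicSpace d k).topologicalClosure := by
  rw [← harmonicProj_of_isAngular hd hw hf]
  exact closureProj_mem (harmonicSpace d) k f

/-- Multiplication by a bounded function is a bounded operator on `L²`. -/
theorem exists_mulOperator {g : Space d → ℂ} (hg : AEStronglyMeasurable g) {C : ℝ}
    (hC : ∀ ξ, ‖g ξ‖ ≤ C) :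
    ∃ A : L2 d →L[ℂ] L2 d, ∀ f : L2 d, A f =ᵐ[volume] fun ξ => g ξ * f ξ := by
  have hm : ∀ f : L2 d, MemLp (fun ξ => g ξ * f ξ) 2 := fun f =>
    (Lp.memLp f).of_le_mul (c := C) (hg.mul (Lp.aestronglyMeasurable f))
      (Filter.Eventually.of_forall fun ξ => by
        rw [norm_mul]; exact mul_le_mul_of_nonneg_right (hC ξ) (norm_nonneg _))
  let A₀ : L2 d →ₗ[ℂ] L2 d :=
    { toFun := fun f => (hm f).toLp _
      map_add' := fun f h => by
        rw [← MemLp.toLp_add, MemLp.toLp_eq_toLp_iff]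
        filter_upwards [Lp.coeFn_add f h] with ξ h1
        rw [h1, Pi.add_apply, Pi.add_apply, mul_add]
      map_smul' := fun c f => by
        rw [RingHom.id_apply, ← MemLp.toLp_const_smul, MemLp.toLp_eq_toLp_iff]
        filter_upwards [Lp.coeFn_smul c f] with ξ h1
        simp only [h1, Pi.smul_apply, smul_eq_mul]
        ring }
  refine ⟨A₀.mkContinuous C fun f => ?_, fun f => (hm f).coeFn_toLp⟩
  refine Lp.norm_le_mul_norm_of_ae_le_mul ?_
  filter_upwards [(hm f).coeFn_toLp] with ξ h1
  change ‖(hm f).toLp _ ξ‖ ≤ _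
  rw [h1, norm_mul]
  exact mul_le_mul_of_nonneg_right (hC ξ) (norm_nonneg _)

theorem harmonicProj_mulOperator (hd : 2 ≤ d) {m : ℝ → ℂ} {A : L2 d →L[ℂ] L2 d}
    (hA : ∀ f : L2 d, A f =ᵐ[volume] fun ξ => m ‖ξ‖ * f ξ) (k : ℕ) (f : L2 d) :
    harmonicProj d k (A f) = A (harmonicProj d k f) := by
  refine closureProj_comm (harmonicSpace_isOrtho hd) (harmonicSpace_total hd) A (fun k y hy => ?_) k f
  obtain ⟨w, hw, h⟩ := exists_isAngular_of_mem_harmonicSpace hy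
  refine mem_closure_harmonicSpace_of_isAngular hd (hw.mul_radial m) ((hA y).trans ?_)
  filter_upwards [h] with ξ hξ
  rw [hξ]

end AngularFunctions

/-! ### Norms on data and on space-time fields. -/

section Norms

theorem tendsto_zero_of_sq {ι : Type*} {l : Filter ι} {a : ι → ℝ≥0∞}
    (ha : Filter.Tendsto (fun n => a n ^ 2) l (nhds 0)) : Filter.Tendsto a l (nhds 0) := by
  have := (ENNReal.continuous_rpow_const (y := 1 / 2)).tendsto 0 |>.comp ha
  rw [ENNReal.zero_rpow_of_pos (by norm_num)] at this
  refine this.congr fun n => ?_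
  rw [Function.comp_apply, ← ENNReal.rpow_natCast, ← ENNReal.rpow_mul]
  simp

/-- The norm `(∑_k c_k ‖H_k f‖²)^{1/2}`. -/
noncomputable def angularNorm (c : ℕ → ℝ≥0∞) (f : L2 d) : ℝ≥0∞ :=
  eLpNorm (fun k => harmonicProj d k f) 2 (Measure.count.withDensity c)

theorem eLpNorm_two_sq {α E : Type*} [MeasurableSpace α] [NormedAddCommGroup E] (μ : Measure α)
    (f : α → E) : eLpNorm f 2 μ ^ 2 = ∫⁻ x, ‖f x‖ₑ ^ 2 ∂μ := by
  rw [eLpNorm_eq_lintegral_rpow_enorm_toReal (by norm_num) (by norm_num), ← ENNReal.rpow_natCast,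
    ← ENNReal.rpow_mul]
  simp

theorem angularNorm_sq (c : ℕ → ℝ≥0∞) (f : L2 d) :
    angularNorm c f ^ 2 = ∑' k, c k * ‖harmonicProj d k f‖ₑ ^ 2 := by
  rw [angularNorm, eLpNorm_two_sq, lintegral_withDensity_eq_lintegral_mul _ (measurable_of_countable c)
    (measurable_of_countable _), lintegral_count]
  rfl

theorem aestronglyMeasurable_nat {E : Type*} [NormedAddCommGroup E] (f : ℕ → E) (μ : Measure ℕ) :
    AEStronglyMeasurable f μ := StronglyMeasurable.of_discrete.aestronglyMeasurable

theorem angularNorm_add_le (c : ℕ → ℝ≥0∞) (f g : L2 d) :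
    angularNorm c (f + g) ≤ angularNorm c f + angularNorm c g := by
  unfold angularNorm
  simp_rw [map_add]
  exact eLpNorm_add_le (aestronglyMeasurable_nat _ _) (aestronglyMeasurable_nat _ _) (by norm_num)

theorem angularNorm_neg (c : ℕ → ℝ≥0∞) (f : L2 d) : angularNorm c (-f) = angularNorm c f := by
  unfold angularNorm
  simp_rw [map_neg]
  exact eLpNorm_neg (fun k => harmonicProj d k f) 2 _

theorem angularNorm_sub_comm (c : ℕ → ℝ≥0∞) (f g : L2 d) :
    angularNorm c (f - g) = angularNorm c (g - f) := by
  rw [← neg_sub, angularNorm_neg]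

theorem angularNorm_le_add_sub (c : ℕ → ℝ≥0∞) (f g : L2 d) :
    angularNorm c f ≤ angularNorm c g + angularNorm c (f - g) := by
  simpa using angularNorm_add_le c g (f - g)

theorem angularNorm_fourier (hd : 2 ≤ d) (c : ℕ → ℝ≥0∞) (f : L2 d) :
    angularNorm c (𝓕 f : L2 d) = angularNorm c f := by
  unfold angularNorm
  simp_rw [harmonicProj_fourier hd]
  refine eLpNorm_congr_norm_ae (Filter.Eventually.of_forall fun k => ?_)
  exact (Lp.fourierTransformₗᵢ (Space d) ℂ).norm_map _

theorem angularNorm_le (hd : 2 ≤ d) {c : ℕ → ℝ≥0∞} {C : ℝ≥0∞} (hc : ∀ k, c k ≤ C ^ 2) (f : L2 d) :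
    angularNorm c f ≤ C * ‖f‖ₑ := by
  rw [← ENNReal.pow_le_pow_left_iff two_ne_zero, angularNorm_sq, mul_pow,
    enorm_sq_eq_tsum_harmonicProj hd, ← ENNReal.tsum_mul_left]
  exact ENNReal.tsum_le_tsum fun k => mul_le_mul_left (hc k) _

/-- Each term is continuous because its weight is finite, and a sum of nonnegative continuous terms
is lower semicontinuous. Continuity would fail for unbounded weights. -/
theorem lowerSemicontinuous_angularNorm_sq (c : ℕ → ℝ≥0∞) (hc : ∀ k, c k ≠ ∞) :
    LowerSemicontinuous fun f : L2 d => angularNorm c f ^ 2 := by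
  simp_rw [angularNorm_sq]
  refine lowerSemicontinuous_tsum fun k => Continuous.lowerSemicontinuous ?_
  exact ENNReal.continuous_const_mul (hc k) |>.comp (by fun_prop)

/-- The measure `|x|^{-τ} dx dt` on space-time. -/
noncomputable def weightedMeasure (d : ℕ) (τ : ℝ) : Measure (ℝ × Space d) :=
  volume.withDensity fun p => ENNReal.ofReal (‖p.2‖ ^ (-τ))

theorem measurable_weight (τ : ℝ) :
    Measurable fun p : ℝ × Space d => ENNReal.ofReal (‖p.2‖ ^ (-τ)) := by fun_prop

/-- The norm of `L²(ℝ × ℝ^d, |x|^{-τ} dx dt)`. -/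
noncomputable def weightedNorm (τ : ℝ) (F : ℝ → Space d → ℂ) : ℝ≥0∞ :=
  eLpNorm (Function.uncurry F) 2 (weightedMeasure d τ)

theorem weightedNorm_sq {τ : ℝ} {F : ℝ → Space d → ℂ}
    (hF : AEStronglyMeasurable (Function.uncurry F) (volume : Measure (ℝ × Space d))) :
    weightedNorm τ F ^ 2 = weightedIntegral τ F := by
  have h1 : AEMeasurable (fun p : ℝ × Space d => ‖Function.uncurry F p‖ₑ ^ 2) := hF.enorm.pow_const 2
  rw [weightedNorm, eLpNorm_two_sq, weightedMeasure,
    lintegral_withDensity_eq_lintegral_mul₀ (measurable_weight τ).aemeasurable h1, Measure.volume_eq_prod,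
    lintegral_prod _ ((measurable_weight τ).aemeasurable.mul h1)]
  simp only [weightedIntegral, Pi.mul_apply, Function.uncurry_apply_pair, mul_comm]

theorem weightedMeasure_absolutelyContinuous (d : ℕ) (τ : ℝ) : weightedMeasure d τ ≪ volume :=
  withDensity_absolutelyContinuous _ _

theorem weightedNorm_add_le {τ : ℝ} {F G : ℝ → Space d → ℂ}
    (hF : AEStronglyMeasurable (Function.uncurry F) (volume : Measure (ℝ × Space d)))
    (hG : AEStronglyMeasurable (Function.uncurry G) (volume : Measure (ℝ × Space d))) :
    weightedNorm τ (fun t x => F t x + G t x) ≤ weightedNorm τ F + weightedNorm τ G :=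
  eLpNorm_add_le (hF.mono_ac (weightedMeasure_absolutelyContinuous d τ))
    (hG.mono_ac (weightedMeasure_absolutelyContinuous d τ)) (by norm_num)

theorem weightedNorm_sub_comm (τ : ℝ) (F G : ℝ → Space d → ℂ) :
    weightedNorm τ (fun t x => F t x - G t x) = weightedNorm τ (fun t x => G t x - F t x) :=
  eLpNorm_congr_norm_ae (Filter.Eventually.of_forall fun _ => norm_sub_rev _ _)

theorem weightedNorm_le_add_sub {τ : ℝ} {F G : ℝ → Space d → ℂ}
    (hF : AEStronglyMeasurable (Function.uncurry F) (volume : Measure (ℝ × Space d)))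
    (hG : AEStronglyMeasurable (Function.uncurry G) (volume : Measure (ℝ × Space d))) :
    weightedNorm τ F ≤ weightedNorm τ G + weightedNorm τ (fun t x => F t x - G t x) := by
  have := weightedNorm_add_le (τ := τ) (G := fun t x => F t x - G t x) hG (hF.sub hG)
  simpa using this

/-- Fatou's lemma, once in x and once in t. The iterated form suits convergence that is known for
almost every x at almost every t. -/
theorem weightedIntegral_le_liminf {τ : ℝ} {F : ℝ → Space d → ℂ} {G : ℕ → ℝ → Space d → ℂ}
    (hG : ∀ n, Measurable (Function.uncurry (G n)))
    (h : ∀ᵐ t, ∀ᵐ x, Filter.Tendsto (fun n => G n t x) Filter.atTop (nhds (F t x))) :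
    weightedIntegral τ F ≤ Filter.liminf (fun n => weightedIntegral τ (G n)) Filter.atTop := by
  have hw : Measurable fun x : Space d => ENNReal.ofReal (‖x‖ ^ (-τ)) := by fun_prop
  have hGt : ∀ n t, Measurable fun x => ‖G n t x‖ₑ ^ 2 * ENNReal.ofReal (‖x‖ ^ (-τ)) := fun n t =>
    (((hG n).comp measurable_prodMk_left).enorm.pow_const 2).mul hw
  calc weightedIntegral τ F ≤ ∫⁻ t, Filter.liminf (fun n => ∫⁻ x, ‖G n t x‖ₑ ^ 2 *
        ENNReal.ofReal (‖x‖ ^ (-τ))) Filter.atTop := by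
        refine lintegral_mono_ae ?_
        filter_upwards [h] with t ht
        refine le_trans (lintegral_mono_ae ?_) (lintegral_liminf_le (hGt · t))
        filter_upwards [ht] with x hx
        refine le_of_eq (Filter.Tendsto.liminf_eq ?_).symm
        refine ENNReal.Tendsto.mul_const ?_ (Or.inr ENNReal.ofReal_ne_top)
        exact ((ENNReal.continuous_pow 2).tendsto _).comp ((continuous_enorm.tendsto _).comp hx)
    _ ≤ _ := lintegral_liminf_le fun n => by
        refine Measurable.lintegral_prod_right' (f := fun p : ℝ × Space d =>
          ‖G n p.1 p.2‖ₑ ^ 2 * ENNReal.ofReal (‖p.2‖ ^ (-τ))) ?_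
        exact ((hG n).enorm.pow_const 2).mul (measurable_weight τ)

end Norms

end AngularSmoothing

namespace AngularSmoothing

open MeasureTheory
open scoped FourierTransform ENNReal ComplexConjugate

variable {d : ℕ}

/-! ### Bounded angular packets localised in frequency. -/

section Packets

/-- The sum of a finite family of functions. -/
noncomputable def packetSum (w : ℕ →₀ (Space d → ℂ)) (ξ : Space d) : ℂ := w.sum fun _ f => f ξ

/-- A finite family of bounded measurable functions, the `k`-th of which is a spherical harmonic of
degree `k` on every sphere centred at the origin. -/
structure IsAngularPacket (w : ℕ →₀ (Space d → ℂ)) : Prop where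
  isAngular : ∀ k, IsAngular k (w k)
  measurable : ∀ k, Measurable (w k)
  bounded : ∀ k, ∃ C : ℝ, ∀ ξ, ‖w k ξ‖ ≤ C

/-- An angular packet that is supported where both `|ξ|` and `ψ(2π|ξ|)` are bounded. -/
structure IsWavePacket (ψ : ℝ → ℝ) (w : ℕ →₀ (Space d → ℂ)) : Prop extends IsAngularPacket w where
  localized : ∃ C : ℝ, ∀ k ξ, w k ξ ≠ 0 → ‖ξ‖ ≤ C ∧ |ψ (2 * Real.pi * ‖ξ‖)| ≤ C

theorem packetSum_eq (w : ℕ →₀ (Space d → ℂ)) (ξ : Space d) :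
    packetSum w ξ = ∑ k ∈ w.support, w k ξ := rfl

theorem packetSum_add (w w' : ℕ →₀ (Space d → ℂ)) (ξ : Space d) :
    packetSum (w + w') ξ = packetSum w ξ + packetSum w' ξ :=
  Finsupp.sum_add_index' (fun _ => rfl) fun _ _ _ => rfl

theorem packetSum_sub (w w' : ℕ →₀ (Space d → ℂ)) (ξ : Space d) :
    packetSum (w - w') ξ = packetSum w ξ - packetSum w' ξ :=
  Finsupp.sum_sub_index fun _ _ _ => rfl

theorem packetSum_smul (c : ℂ) (w : ℕ →₀ (Space d → ℂ)) (ξ : Space d) :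
    packetSum (c • w) ξ = c * packetSum w ξ := by
  rw [packetSum, Finsupp.sum_smul_index' fun _ => rfl, packetSum, Finsupp.mul_sum]
  rfl

theorem packetSum_single (k : ℕ) (f : Space d → ℂ) (ξ : Space d) :
    packetSum (Finsupp.single k f) ξ = f ξ := Finsupp.sum_single_index rfl

theorem IsAngularPacket.add {w w' : ℕ →₀ (Space d → ℂ)} (h : IsAngularPacket w)
    (h' : IsAngularPacket w') : IsAngularPacket (w + w') where
  isAngular k := (h.isAngular k).add (h'.isAngular k)
  measurable k := (h.measurable k).add (h'.measurable k)
  bounded k := by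
    obtain ⟨C, hC⟩ := h.bounded k
    obtain ⟨C', hC'⟩ := h'.bounded k
    exact ⟨C + C', fun ξ => (norm_add_le _ _).trans (add_le_add (hC ξ) (hC' ξ))⟩

theorem IsAngularPacket.smul {w : ℕ →₀ (Space d → ℂ)} (h : IsAngularPacket w) (c : ℂ) :
    IsAngularPacket (c • w) where
  isAngular k := (h.isAngular k).mul_radial fun _ => c
  measurable k := (h.measurable k).const_smul c
  bounded k := by
    obtain ⟨C, hC⟩ := h.bounded k
    refine ⟨‖c‖ * C, fun ξ => ?_⟩
    rw [Finsupp.smul_apply, Pi.smul_apply, norm_smul]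
    exact mul_le_mul_of_nonneg_left (hC ξ) (norm_nonneg _)

theorem isAngularPacket_single {k : ℕ} {f : Space d → ℂ} (hf : IsAngular k f) (hm : Measurable f)
    {C : ℝ} (hC : ∀ ξ, ‖f ξ‖ ≤ C) : IsAngularPacket (Finsupp.single k f) := by
  have h : ∀ j, Finsupp.single k f j = if k = j then f else 0 := fun j => Finsupp.single_apply
  refine ⟨fun j => ?_, fun j => ?_, fun j => ?_⟩ <;> rw [h j] <;> split_ifs with hj
  · exact hj ▸ hf
  · exact isAngular_zero j
  · exact hm
  · exact measurable_zero
  · exact ⟨C, hC⟩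
  · exact ⟨0, fun ξ => by simp⟩

theorem IsWavePacket.sub {ψ : ℝ → ℝ} {w w' : ℕ →₀ (Space d → ℂ)} (h : IsWavePacket ψ w)
    (h' : IsWavePacket ψ w') : IsWavePacket ψ (w - w') := by
  refine ⟨?_, ?_⟩
  · have := h.toIsAngularPacket.add (h'.toIsAngularPacket.smul (-1))
    rwa [neg_one_smul, ← sub_eq_add_neg] at this
  · obtain ⟨C, hC⟩ := h.localized
    obtain ⟨C', hC'⟩ := h'.localized
    refine ⟨max C C', fun k ξ hξ => ?_⟩
    by_cases h0 : w k ξ = 0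
    · have h1 : w' k ξ ≠ 0 := fun h1 => hξ (by simp [h0, h1])
      exact ⟨(hC' k ξ h1).1.trans (le_max_right _ _), (hC' k ξ h1).2.trans (le_max_right _ _)⟩
    · exact ⟨(hC k ξ h0).1.trans (le_max_left _ _), (hC k ξ h0).2.trans (le_max_left _ _)⟩

theorem memLp_of_bounded_of_support {f : Space d → ℂ} (hf : AEStronglyMeasurable f) {C R : ℝ}
    (hC : ∀ ξ, ‖f ξ‖ ≤ C) (hR : ∀ ξ, f ξ ≠ 0 → ‖ξ‖ ≤ R) (p : ℝ≥0∞) : MemLp f p := by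
  have h1 : (Metric.closedBall (0 : Space d) R).indicator f = f := by
    rw [Set.indicator_eq_self]
    intro ξ hξ
    simpa using hR ξ hξ
  rw [← h1, memLp_indicator_iff_restrict measurableSet_closedBall]
  have : IsFiniteMeasure ((volume : Measure (Space d)).restrict (Metric.closedBall 0 R)) :=
    ⟨by simpa using measure_closedBall_lt_top⟩
  exact MemLp.of_bound hf.restrict C (Filter.Eventually.of_forall hC)

theorem IsAngularPacket.measurable_packetSum {w : ℕ →₀ (Space d → ℂ)} (h : IsAngularPacket w) :
    Measurable (packetSum w) := by
  have := h.measurable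
  unfold packetSum Finsupp.sum
  fun_prop

theorem IsAngularPacket.bounded_packetSum {w : ℕ →₀ (Space d → ℂ)} (h : IsAngularPacket w) :
    ∃ C : ℝ, ∀ ξ, ‖packetSum w ξ‖ ≤ C := by
  choose C hC using h.bounded
  exact ⟨∑ k ∈ w.support, C k, fun ξ => norm_sum_le_of_le _ fun k _ => hC k ξ⟩

theorem exists_ne_zero_of_packetSum {w : ℕ →₀ (Space d → ℂ)} {ξ : Space d}
    (h : packetSum w ξ ≠ 0) : ∃ k, w k ξ ≠ 0 := by
  obtain ⟨k, -, hk⟩ := Finset.exists_ne_zero_of_sum_ne_zero h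
  exact ⟨k, hk⟩

theorem IsWavePacket.memLp_apply {ψ : ℝ → ℝ} {w : ℕ →₀ (Space d → ℂ)} (h : IsWavePacket ψ w) (k : ℕ)
    (p : ℝ≥0∞) : MemLp (w k) p := by
  obtain ⟨C, hC⟩ := h.bounded k
  obtain ⟨R, hR⟩ := h.localized
  exact memLp_of_bounded_of_support (h.measurable k).aestronglyMeasurable hC
    (fun ξ hξ => (hR k ξ hξ).1) p

theorem IsWavePacket.memLp {ψ : ℝ → ℝ} {w : ℕ →₀ (Space d → ℂ)} (h : IsWavePacket ψ w)
    (p : ℝ≥0∞) : MemLp (packetSum w) p := by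
  obtain ⟨C, hC⟩ := h.bounded_packetSum
  obtain ⟨R, hR⟩ := h.localized
  refine memLp_of_bounded_of_support h.measurable_packetSum.aestronglyMeasurable hC
    (fun ξ hξ => ?_) p (R := R)
  obtain ⟨k, hk⟩ := exists_ne_zero_of_packetSum hξ
  exact (hR k ξ hk).1

theorem IsWavePacket.memLp_mul (hd : 2 ≤ d) {τ : ℝ} {φ ψ : ℝ → ℝ} (hp : IsSmoothingPair τ φ ψ)
    {w : ℕ →₀ (Space d → ℂ)} (h : IsWavePacket ψ w) (p : ℝ≥0∞) :
    MemLp (fun ξ => (ψ (2 * Real.pi * ‖ξ‖) : ℂ) * packetSum w ξ) p := by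
  obtain ⟨C, hC⟩ := h.bounded_packetSum
  obtain ⟨R, hR⟩ := h.localized
  refine memLp_of_bounded_of_support
    (f := fun ξ => (ψ (2 * Real.pi * ‖ξ‖) : ℂ) * packetSum w ξ) ((Complex.measurable_ofReal.comp_aemeasurable
    (hp.aemeasurable_comp_norm' hd)).aestronglyMeasurable.mul
      h.measurable_packetSum.aestronglyMeasurable) (C := |R| * C) (R := R) (fun ξ => ?_)
    (fun ξ hξ => ?_) p
  · by_cases h0 : packetSum w ξ = 0
    · rw [h0, mul_zero, norm_zero]
      exact mul_nonneg (abs_nonneg _) ((norm_nonneg _).trans (hC ξ))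
    · obtain ⟨k, hk⟩ := exists_ne_zero_of_packetSum h0
      rw [norm_mul, Complex.norm_real, Real.norm_eq_abs]
      exact mul_le_mul ((hR k ξ hk).2.trans (le_abs_self R)) (hC ξ) (norm_nonneg _) (abs_nonneg _)
  · obtain ⟨k, hk⟩ := exists_ne_zero_of_packetSum (right_ne_zero_of_mul hξ)
    exact (hR k ξ hk).1

theorem IsWavePacket.harmonicProj_toLp (hd : 2 ≤ d) {ψ : ℝ → ℝ} {w : ℕ →₀ (Space d → ℂ)}
    (h : IsWavePacket ψ w) (k : ℕ) :
    harmonicProj d k ((h.memLp 2).toLp (packetSum w)) = (h.memLp_apply k 2).toLp (w k) := by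
  refine closureProj_eq_of_hasSum (harmonicSpace_isOrtho hd)
    (c := fun k => (h.memLp_apply k 2).toLp (w k)) (fun k =>
      mem_closure_harmonicSpace_of_isAngular hd (h.isAngular k) (MemLp.coeFn_toLp _)) ?_ k
  have h1 : (h.memLp 2).toLp (packetSum w) = ∑ k ∈ w.support, (h.memLp_apply k 2).toLp (w k) := by
    refine Lp.ext ((MemLp.coeFn_toLp _).trans ?_)
    have h3 : ∀ᵐ ξ, ∀ k, ((h.memLp_apply k 2).toLp (w k) : _ → ℂ) ξ = w k ξ :=
      ae_all_iff.2 fun k => MemLp.coeFn_toLp _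
    filter_upwards [h3, Lp.coeFn_finsetSum w.support fun k => (h.memLp_apply k 2).toLp (w k)]
      with ξ h1 h2
    rw [h2, packetSum_eq]
    simp [h1]
  rw [h1]
  refine hasSum_sum_of_ne_finset_zero fun k hk => ?_
  rw [Finsupp.notMem_support_iff] at hk
  simp [hk]

theorem IsWavePacket.weightedIntegral_waveField (hd : 2 ≤ d) {τ : ℝ} (hτ : τ ∈ Set.Ioo (1 : ℝ) d)
    {φ ψ : ℝ → ℝ} (hp : IsSmoothingPair τ φ ψ) {w : ℕ →₀ (Space d → ℂ)} (h : IsWavePacket ψ w) :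
    weightedIntegral τ (waveField φ fun ξ => (ψ (2 * Real.pi * ‖ξ‖) : ℂ) * packetSum w ξ) =
      angularNorm (fun k => ENNReal.ofReal (angularConst d τ k))
        ((h.memLp 2).toLp (packetSum w)) ^ 2 := by
  have h1 := weightedIntegral_sum_isAngular hd hτ hp w.support h.isAngular h.measurable
    (memLp_one_iff_integrable.1 (h.memLp_mul hd hp 1))
  rw [angularNorm_sq, tsum_eq_sum (s := w.support)]
  · refine h1.trans (Finset.sum_congr rfl fun k _ => ?_)
    rw [h.harmonicProj_toLp hd, enorm_sq_toLp]
  · intro k hk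
    rw [Finsupp.notMem_support_iff] at hk
    rw [h.harmonicProj_toLp hd, enorm_sq_toLp, hk]
    simp

end Packets

end AngularSmoothing

namespace AngularSmoothing

open MeasureTheory
open scoped FourierTransform ENNReal ComplexConjugate

variable {d : ℕ}

/-! ### Frequency cutoffs and density. -/

section Approximation

/-- The radii where both `ρ` and `ψ(2πρ)` are at most `m`. -/
def cutoffSet (τ : ℝ) (φ : ℝ → ℝ) (m : ℝ) : Set ℝ :=
  {ρ | 0 < ρ ∧ ρ ≤ m ∧ |deriv φ (2 * Real.pi * ρ)| * (2 * Real.pi * ρ) ^ (1 - τ) ≤ m ^ 2}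

/-- The cutoff is expressed through φ' for this reason: derivatives are Borel measurable, whereas ψ
is only almost everywhere measurable. -/
theorem measurableSet_cutoffSet (τ : ℝ) (φ : ℝ → ℝ) (m : ℝ) : MeasurableSet (cutoffSet τ φ m) := by
  have h1 : Measurable fun ρ : ℝ => |deriv φ (2 * Real.pi * ρ)| * (2 * Real.pi * ρ) ^ (1 - τ) := by
    have := measurable_deriv φ
    fun_prop
  exact measurableSet_Ioi.inter (measurableSet_Iic.inter (measurableSet_le h1 measurable_const))

theorem IsSmoothingPair.abs_le_of_mem_cutoffSet {τ : ℝ} {φ ψ : ℝ → ℝ} (h : IsSmoothingPair τ φ ψ)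
    {m ρ : ℝ} (hρ : ρ ∈ cutoffSet τ φ m) : |ψ (2 * Real.pi * ρ)| ≤ m := by
  obtain ⟨h1, h2, h3⟩ := hρ
  rw [← h.sq_eq _ (mul_pos Real.two_pi_pos h1)] at h3
  exact abs_le_of_sq_le_sq h3 (h1.le.trans h2)

theorem IsSmoothingPair.mem_cutoffSet {τ : ℝ} {φ ψ : ℝ → ℝ} (h : IsSmoothingPair τ φ ψ)
    {m ρ : ℝ} (hρ : 0 < ρ) (hm : ρ ≤ m) (hψ : |ψ (2 * Real.pi * ρ)| ≤ m) :
    ρ ∈ cutoffSet τ φ m := by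
  refine ⟨hρ, hm, ?_⟩
  rw [← h.sq_eq _ (mul_pos Real.two_pi_pos hρ), ← sq_abs]
  exact pow_le_pow_left₀ (abs_nonneg _) hψ 2

/-- The characteristic function of `cutoffSet`. -/
noncomputable def cutoff (τ : ℝ) (φ : ℝ → ℝ) (m : ℝ) : ℝ → ℂ := (cutoffSet τ φ m).indicator 1

theorem cutoff_of_mem {τ : ℝ} {φ : ℝ → ℝ} {m ρ : ℝ} (h : ρ ∈ cutoffSet τ φ m) :
    cutoff τ φ m ρ = 1 := Set.indicator_of_mem h _

theorem cutoff_of_notMem {τ : ℝ} {φ : ℝ → ℝ} {m ρ : ℝ} (h : ρ ∉ cutoffSet τ φ m) :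
    cutoff τ φ m ρ = 0 := Set.indicator_of_notMem h _

theorem measurable_cutoff (τ : ℝ) (φ : ℝ → ℝ) (m : ℝ) : Measurable (cutoff τ φ m) :=
  measurable_one.indicator (measurableSet_cutoffSet τ φ m)

theorem norm_cutoff_le (τ : ℝ) (φ : ℝ → ℝ) (m ρ : ℝ) : ‖cutoff τ φ m ρ‖ ≤ 1 := by
  by_cases h : ρ ∈ cutoffSet τ φ m
  · rw [cutoff_of_mem h, norm_one]
  · rw [cutoff_of_notMem h, norm_zero]; exact zero_le_one

theorem IsSmoothingPair.eventually_cutoff_eq_one {τ : ℝ} {φ ψ : ℝ → ℝ} (h : IsSmoothingPair τ φ ψ)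
    {ρ : ℝ} (hρ : 0 < ρ) : ∀ᶠ m : ℕ in Filter.atTop, cutoff τ φ m ρ = 1 := by
  filter_upwards [(tendsto_natCast_atTop_atTop (R := ℝ)).eventually_ge_atTop ρ,
    (tendsto_natCast_atTop_atTop (R := ℝ)).eventually_ge_atTop |ψ (2 * Real.pi * ρ)|] with m h1 h2
  exact cutoff_of_mem (h.mem_cutoffSet hρ h1 h2)

theorem ae_norm_pos (hd : 2 ≤ d) : ∀ᵐ ξ : Space d, 0 < ‖ξ‖ := by
  have : Nontrivial (Space d) := by
    have : Nonempty (Fin d) := ⟨⟨0, by omega⟩⟩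
    infer_instance
  filter_upwards [Measure.ae_ne volume (0 : Space d)] with v hv0
  exact norm_pos_iff.2 hv0

theorem IsAngularPacket.isWavePacket_cutoff {τ : ℝ} {φ ψ : ℝ → ℝ} (hp : IsSmoothingPair τ φ ψ)
    {w : ℕ →₀ (Space d → ℂ)} (h : IsAngularPacket w) (m : ℝ) :
    ∃ w' : ℕ →₀ (Space d → ℂ), IsWavePacket ψ w' ∧
      ∀ ξ, packetSum w' ξ = cutoff τ φ m ‖ξ‖ * packetSum w ξ := by
  refine ⟨w.mapRange (fun f ξ => cutoff τ φ m ‖ξ‖ * f ξ) (by ext; simp), ⟨⟨?_, ?_, ?_⟩, m, ?_⟩, ?_⟩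
  · exact fun k => (h.isAngular k).mul_radial _
  · exact fun k => ((measurable_cutoff τ φ m).comp measurable_norm).mul (h.measurable k)
  · intro k
    obtain ⟨C, hC⟩ := h.bounded k
    refine ⟨C, fun ξ => ?_⟩
    rw [Finsupp.mapRange_apply, norm_mul]
    exact (mul_le_of_le_one_left (norm_nonneg _) (norm_cutoff_le _ _ _ _)).trans (hC ξ)
  · intro k ξ hξ
    rw [Finsupp.mapRange_apply] at hξ
    have hmem : ‖ξ‖ ∈ cutoffSet τ φ m := by
      by_contra h0
      exact hξ (by rw [cutoff_of_notMem h0, zero_mul])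
    exact ⟨hmem.2.1, hp.abs_le_of_mem_cutoffSet hmem⟩
  · intro ξ
    rw [packetSum, Finsupp.sum_mapRange_index fun _ => rfl, packetSum, Finsupp.mul_sum]

theorem exists_isAngularPacket_of_mem {g : L2 d} (hg : g ∈ ⨆ k, gaussianSpace d k) :
    ∃ w : ℕ →₀ (Space d → ℂ), IsAngularPacket w ∧ g =ᵐ[volume] packetSum w := by
  have hzero : ∃ w : ℕ →₀ (Space d → ℂ), IsAngularPacket w ∧ (0 : L2 d) =ᵐ[volume] packetSum w := by
    refine ⟨0, ⟨isAngular_zero, fun _ => measurable_zero, fun _ => ⟨0, fun ξ => by simp⟩⟩, ?_⟩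
    filter_upwards [Lp.coeFn_zero ℂ 2 (volume : Measure (Space d))] with ξ hξ
    rw [hξ]; rfl
  have hadd : ∀ f g : L2 d, (∃ w : ℕ →₀ (Space d → ℂ), IsAngularPacket w ∧ f =ᵐ[volume] packetSum w) →
      (∃ w : ℕ →₀ (Space d → ℂ), IsAngularPacket w ∧ g =ᵐ[volume] packetSum w) →
      ∃ w : ℕ →₀ (Space d → ℂ), IsAngularPacket w ∧ (f + g : L2 d) =ᵐ[volume] packetSum w := by
    rintro f g ⟨w, hw, h⟩ ⟨w', hw', h'⟩
    refine ⟨w + w', hw.add hw', ?_⟩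
    filter_upwards [h, h', Lp.coeFn_add f g] with ξ h1 h2 h3
    rw [h3, Pi.add_apply, h1, h2, packetSum_add]
  refine Submodule.iSup_induction _ (motive := fun g : L2 d =>
    ∃ w : ℕ →₀ (Space d → ℂ), IsAngularPacket w ∧ g =ᵐ[volume] packetSum w) hg (fun k g hg => ?_)
    hzero hadd
  induction hg using Submodule.span_induction with
  | mem g hg =>
    obtain ⟨P, b, hb, hP, rfl⟩ := hg
    have h1 : IsAngular k fun ξ : Space d => evalAt P ξ * gaussianWave (b : ℂ) 0 0 ξ := by
      have := isAngular_evalAt_mul hP fun r => ((Real.exp (-b * r ^ 2) : ℝ) : ℂ)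
      simpa only [gaussianWave_zero] using this
    obtain ⟨C, hC0, hC⟩ := exists_evalAt_mul_gaussianWave_bound P (b := (b : ℂ)) (by simpa using hb) 0 0
    refine ⟨_, isAngularPacket_single h1 ((continuous_evalAt P).mul
      (continuous_gaussianWave _ _ _)).measurable (C := C) fun ξ => ?_, ?_⟩
    · refine (hC ξ).trans (mul_le_of_le_one_right hC0 (Real.exp_le_one_iff.2 ?_))
      rw [neg_mul, neg_nonpos]
      exact mul_nonneg (half_pos hb).le (sq_nonneg _)
    · filter_upwards [coeFn_gaussianL2 P hb] with ξ hξ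
      rw [hξ, packetSum_single]
  | zero => exact hzero
  | add f g _ _ ihf ihg => exact hadd f g ihf ihg
  | smul c f _ ih =>
    obtain ⟨w, hw, h⟩ := ih
    refine ⟨c • w, hw.smul c, ?_⟩
    filter_upwards [h, Lp.coeFn_smul c f] with ξ h1 h3
    rw [h3, Pi.smul_apply, h1, packetSum_smul, smul_eq_mul]

theorem dense_gaussianSpace (hd : 2 ≤ d) (f : L2 d) {ε : ℝ} (hε : 0 < ε) :
    ∃ g ∈ ⨆ k, gaussianSpace d k, ‖g - f‖ < ε := by
  have h1 : (⨆ k, gaussianSpace d k).topologicalClosure = ⊤ := by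
    rw [Submodule.topologicalClosure_eq_top_iff, Submodule.eq_bot_iff]
    intro x hx
    refine gaussianSpace_total hd x fun k y hy => ?_
    exact hx y (Submodule.mem_iSup_of_mem k hy)
  have h2 : f ∈ closure ((⨆ k, gaussianSpace d k : Submodule ℂ (L2 d)) : Set (L2 d)) := by
    rw [← Submodule.topologicalClosure_coe, h1]; trivial
  obtain ⟨g, hg, h3⟩ := Metric.mem_closure_iff.1 h2 ε hε
  exact ⟨g, hg, by rwa [← dist_eq_norm, dist_comm]⟩

end Approximation

end AngularSmoothing

namespace AngularSmoothing

open MeasureTheory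
open scoped FourierTransform ENNReal ComplexConjugate

variable {d : ℕ}

/-! ### The identity for regular fields. -/

section RegularFields

/-- W and ψW are approximated at once although ψ may be unbounded. A cutoff level m is fixed first,
so that the discarded part is small by dominated convergence. Below it |ψ| ≤ m, and a sufficiently
good Gaussian approximation of W controls both errors. -/
theorem exists_isWavePacket_approx (hd : 2 ≤ d) {τ : ℝ} {φ ψ : ℝ → ℝ} (hp : IsSmoothingPair τ φ ψ)
    {W V : L2 d} (hV : V =ᵐ[volume] fun ξ => (ψ (2 * Real.pi * ‖ξ‖) : ℂ) * W ξ) {ε : ℝ} (hε : 0 < ε) :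
    ∃ w : ℕ →₀ (Space d → ℂ), IsWavePacket ψ w ∧
      ∫⁻ ξ, ‖packetSum w ξ - W ξ‖ₑ ^ 2 ≤ ENNReal.ofReal ε ∧
      ∫⁻ ξ, ‖(ψ (2 * Real.pi * ‖ξ‖) : ℂ) * packetSum w ξ - V ξ‖ₑ ^ 2 ≤ ENNReal.ofReal ε := by
  have mW : AEMeasurable fun ξ => ‖W ξ‖ₑ ^ 2 := (Lp.aestronglyMeasurable W).enorm.pow_const 2
  have mV : AEMeasurable fun ξ => ‖V ξ‖ₑ ^ 2 := (Lp.aestronglyMeasurable V).enorm.pow_const 2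
  set T : ℕ → Space d → ℝ≥0∞ := fun m ξ =>
    ‖1 - cutoff τ φ m ‖ξ‖‖ₑ * (‖W ξ‖ₑ ^ 2 + ‖V ξ‖ₑ ^ 2) with hT
  have hcut : ∀ (m : ℕ) (ρ : ℝ), ‖1 - cutoff τ φ m ρ‖ₑ ≤ 1 := by
    intro m ρ
    by_cases h : ρ ∈ cutoffSet τ φ m
    · simp [cutoff_of_mem h]
    · simp [cutoff_of_notMem h]
  have htend : Filter.Tendsto (fun m => ∫⁻ ξ, T m ξ) Filter.atTop (nhds 0) := by
    have := tendsto_lintegral_of_dominated_convergence' (F := T) (f := fun _ => 0)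
      (fun ξ => ‖W ξ‖ₑ ^ 2 + ‖V ξ‖ₑ ^ 2) (μ := volume) (fun m => ?_) (fun m => ?_) ?_ ?_
    · simpa using this
    · exact ((measurable_const.sub ((measurable_cutoff τ φ m).comp measurable_norm)).enorm.aemeasurable).mul
        (mW.add mV)
    · exact Filter.Eventually.of_forall fun ξ => mul_le_of_le_one_left zero_le (hcut m _)
    · rw [lintegral_add_left' mW, ← enorm_sq_Lp, ← enorm_sq_Lp]
      simp
    · filter_upwards [ae_norm_pos hd] with ξ hξ
      refine tendsto_const_nhds.congr' ?_
      filter_upwards [hp.eventually_cutoff_eq_one hξ] with m hm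
      simp [hT, hm]
  obtain ⟨m, hm⟩ := (htend.eventually_le_const (ENNReal.ofReal_pos.2 (half_pos hε))).exists
  -- K bounds both 1 and ψ² on the cutoff set.
  set K : ℝ := 1 + (m : ℝ) ^ 2 with hK
  have hKpos : 0 < K := by positivity
  obtain ⟨g, hg, hgW⟩ := dense_gaussianSpace hd W (Real.sqrt_pos.2 (div_pos (half_pos hε) hKpos))
  have hgW2 : ENNReal.ofReal K * ∫⁻ ξ, ‖(g - W : L2 d) ξ‖ₑ ^ 2 ≤ ENNReal.ofReal (ε / 2) := by
    rw [← enorm_sq_Lp, ← ofReal_norm, ← ENNReal.ofReal_pow (norm_nonneg _),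
      ← ENNReal.ofReal_mul hKpos.le]
    refine ENNReal.ofReal_le_ofReal ?_
    have h1 : ‖g - W‖ ^ 2 ≤ ε / 2 / K := by
      rw [← Real.sq_sqrt (div_pos (half_pos hε) hKpos).le]
      exact pow_le_pow_left₀ (norm_nonneg _) hgW.le 2
    calc K * ‖g - W‖ ^ 2 ≤ K * (ε / 2 / K) := mul_le_mul_of_nonneg_left h1 hKpos.le
      _ = ε / 2 := by field_simp
  obtain ⟨w, hw, hgw⟩ := exists_isAngularPacket_of_mem hg
  obtain ⟨w', hw', hsum⟩ := hw.isWavePacket_cutoff hp m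
  -- Both squared errors have such a pointwise bound: by K|g - W|² inside the cutoff set, and by T m
  -- outside, where the packet vanishes.
  have hfin : ∀ f : Space d → ℝ≥0∞, (∀ᵐ ξ, f ξ ≤ ENNReal.ofReal K * ‖(g - W : L2 d) ξ‖ₑ ^ 2 + T m ξ) →
      ∫⁻ ξ, f ξ ≤ ENNReal.ofReal ε := by
    intro f hf
    refine (lintegral_mono_ae hf).trans ?_
    rw [lintegral_add_left' (((Lp.aestronglyMeasurable _).enorm.pow_const 2).const_mul _),
      lintegral_const_mul' _ _ ENNReal.ofReal_ne_top]
    refine (add_le_add hgW2 hm).trans ?_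
    rw [← ENNReal.ofReal_add (by positivity) (by positivity), add_halves]
  have hmul : ∀ (a b : ℂ) (r : ℝ), ‖a‖ ^ 2 ≤ r → ‖a * b‖ₑ ^ 2 ≤ ENNReal.ofReal r * ‖b‖ₑ ^ 2 := by
    intro a b r h
    rw [enorm_mul, mul_pow, ← ofReal_norm a, ← ENNReal.ofReal_pow (norm_nonneg _)]
    exact mul_le_mul_left (ENNReal.ofReal_le_ofReal h) _
  refine ⟨w', hw', hfin _ ?_, hfin _ ?_⟩
  · filter_upwards [hgw, Lp.coeFn_sub g W] with ξ h1 h2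
    rw [h2, Pi.sub_apply, h1, hsum]
    by_cases h : ‖ξ‖ ∈ cutoffSet τ φ m
    · rw [cutoff_of_mem h, one_mul]
      refine le_add_right ?_
      simpa using hmul 1 (packetSum w ξ - W ξ) K (by rw [hK]; simp)
    · simp only [hT, cutoff_of_notMem h, zero_mul, zero_sub, enorm_neg, sub_zero, enorm_one, one_mul]
      exact le_add_left le_self_add
  · filter_upwards [hgw, Lp.coeFn_sub g W, hV] with ξ h1 h2 h3
    rw [h2, Pi.sub_apply, h1, hsum]
    by_cases h : ‖ξ‖ ∈ cutoffSet τ φ m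
    · rw [cutoff_of_mem h, one_mul, h3, ← mul_sub]
      refine le_add_right (hmul _ _ _ ?_)
      rw [Complex.norm_real, Real.norm_eq_abs, hK]
      have := pow_le_pow_left₀ (abs_nonneg _) (hp.abs_le_of_mem_cutoffSet h) 2
      linarith
    · simp [hT, cutoff_of_notMem h, ← add_assoc]

theorem enorm_phase (t r : ℝ) : ‖Complex.exp (Complex.I * t * r)‖ₑ = 1 := by
  rw [show Complex.I * t * r = ((t * r : ℝ) : ℂ) * Complex.I by push_cast; ring, ← ofReal_norm,
    Complex.norm_exp_ofReal_mul_I, ENNReal.ofReal_one]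

theorem norm_phase (t r : ℝ) : ‖Complex.exp (Complex.I * t * r)‖ = 1 := by
  rw [show Complex.I * t * r = ((t * r : ℝ) : ℂ) * Complex.I by push_cast; ring,
    Complex.norm_exp_ofReal_mul_I]

theorem IsSmoothingPair.aestronglyMeasurable_phase {τ : ℝ} {φ ψ : ℝ → ℝ} (h : IsSmoothingPair τ φ ψ)
    (hd : 2 ≤ d) (t : ℝ) : AEStronglyMeasurable fun ξ : Space d =>
      Complex.exp (Complex.I * t * φ (2 * Real.pi * ‖ξ‖)) :=
  (Complex.measurable_exp.comp_aemeasurable ((Complex.measurable_ofReal.comp_aemeasurable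
    (h.aemeasurable_comp_norm hd)).const_mul _)).aestronglyMeasurable

/-- Plancherel in x at a fixed time. The phase is unimodular and drops out, so the bound is uniform
in t. -/
theorem IsWavePacket.lintegral_waveField_sub (hd : 2 ≤ d) {τ : ℝ} {φ ψ : ℝ → ℝ}
    (hp : IsSmoothingPair τ φ ψ) {w : ℕ →₀ (Space d → ℂ)} (hw : IsWavePacket ψ w) {t : ℝ}
    {V v : L2 d} (hv : (𝓕 v : L2 d) =ᵐ[volume] fun ξ =>
      Complex.exp (Complex.I * t * φ (2 * Real.pi * ‖ξ‖)) * V ξ) :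
    ∫⁻ x, ‖waveField φ (fun ξ => (ψ (2 * Real.pi * ‖ξ‖) : ℂ) * packetSum w ξ) t x - v x‖ₑ ^ 2 =
      ∫⁻ ξ, ‖(ψ (2 * Real.pi * ‖ξ‖) : ℂ) * packetSum w ξ - V ξ‖ₑ ^ 2 := by
  set g : Space d → ℂ := fun ξ => Complex.exp (Complex.I * t * φ (2 * Real.pi * ‖ξ‖)) *
    ((ψ (2 * Real.pi * ‖ξ‖) : ℂ) * packetSum w ξ) with hg
  have hgp : ∀ p, MemLp g p := fun p => (hw.memLp_mul hd hp p).of_le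
    ((hp.aestronglyMeasurable_phase hd t).mul (hw.memLp_mul hd hp p).1)
    (Filter.Eventually.of_forall fun ξ => by rw [hg, norm_mul, norm_phase, one_mul])
  have h1 := fourierInv_toLp_ae (memLp_one_iff_integrable.1 (hgp 1)) (hgp 2)
  set G : L2 d := (hgp 2).toLp g with hG
  have h2 : ∫⁻ x, ‖waveField φ (fun ξ => (ψ (2 * Real.pi * ‖ξ‖) : ℂ) * packetSum w ξ) t x - v x‖ₑ ^ 2
      = ‖(𝓕⁻ G : L2 d) - v‖ₑ ^ 2 := by
    rw [enorm_sq_Lp]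
    refine lintegral_congr_ae ?_
    filter_upwards [h1, Lp.coeFn_sub (𝓕⁻ G : L2 d) v] with x h3 h4
    rw [h4, Pi.sub_apply, h3]
    rfl
  have h3 : ‖(𝓕⁻ G : L2 d) - v‖ₑ = ‖G - (𝓕 v : L2 d)‖ₑ := by
    have h4 : (𝓕 ((𝓕⁻ G : L2 d) - v) : L2 d) = G - (𝓕 v : L2 d) := by
      have := map_sub (Lp.fourierTransformₗᵢ (Space d) ℂ) (𝓕⁻ G : L2 d) v
      refine this.trans ?_
      congr 1
      exact (Lp.fourierTransformₗᵢ (Space d) ℂ).apply_symm_apply G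
    rw [← h4]
    exact ((Lp.fourierTransformₗᵢ (Space d) ℂ).enorm_map _).symm
  rw [h2, h3, enorm_sq_Lp]
  refine lintegral_congr_ae ?_
  filter_upwards [hv, (hgp 2).coeFn_toLp, Lp.coeFn_sub G (𝓕 v : L2 d)] with ξ h4 h5 h6
  rw [h6, Pi.sub_apply, h4, h5, hg]
  simp only
  rw [← mul_sub, enorm_mul, enorm_phase, one_mul]

theorem IsSmoothingPair.measurable_waveField {τ : ℝ} {φ ψ : ℝ → ℝ} (hp : IsSmoothingPair τ φ ψ)
    (hd : 2 ≤ d) {w : ℕ →₀ (Space d → ℂ)} (hw : IsWavePacket ψ w) :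
    Measurable (Function.uncurry
      (waveField φ fun ξ : Space d => (ψ (2 * Real.pi * ‖ξ‖) : ℂ) * packetSum w ξ)) :=
  (stronglyMeasurable_waveField (hp.aemeasurable_comp_norm hd) (hw.memLp_mul hd hp 1).1).measurable

theorem IsWavePacket.waveField_sub (hd : 2 ≤ d) {τ : ℝ} {φ ψ : ℝ → ℝ}
    (hp : IsSmoothingPair τ φ ψ) {w w' : ℕ →₀ (Space d → ℂ)} (hw : IsWavePacket ψ w)
    (hw' : IsWavePacket ψ w') (t : ℝ) (x : Space d) :
    waveField φ (fun ξ => (ψ (2 * Real.pi * ‖ξ‖) : ℂ) * packetSum w ξ) t x -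
      waveField φ (fun ξ => (ψ (2 * Real.pi * ‖ξ‖) : ℂ) * packetSum w' ξ) t x =
    waveField φ (fun ξ => (ψ (2 * Real.pi * ‖ξ‖) : ℂ) * packetSum (w - w') ξ) t x := by
  have h_int : ∀ {w : ℕ →₀ (Space d → ℂ)}, IsWavePacket ψ w → Integrable fun ξ =>
      Complex.exp (Complex.I * t * φ (2 * Real.pi * ‖ξ‖)) *
      ((ψ (2 * Real.pi * ‖ξ‖) : ℂ) * packetSum w ξ *
        Complex.exp (2 * Real.pi * Complex.I * ((inner ℝ x ξ : ℝ) : ℂ))) := by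
    intro w hw
    have h1 := memLp_one_iff_integrable.1 (hw.memLp_mul hd hp 1)
    refine h1.mono ((hp.aestronglyMeasurable_phase hd t).mul (h1.1.mul
      (Continuous.aestronglyMeasurable (by fun_prop)))) (Filter.Eventually.of_forall fun ξ => ?_)
    rw [norm_mul, norm_phase, one_mul, norm_mul _ (Complex.exp _),
      show 2 * Real.pi * Complex.I * ((inner ℝ x ξ : ℝ) : ℂ) =
        ((2 * Real.pi * inner ℝ x ξ : ℝ) : ℂ) * Complex.I by push_cast; ring,
      Complex.norm_exp_ofReal_mul_I, mul_one]
  rw [waveField_eq, waveField_eq, waveField_eq, ← integral_sub (h_int hw) (h_int hw')]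
  refine integral_congr_ae (Filter.Eventually.of_forall fun ξ => ?_)
  simp only [packetSum_sub]
  ring

/-- The weights `β_k / |θ(μ_k)|²`. -/
noncomputable def angularWeight (d : ℕ) (τ : ℝ) (k : ℕ) : ℝ≥0∞ := ENNReal.ofReal (angularConst d τ k)

theorem angularNorm_angularWeight_le (hd : 2 ≤ d) {τ : ℝ} (hτ : τ ∈ Set.Ioo (1 : ℝ) d) (f : L2 d) :
    angularNorm (angularWeight d τ) f ≤ ENNReal.ofReal √(angularConst d τ 0) * ‖f‖ₑ := by
  refine angularNorm_le hd (fun k => ?_) f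
  rw [← ENNReal.ofReal_pow (Real.sqrt_nonneg _), Real.sq_sqrt (angularConst_pos hτ 0).le]
  exact ENNReal.ofReal_le_ofReal (angularConst_le hd hτ k)

/-- Packets converge to F in two senses, pointwise at almost every time and as a Cauchy sequence in
the weighted norm; Fatou's lemma identifies the limits, and the packet identity passes to F. -/
theorem weightedNorm_eq_angularNorm (hd : 2 ≤ d) {τ : ℝ} (hτ : τ ∈ Set.Ioo (1 : ℝ) d)
    {φ ψ : ℝ → ℝ} (hp : IsSmoothingPair τ φ ψ) {W V : L2 d}
    (hV : V =ᵐ[volume] fun ξ => (ψ (2 * Real.pi * ‖ξ‖) : ℂ) * W ξ) {F : ℝ → Space d → ℂ}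
    (hF : AEStronglyMeasurable (Function.uncurry F) (volume : Measure (ℝ × Space d)))
    (hFt : ∀ᵐ t : ℝ, ∃ v : L2 d, F t =ᵐ[volume] v ∧ (𝓕 v : L2 d) =ᵐ[volume] fun ξ =>
      Complex.exp (Complex.I * t * φ (2 * Real.pi * ‖ξ‖)) * V ξ) :
    weightedNorm τ F = angularNorm (angularWeight d τ) W := by
  -- The accuracies 2^{-n} are summable, so almost everywhere convergence holds along the whole
  -- sequence, with no subsequence depending on t.
  have happ := fun n : ℕ => exists_isWavePacket_approx hd hp hV (ε := (1 / 2) ^ n) (by positivity)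
  choose w hw h1 h2 using happ
  set G : ℕ → ℝ → Space d → ℂ := fun n =>
    waveField φ fun ξ => (ψ (2 * Real.pi * ‖ξ‖) : ℂ) * packetSum (w n) ξ with hG
  set Wn : ℕ → L2 d := fun n => ((hw n).memLp 2).toLp _ with hWn
  set δ : ℕ → ℝ≥0∞ := fun n => ‖Wn n - W‖ₑ with hδ
  set C : ℝ≥0∞ := ENNReal.ofReal √(angularConst d τ 0)
  have hC : C ≠ ∞ := ENNReal.ofReal_ne_top
  have mG : ∀ n, Measurable (Function.uncurry (G n)) := fun n => hp.measurable_waveField hd (hw n)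
  have hgeo : ∑' n : ℕ, ENNReal.ofReal ((1 / 2) ^ n) ≠ ∞ := by
    rw [← ENNReal.ofReal_tsum_of_nonneg (fun n => by positivity) summable_geometric_two]
    exact ENNReal.ofReal_ne_top
  have hgeo0 := ENNReal.tendsto_atTop_zero_of_tsum_ne_top hgeo
  have hδ0 : Filter.Tendsto δ Filter.atTop (nhds 0) := by
    refine tendsto_zero_of_sq (tendsto_of_tendsto_of_tendsto_of_le_of_le tendsto_const_nhds hgeo0
      (fun _ => zero_le) fun n => le_trans (le_of_eq ?_) (h1 n))
    rw [hδ, enorm_sq_Lp]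
    refine lintegral_congr_ae ?_
    filter_upwards [Lp.coeFn_sub (Wn n) W, ((hw n).memLp 2).coeFn_toLp] with ξ h3 h4
    rw [h3, Pi.sub_apply, h4]
  have hconv : ∀ᵐ t, ∀ᵐ x, Filter.Tendsto (fun n => G n t x) Filter.atTop (nhds (F t x)) := by
    filter_upwards [hFt] with t ⟨v, hFv, hv⟩
    have mGv : ∀ n, AEMeasurable fun x => ‖G n t x - v x‖ₑ ^ 2 := fun n =>
      ((((mG n).comp measurable_prodMk_left).aestronglyMeasurable (μ := volume)).sub
        (Lp.aestronglyMeasurable v)).enorm.pow_const 2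
    have h3 : ∫⁻ x, ∑' n, ‖G n t x - v x‖ₑ ^ 2 ≠ ∞ := by
      rw [lintegral_tsum mGv]
      refine ne_top_of_le_ne_top hgeo (ENNReal.tsum_le_tsum fun n => ?_)
      exact ((hw n).lintegral_waveField_sub hd hp hv).trans_le (h2 n)
    filter_upwards [ae_lt_top' (AEMeasurable.tsum mGv) h3, hFv] with x hx hFx
    have h4 := tendsto_zero_of_sq (ENNReal.tendsto_atTop_zero_of_tsum_ne_top hx.ne)
    rw [hFx]
    rw [tendsto_iff_edist_tendsto_0]
    simpa only [edist_eq_enorm_sub] using h4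
  -- A difference of packets is a packet, so the exact identity applies to it; boundedness of the
  -- angular constants then reduces it to L² distances.
  have hdiff : ∀ n m, weightedIntegral τ (fun t x => G n t x - G m t x) ≤
      (C * (δ n + δ m)) ^ 2 := by
    intro n m
    have e : (fun t x => G n t x - G m t x) = waveField φ fun ξ : Space d =>
        (ψ (2 * Real.pi * ‖ξ‖) : ℂ) * packetSum (w n - w m) ξ := by
      ext t x
      exact (hw n).waveField_sub hd hp (hw m) t x
    rw [e, ((hw n).sub (hw m)).weightedIntegral_waveField hd hτ hp]
    refine ENNReal.pow_le_pow_left ((angularNorm_angularWeight_le hd hτ _).trans ?_)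
    refine mul_le_mul_right ?_ _
    have e2 : (((hw n).sub (hw m)).memLp 2).toLp (packetSum (w n - w m)) = Wn n - Wn m := by
      rw [hWn, ← MemLp.toLp_sub, MemLp.toLp_eq_toLp_iff]
      exact Filter.Eventually.of_forall fun ξ => packetSum_sub _ _ ξ
    rw [e2, ← sub_add_sub_cancel (Wn n) W (Wn m)]
    refine (enorm_add_le _ _).trans (le_of_eq ?_)
    rw [← enorm_neg (W - Wn m), neg_sub]
  -- Fatou's lemma as n → ∞ in the estimate for G n - G m.
  have hFG : ∀ m, weightedNorm τ (fun t x => F t x - G m t x) ≤ C * δ m := by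
    intro m
    have haes : AEStronglyMeasurable (Function.uncurry fun t x => F t x - G m t x)
        (volume : Measure (ℝ × Space d)) := hF.sub (mG m).aestronglyMeasurable
    rw [← ENNReal.pow_le_pow_left_iff two_ne_zero, weightedNorm_sq haes]
    refine (weightedIntegral_le_liminf (G := fun n t x => G n t x - G m t x)
      (fun n => (mG n).sub (mG m)) ?_).trans ?_
    · filter_upwards [hconv] with t ht
      filter_upwards [ht] with x hx
      exact hx.sub_const _
    · refine (Filter.liminf_le_liminf (Filter.Eventually.of_forall fun n => hdiff n m)).trans ?_
      refine le_of_eq (Filter.Tendsto.liminf_eq ?_)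
      refine ((ENNReal.continuous_pow 2).tendsto _).comp (ENNReal.Tendsto.const_mul ?_ (Or.inr hC))
      simpa using hδ0.add_const (δ m)
  have hGn : ∀ n, weightedNorm τ (G n) = angularNorm (angularWeight d τ) (Wn n) := by
    intro n
    have := (hw n).weightedIntegral_waveField hd hτ hp
    rw [← weightedNorm_sq (mG n).aestronglyMeasurable] at this
    exact (ENNReal.pow_right_strictMono two_ne_zero).injective this
  have hlim : ∀ a : ℝ≥0∞, Filter.Tendsto (fun n => a + C * δ n + C * δ n) Filter.atTop (nhds a) := by
    intro a
    have h3 : Filter.Tendsto (fun n => C * δ n) Filter.atTop (nhds 0) := by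
      simpa using ENNReal.Tendsto.const_mul hδ0 (Or.inr hC)
    simpa using (h3.const_add a).add h3
  refine le_antisymm (ge_of_tendsto' (hlim _) fun n => ?_) (ge_of_tendsto' (hlim _) fun n => ?_)
  · refine (weightedNorm_le_add_sub hF (mG n).aestronglyMeasurable).trans (add_le_add ?_ (hFG n))
    rw [hGn]
    exact (angularNorm_le_add_sub _ _ W).trans
      (add_le_add_right (angularNorm_angularWeight_le hd hτ _) _)
  · refine (angularNorm_le_add_sub _ W (Wn n)).trans (add_le_add ?_ ?_)
    · rw [← hGn]
      refine (weightedNorm_le_add_sub (mG n).aestronglyMeasurable hF).trans (add_le_add_right ?_ _)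
      rw [weightedNorm_sub_comm]
      exact hFG n
    · rw [angularNorm_sub_comm]
      exact angularNorm_angularWeight_le hd hτ _

end RegularFields

end AngularSmoothing

namespace AngularSmoothing

open MeasureTheory
open scoped FourierTransform ENNReal ComplexConjugate

variable {d : ℕ}

/-! ### Uniqueness of weak solutions. -/

section Solutions

/-- Multiplication by `e^{itφ(2π|ξ|)}`. -/
noncomputable def phaseOperator (hd : 2 ≤ d) {τ : ℝ} {φ ψ : ℝ → ℝ} (hp : IsSmoothingPair τ φ ψ)
    (t : ℝ) : L2 d →L[ℂ] L2 d :=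
  (exists_mulOperator (hp.aestronglyMeasurable_phase hd t) (C := 1)
    fun _ => (norm_phase t _).le).choose

theorem coeFn_phaseOperator (hd : 2 ≤ d) {τ : ℝ} {φ ψ : ℝ → ℝ} (hp : IsSmoothingPair τ φ ψ)
    (t : ℝ) (f : L2 d) : phaseOperator hd hp t f =ᵐ[volume] fun ξ =>
      Complex.exp (Complex.I * t * φ (2 * Real.pi * ‖ξ‖)) * f ξ :=
  (exists_mulOperator (hp.aestronglyMeasurable_phase hd t) (C := 1)
    fun _ => (norm_phase t _).le).choose_spec f

theorem phaseOperator_phaseOperator (hd : 2 ≤ d) {τ : ℝ} {φ ψ : ℝ → ℝ}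
    (hp : IsSmoothingPair τ φ ψ) (s t : ℝ) (f : L2 d) :
    phaseOperator hd hp s (phaseOperator hd hp t f) = phaseOperator hd hp (s + t) f := by
  refine Lp.ext ?_
  filter_upwards [coeFn_phaseOperator hd hp s (phaseOperator hd hp t f),
    coeFn_phaseOperator hd hp t f, coeFn_phaseOperator hd hp (s + t) f] with ξ h1 h2 h3
  rw [h1, h2, h3, ← mul_assoc, ← Complex.exp_add]
  congr 2
  push_cast; ring

theorem phaseOperator_zero (hd : 2 ≤ d) {τ : ℝ} {φ ψ : ℝ → ℝ} (hp : IsSmoothingPair τ φ ψ)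
    (f : L2 d) : phaseOperator hd hp 0 f = f := by
  refine Lp.ext ?_
  filter_upwards [coeFn_phaseOperator hd hp 0 f] with ξ h1
  rw [h1]
  simp

theorem inner_phaseOperator (hd : 2 ≤ d) {τ : ℝ} {φ ψ : ℝ → ℝ} (hp : IsSmoothingPair τ φ ψ)
    (t : ℝ) (f g : L2 d) :
    inner ℂ (phaseOperator hd hp t f) g = inner ℂ f (phaseOperator hd hp (-t) g) := by
  rw [L2.inner_def, L2.inner_def]
  refine integral_congr_ae ?_
  filter_upwards [coeFn_phaseOperator hd hp t f, coeFn_phaseOperator hd hp (-t) g] with ξ h1 h2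
  rw [h1, h2, RCLike.inner_apply, RCLike.inner_apply, map_mul, ← Complex.exp_conj]
  simp only [map_mul, Complex.conj_I, Complex.conj_ofReal, Complex.ofReal_neg]
  ring_nf

/-- A product rule in which y is only norm continuous, and differentiable only against the fixed
vector a(t); the difference quotients of a converge in norm. -/
theorem hasDerivAt_inner_of_weak {H : Type*} [NormedAddCommGroup H] [InnerProductSpace ℂ H]
    {a y : ℝ → H} {a' : H} {D : ℂ} {t : ℝ} (ha : HasDerivAt a a' t) (hy : ContinuousAt y t)
    (hw : HasDerivAt (fun s => inner ℂ (a t) (y s)) D t) :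
    HasDerivAt (fun s => inner ℂ (a s) (y s)) (inner ℂ a' (y t) + D) t := by
  have h1 : HasDerivAt (fun s => inner ℂ (a s - a t) (y s)) (inner ℂ a' (y t)) t := by
    rw [hasDerivAt_iff_tendsto_slope] at ha ⊢
    refine (ha.inner (hy.tendsto.mono_left nhdsWithin_le_nhds)).congr fun s => ?_
    simp only [slope, vsub_eq_sub, sub_self, inner_zero_left, sub_zero]
    rw [RCLike.real_smul_eq_coe_smul (K := ℂ), inner_smul_left]
    simp [inner_sub_left]
  refine (h1.add hw).congr_of_eventuallyEq (Filter.Eventually.of_forall fun s => ?_)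
  simp

/-- Multiplication by the characteristic function of `|φ(2π|ξ|)| ≤ m`. -/
theorem exists_phaseCutoff (hd : 2 ≤ d) {τ : ℝ} {φ ψ : ℝ → ℝ} (hp : IsSmoothingPair τ φ ψ) (m : ℝ)
    (f : L2 d) : ∃ g : L2 d, g =ᵐ[volume] fun ξ =>
      if |φ (2 * Real.pi * ‖ξ‖)| ≤ m then f ξ else 0 := by
  have hφ := hp.aemeasurable_comp_norm hd
  have h1 : AEStronglyMeasurable (fun ξ : Space d =>
      if |φ (2 * Real.pi * ‖ξ‖)| ≤ m then f ξ else 0) := by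
    refine AEStronglyMeasurable.congr (f := fun ξ : Space d =>
      {ξ | |hφ.mk _ ξ| ≤ m}.indicator f ξ) ?_ ?_
    · exact (Lp.aestronglyMeasurable f).indicator
        (measurableSet_le hφ.measurable_mk.abs measurable_const)
    · filter_upwards [hφ.ae_eq_mk] with ξ hξ
      simp only [Set.indicator, Set.mem_ofPred_eq, hξ]
  have h2 : MemLp (fun ξ : Space d => if |φ (2 * Real.pi * ‖ξ‖)| ≤ m then f ξ else 0) 2 :=
    (Lp.memLp f).of_le h1 (Filter.Eventually.of_forall fun ξ => by split_ifs <;> simp)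
  exact ⟨h2.toLp _, h2.coeFn_toLp⟩

/-- Boundedness of φ on the support of f makes |e^z - 1 - z| ≤ |z|² uniform in ξ, which gives a
derivative in norm. -/
theorem hasDerivAt_phaseOperator (hd : 2 ≤ d) {τ : ℝ} {φ ψ : ℝ → ℝ} (hp : IsSmoothingPair τ φ ψ)
    {m : ℝ} {f k : L2 d} (hk : k =ᵐ[volume] fun ξ => (φ (2 * Real.pi * ‖ξ‖) : ℂ) * f ξ)
    (hf : ∀ᵐ ξ, f ξ ≠ 0 → |φ (2 * Real.pi * ‖ξ‖)| ≤ m) (t : ℝ) :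
    HasDerivAt (fun s => phaseOperator hd hp s f) (Complex.I • phaseOperator hd hp t k) t := by
  have hm : ∀ s : ℝ, |s - t| * |m| ≤ 1 → ‖phaseOperator hd hp s f - phaseOperator hd hp t f -
      (s - t) • (Complex.I • phaseOperator hd hp t k)‖ ≤ m ^ 2 * (s - t) ^ 2 * ‖f‖ := by
    intro s hs
    refine Lp.norm_le_mul_norm_of_ae_le_mul ?_
    filter_upwards [coeFn_phaseOperator hd hp s f, coeFn_phaseOperator hd hp t f,
      coeFn_phaseOperator hd hp t k, hk, hf,
      Lp.coeFn_sub (phaseOperator hd hp s f - phaseOperator hd hp t f)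
        ((s - t) • (Complex.I • phaseOperator hd hp t k)),
      Lp.coeFn_sub (phaseOperator hd hp s f) (phaseOperator hd hp t f),
      Lp.coeFn_smul (s - t) (Complex.I • phaseOperator hd hp t k),
      Lp.coeFn_smul Complex.I (phaseOperator hd hp t k)] with ξ h1 h2 h3 h4 h5 h6 h7 h8 h9
    rw [h6, Pi.sub_apply, h7, Pi.sub_apply, h8, Pi.smul_apply, h9, Pi.smul_apply, h1, h2, h3, h4]
    by_cases h0 : f ξ = 0
    · simp [h0]
    have h5 := h5 h0
    set r := φ (2 * Real.pi * ‖ξ‖)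
    set z : ℂ := Complex.I * (s - t : ℝ) * r with hz
    have e1 : Complex.exp (Complex.I * s * r) = Complex.exp (Complex.I * t * r) * Complex.exp z := by
      rw [← Complex.exp_add, hz]
      congr 1
      push_cast; ring
    have e2 : Complex.exp (Complex.I * s * r) * f ξ - Complex.exp (Complex.I * t * r) * f ξ -
        (s - t) • Complex.I • (Complex.exp (Complex.I * t * r) * (r * f ξ)) =
        Complex.exp (Complex.I * t * r) * ((Complex.exp z - 1 - z) * f ξ) := by
      rw [e1, hz, Complex.real_smul, smul_eq_mul]
      ring
    have hzn : ‖z‖ = |s - t| * |r| := by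
      rw [hz, norm_mul, norm_mul, Complex.norm_I, one_mul, Complex.norm_real, Complex.norm_real,
        Real.norm_eq_abs, Real.norm_eq_abs]
    have hzm : ‖z‖ ≤ |s - t| * |m| := by
      rw [hzn]
      exact mul_le_mul_of_nonneg_left (h5.trans (le_abs_self m)) (abs_nonneg _)
    rw [e2, norm_mul, norm_phase, one_mul, norm_mul]
    refine mul_le_mul_of_nonneg_right ?_ (norm_nonneg _)
    refine (Complex.norm_exp_sub_one_sub_id_le (hzm.trans hs)).trans ?_
    refine (pow_le_pow_left₀ (norm_nonneg _) hzm 2).trans (le_of_eq ?_)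
    rw [mul_pow, sq_abs, sq_abs]
    ring
  rw [hasDerivAt_iff_isLittleO]
  refine Asymptotics.IsBigO.trans_isLittleO (g := fun s => (s - t) ^ 2) ?_ ?_
  · refine Asymptotics.IsBigO.of_bound (m ^ 2 * ‖f‖) ?_
    have : Filter.Tendsto (fun s : ℝ => |s - t| * |m|) (nhds t) (nhds 0) := by
      have : Continuous fun s : ℝ => |s - t| * |m| := by fun_prop
      simpa using this.tendsto t
    filter_upwards [this.eventually_le_const one_pos] with s hs
    refine (hm s hs).trans (le_of_eq ?_)
    rw [Real.norm_of_nonneg (sq_nonneg _)]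
    ring
  · simpa only [Real.norm_eq_abs, sq_abs] using Asymptotics.isLittleO_pow_sub_sub t one_lt_two

theorem inner_fourier (f g : L2 d) : inner ℂ (𝓕 f : L2 d) (𝓕 g : L2 d) = inner ℂ f g :=
  (Lp.fourierTransformₗᵢ (Space d) ℂ).inner_map_map f g

theorem fourier_fourierInv (f : L2 d) : (𝓕 (𝓕⁻ f : L2 d) : L2 d) = f :=
  (Lp.fourierTransformₗᵢ (Space d) ℂ).apply_symm_apply f

theorem continuous_fourier : Continuous fun f : L2 d => (𝓕 f : L2 d) :=
  (Lp.fourierTransformₗᵢ (Space d) ℂ).continuous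

/-- The pairing of the transformed solution with e^{itφ} f is constant in time when φ is bounded on
the support of f. Such f detect every frequency, since φ is finite everywhere. -/
theorem IsSolution.fourier_eq (hd : 2 ≤ d) {τ : ℝ} {φ ψ : ℝ → ℝ} (hp : IsSmoothingPair τ φ ψ)
    {u : ℝ → L2 d} (hu : IsSolution φ u) (t : ℝ) :
    (𝓕 (u t) : L2 d) = phaseOperator hd hp t (𝓕 (u 0) : L2 d) := by
  obtain ⟨hc, hu⟩ := hu
  have hU : ∀ f k : L2 d, (k =ᵐ[volume] fun ξ => (φ (2 * Real.pi * ‖ξ‖) : ℂ) * f ξ) → ∀ t,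
      HasDerivAt (fun s => inner ℂ f (𝓕 (u s) : L2 d)) (Complex.I * inner ℂ k (𝓕 (u t) : L2 d)) t := by
    intro f k hk t
    have h1 := hu (𝓕⁻ f : L2 d) (𝓕⁻ k : L2 d) (by
      rw [IsRadialMultiplier, fourier_fourierInv, fourier_fourierInv]; exact hk) t
    simp_rw [← inner_fourier (𝓕⁻ _ : L2 d), fourier_fourierInv] at h1
    exact h1
  have hcU : Continuous fun s => (𝓕 (u s) : L2 d) := continuous_fourier.comp hc
  have hconst : ∀ (m : ℝ) (f : L2 d), (∀ᵐ ξ, f ξ ≠ 0 → |φ (2 * Real.pi * ‖ξ‖)| ≤ m) →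
      inner ℂ (phaseOperator hd hp t f) (𝓕 (u t) : L2 d) = inner ℂ f (𝓕 (u 0) : L2 d) := by
    intro m f hf
    have hφ := hp.aemeasurable_comp_norm hd
    have hkm : MemLp (fun ξ : Space d => (φ (2 * Real.pi * ‖ξ‖) : ℂ) * f ξ) 2 := by
      refine (Lp.memLp f).of_le_mul (c := m) ((Complex.measurable_ofReal.comp_aemeasurable
        hφ).aestronglyMeasurable.mul (Lp.aestronglyMeasurable f)) ?_
      filter_upwards [hf] with ξ hξ
      by_cases h0 : f ξ = 0
      · simp [h0]
      · rw [norm_mul, Complex.norm_real, Real.norm_eq_abs]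
        exact mul_le_mul_of_nonneg_right (hξ h0) (norm_nonneg _)
    set k : L2 d := hkm.toLp _
    have hk : k =ᵐ[volume] fun ξ => (φ (2 * Real.pi * ‖ξ‖) : ℂ) * f ξ := hkm.coeFn_toLp
    have hder : ∀ s, HasDerivAt (fun s => inner ℂ (phaseOperator hd hp s f) (𝓕 (u s) : L2 d)) 0 s := by
      intro s
      have h1 := hasDerivAt_inner_of_weak (hasDerivAt_phaseOperator hd hp hk hf s) hcU.continuousAt
        (hU (phaseOperator hd hp s f) (phaseOperator hd hp s k) (by
          filter_upwards [coeFn_phaseOperator hd hp s f, coeFn_phaseOperator hd hp s k, hk]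
            with ξ h1 h2 h3
          rw [h1, h2, h3]; ring) s)
      refine h1.congr_deriv ?_
      rw [inner_smul_left, Complex.conj_I]
      ring
    have h2 := is_const_of_deriv_eq_zero (fun s => (hder s).differentiableAt)
      (fun s => (hder s).deriv) t 0
    simpa only [phaseOperator_zero] using h2
  -- y is the defect between the solution, propagated back to time 0, and its initial data.
  set y : L2 d := phaseOperator hd hp (-t) (𝓕 (u t) : L2 d) - (𝓕 (u 0) : L2 d) with hy
  suffices y = 0 by
    rw [hy, sub_eq_zero] at this
    rw [← this, phaseOperator_phaseOperator, add_neg_cancel, phaseOperator_zero]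
  have h0 : ∀ m : ℕ, ∀ᵐ ξ, |φ (2 * Real.pi * ‖ξ‖)| ≤ m → y ξ = 0 := by
    intro m
    obtain ⟨g, hg⟩ := exists_phaseCutoff hd hp m y
    have h1 := hconst m g (by
      filter_upwards [hg] with ξ hξ h0
      by_contra h2
      exact h0 (by rw [hξ, if_neg h2]))
    rw [inner_phaseOperator, ← sub_eq_zero, ← inner_sub_right, ← hy] at h1
    -- The test function is the defect itself restricted to |φ| ≤ m, so the vanishing of the pairing
    -- is the vanishing of its norm.
    have h2 : inner ℂ g y = inner ℂ g g := by
      rw [L2.inner_def, L2.inner_def]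
      refine integral_congr_ae ?_
      filter_upwards [hg] with ξ hξ
      rw [hξ]
      split_ifs <;> simp
    rw [h2, inner_self_eq_zero, Lp.eq_zero_iff_ae_eq_zero] at h1
    filter_upwards [h1, hg] with ξ h3 h4 h5
    rw [h4, if_pos h5] at h3
    exact h3
  rw [Lp.eq_zero_iff_ae_eq_zero]
  filter_upwards [ae_all_iff.2 h0] with ξ hξ
  obtain ⟨m, hm⟩ := exists_nat_ge |φ (2 * Real.pi * ‖ξ‖)|
  exact hξ m hm

end Solutions

end AngularSmoothing

namespace AngularSmoothing

open MeasureTheory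
open scoped FourierTransform ENNReal ComplexConjugate

variable {d : ℕ}

/-! ### Existence of solutions. -/

section Existence

theorem continuous_phaseOperator (hd : 2 ≤ d) {τ : ℝ} {φ ψ : ℝ → ℝ} (hp : IsSmoothingPair τ φ ψ)
    (f : L2 d) : Continuous fun t => phaseOperator hd hp t f := by
  refine continuous_iff_continuousAt.2 fun t => ?_
  rw [ContinuousAt, tendsto_iff_edist_tendsto_0]
  have h1 : ∀ s, edist (phaseOperator hd hp s f) (phaseOperator hd hp t f) ^ 2 =
      ∫⁻ ξ, ‖(Complex.exp (Complex.I * s * φ (2 * Real.pi * ‖ξ‖)) -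
        Complex.exp (Complex.I * t * φ (2 * Real.pi * ‖ξ‖))) * f ξ‖ₑ ^ 2 := by
    intro s
    rw [edist_eq_enorm_sub, enorm_sq_Lp]
    refine lintegral_congr_ae ?_
    filter_upwards [coeFn_phaseOperator hd hp s f, coeFn_phaseOperator hd hp t f,
      Lp.coeFn_sub (phaseOperator hd hp s f) (phaseOperator hd hp t f)] with ξ h2 h3 h4
    rw [h4, Pi.sub_apply, h2, h3, sub_mul]
  have h2 : Filter.Tendsto (fun s : ℝ => ∫⁻ ξ, ‖(Complex.exp (Complex.I * s * φ (2 * Real.pi * ‖ξ‖)) -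
      Complex.exp (Complex.I * t * φ (2 * Real.pi * ‖ξ‖))) * f ξ‖ₑ ^ 2) (nhds t) (nhds 0) := by
    have := tendsto_lintegral_filter_of_dominated_convergence' (l := nhds t) (μ := volume)
      (F := fun s ξ => ‖(Complex.exp (Complex.I * (s : ℝ) * φ (2 * Real.pi * ‖ξ‖)) -
        Complex.exp (Complex.I * t * φ (2 * Real.pi * ‖ξ‖))) * f ξ‖ₑ ^ 2) (f := fun _ => 0)
      (fun ξ => 4 * ‖f ξ‖ₑ ^ 2) (Filter.Eventually.of_forall fun s => ?_)
      (Filter.Eventually.of_forall fun s => Filter.Eventually.of_forall fun ξ => ?_) ?_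
      (Filter.Eventually.of_forall fun ξ => ?_)
    · simpa using this
    · exact (((hp.aestronglyMeasurable_phase hd s).sub (hp.aestronglyMeasurable_phase hd t)).mul
        (Lp.aestronglyMeasurable f)).enorm.pow_const 2
    · rw [enorm_mul, mul_pow]
      refine mul_le_mul_left ?_ _
      refine (ENNReal.pow_le_pow_left (enorm_sub_le.trans (add_le_add (enorm_phase _ _).le
        (enorm_phase _ _).le))).trans ?_
      norm_num
    · rw [lintegral_const_mul' _ _ (by norm_num), ← enorm_sq_Lp]
      exact ENNReal.mul_ne_top (by norm_num) (by simp)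
    · have hc : Continuous fun s : ℝ => ‖(Complex.exp (Complex.I * (s : ℝ) *
          φ (2 * Real.pi * ‖ξ‖)) - Complex.exp (Complex.I * t * φ (2 * Real.pi * ‖ξ‖))) * f ξ‖ₑ ^ 2 :=
        by fun_prop
      simpa using hc.tendsto t
  exact tendsto_zero_of_sq (h2.congr fun s => (h1 s).symm)

/-- Differentiation under the integral, dominated by |k g|. All the decay is on the side of f, so g
is an arbitrary element of L². -/
theorem hasDerivAt_inner_phaseOperator (hd : 2 ≤ d) {τ : ℝ} {φ ψ : ℝ → ℝ}
    (hp : IsSmoothingPair τ φ ψ) {f k : L2 d}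
    (hk : k =ᵐ[volume] fun ξ => (φ (2 * Real.pi * ‖ξ‖) : ℂ) * f ξ) (g : L2 d) (t : ℝ) :
    HasDerivAt (fun s => inner ℂ f (phaseOperator hd hp s g))
      (Complex.I * inner ℂ k (phaseOperator hd hp t g)) t := by
  have h_int : ∀ f : L2 d, Integrable fun ξ => conj (f ξ) * g ξ := by
    intro f
    refine (L2.integrable_inner (𝕜 := ℂ) f g).congr (Filter.Eventually.of_forall fun ξ => ?_)
    simp only [RCLike.inner_apply, mul_comm]
  have hin : ∀ (f : L2 d) (s : ℝ), inner ℂ f (phaseOperator hd hp s g) =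
      ∫ ξ, Complex.exp (Complex.I * s * φ (2 * Real.pi * ‖ξ‖)) * (conj (f ξ) * g ξ) := by
    intro f s
    rw [L2.inner_def]
    refine integral_congr_ae ?_
    filter_upwards [coeFn_phaseOperator hd hp s g] with ξ h1
    rw [h1, RCLike.inner_apply]
    ring
  simp_rw [hin]
  have hm := fun s => hp.aestronglyMeasurable_phase hd s
  have hφ := (Complex.measurable_ofReal.comp_aemeasurable
    (hp.aemeasurable_comp_norm hd)).aestronglyMeasurable
  have key := hasDerivAt_integral_of_dominated_loc_of_deriv_le (μ := volume) (x₀ := t)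
    (s := Set.univ) (F := fun (s : ℝ) ξ => Complex.exp (Complex.I * s * φ (2 * Real.pi * ‖ξ‖)) *
      (conj (f ξ) * g ξ)) (F' := fun (s : ℝ) ξ => Complex.I * φ (2 * Real.pi * ‖ξ‖) *
      Complex.exp (Complex.I * s * φ (2 * Real.pi * ‖ξ‖)) * (conj (f ξ) * g ξ))
    (bound := fun ξ => ‖conj (k ξ) * g ξ‖) Filter.univ_mem
    (Filter.Eventually.of_forall fun s => (hm s).mul (h_int f).1)
    ((h_int f).mono ((hm t).mul (h_int f).1) (Filter.Eventually.of_forall fun ξ => by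
      rw [norm_mul, norm_phase, one_mul]))
    (((hφ.const_mul _).mul (hm t)).mul (h_int f).1) ?_ (h_int k).norm ?_
  · refine key.2.congr_deriv ?_
    rw [← integral_const_mul]
    refine integral_congr_ae ?_
    filter_upwards [hk] with ξ h1
    rw [h1, map_mul, Complex.conj_ofReal]
    ring
  · filter_upwards [hk] with ξ h1 s _
    rw [h1, map_mul, Complex.conj_ofReal, norm_mul, norm_mul, norm_mul Complex.I, norm_phase,
      Complex.norm_I, one_mul, mul_one, mul_assoc (_ : ℂ) (conj (f ξ)), norm_mul _ (_ * _)]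
  · refine Filter.Eventually.of_forall fun ξ s _ => ?_
    have h1 : HasDerivAt (fun s : ℝ => Complex.I * s * φ (2 * Real.pi * ‖ξ‖))
        (Complex.I * φ (2 * Real.pi * ‖ξ‖)) s := by
      have := (((hasDerivAt_id s).ofReal_comp).const_mul Complex.I).mul_const
        (φ (2 * Real.pi * ‖ξ‖) : ℂ)
      simpa using this
    refine (h1.cexp.mul_const (conj (f ξ) * g ξ)).congr_deriv ?_
    ring

/-- Every function in `L²` is the initial value of a solution. -/
theorem exists_isSolution (hd : 2 ≤ d) {τ : ℝ} {φ ψ : ℝ → ℝ} (hp : IsSmoothingPair τ φ ψ)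
    (f : L2 d) : ∃ u, IsSolution φ u ∧ u 0 = f := by
  refine ⟨fun t => (𝓕⁻ (phaseOperator hd hp t (𝓕 f : L2 d)) : L2 d), ⟨?_, ?_⟩, ?_⟩
  · exact (Lp.fourierTransformₗᵢ (Space d) ℂ).symm.continuous.comp (continuous_phaseOperator hd hp _)
  · intro g h hgh t
    have := hasDerivAt_inner_phaseOperator hd hp hgh (𝓕 f : L2 d) t
    simp_rw [← inner_fourier _ (𝓕⁻ _ : L2 d), fourier_fourierInv]
    exact this
  · simp only [phaseOperator_zero]
    exact (Lp.fourierTransformₗᵢ (Space d) ℂ).symm_apply_apply f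

end Existence

end AngularSmoothing

namespace AngularSmoothing

open MeasureTheory
open scoped FourierTransform ENNReal ComplexConjugate

variable {d : ℕ}

/-! ### From regular fields to the closure of the graph. -/

section SmoothedFields

theorem harmonicProj_phaseOperator (hd : 2 ≤ d) {τ : ℝ} {φ ψ : ℝ → ℝ} (hp : IsSmoothingPair τ φ ψ)
    (t : ℝ) (k : ℕ) (f : L2 d) :
    harmonicProj d k (phaseOperator hd hp t f) = phaseOperator hd hp t (harmonicProj d k f) :=
  harmonicProj_mulOperator hd (m := fun r => Complex.exp (Complex.I * t * φ (2 * Real.pi * r)))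
    (coeFn_phaseOperator hd hp t) k f

/-- The projections commute with the Fourier transform and with the phase, so whether u(t) lies in
the domain of θ(-Λ) does not depend on t. -/
theorem IsSolution.hasSum_fourier_iff (hd : 2 ≤ d) {τ : ℝ} {φ ψ : ℝ → ℝ}
    (hp : IsSmoothingPair τ φ ψ) {u : ℝ → L2 d} (hu : IsSolution φ u) (θ : ℝ → ℂ) (t : ℝ) (W : L2 d) :
    IsAngularMultiplier θ (u t) (𝓕⁻ (phaseOperator hd hp t W) : L2 d) ↔
      IsAngularMultiplier θ (𝓕 (u 0) : L2 d) W := by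
  have e1 : ∀ k, (phaseOperator hd hp t) (θ (sphereEigenvalue d k) • harmonicProj d k
      (𝓕 (u 0) : L2 d)) = Lp.fourierTransformₗᵢ (Space d) ℂ
        (θ (sphereEigenvalue d k) • harmonicProj d k (u t)) := by
    intro k
    rw [map_smul, map_smul, ← harmonicProj_phaseOperator, ← hu.fourier_eq hd hp]
    congr 1
    exact harmonicProj_fourier hd k (u t)
  constructor
  · intro h
    have h1 := ((Lp.fourierTransformₗᵢ (Space d) ℂ).toContinuousLinearEquiv :
      L2 d →L[ℂ] L2 d).hasSum h
    have h2 := (phaseOperator hd hp (-t)).hasSum h1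
    have e2 : phaseOperator hd hp (-t) (((Lp.fourierTransformₗᵢ (Space d) ℂ).toContinuousLinearEquiv :
        L2 d →L[ℂ] L2 d) (𝓕⁻ (phaseOperator hd hp t W) : L2 d)) = W := by
      change phaseOperator hd hp (-t) (𝓕 (𝓕⁻ (phaseOperator hd hp t W) : L2 d) : L2 d) = W
      rw [fourier_fourierInv, phaseOperator_phaseOperator, neg_add_cancel, phaseOperator_zero]
    rw [e2] at h2
    refine h2.congr_fun fun k => ?_
    change _ = phaseOperator hd hp (-t) (Lp.fourierTransformₗᵢ (Space d) ℂ _)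
    rw [← e1, phaseOperator_phaseOperator, neg_add_cancel, phaseOperator_zero]
  · intro h
    have h1 := (phaseOperator hd hp t).hasSum h
    have h2 := ((Lp.fourierTransformₗᵢ (Space d) ℂ).symm.toContinuousLinearEquiv :
      L2 d →L[ℂ] L2 d).hasSum h1
    refine h2.congr_fun fun k => ?_
    change _ = (Lp.fourierTransformₗᵢ (Space d) ℂ).symm (phaseOperator hd hp t _)
    rw [e1, LinearIsometryEquiv.symm_apply_apply]

theorem IsAngularMultiplier.angularNorm_eq (hd : 2 ≤ d) {τ : ℝ} (hτ : τ ∈ Set.Ioo (1 : ℝ) d)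
    {θ : ℝ → ℂ} {f W : L2 d} (h : IsAngularMultiplier θ f W) :
    angularNorm (angularWeight d τ) W = angularNorm (beta d τ θ) f := by
  refine (ENNReal.pow_right_strictMono two_ne_zero).injective ?_
  simp only [angularNorm_sq]
  refine tsum_congr fun k => ?_
  have h1 : harmonicProj d k W = θ (sphereEigenvalue d k) • harmonicProj d k f :=
    closureProj_eq_of_hasSum (harmonicSpace_isOrtho hd)
      (fun k => Submodule.smul_mem _ _ (closureProj_mem (harmonicSpace d) k f)) h k
  rw [h1, enorm_smul, mul_pow, beta_eq, ENNReal.ofReal_mul (angularConst_pos hτ k).le,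
    ENNReal.ofReal_pow (norm_nonneg _), ofReal_norm, mul_assoc, angularWeight]

/-- One good time t₀ provides W and V by undoing the phase. By uniqueness of sums the same W arises
at almost every time, so `weightedNorm_eq_angularNorm` applies; the factors |θ(μ_k)|² then turn its
weights into β_k. -/
theorem weightedNorm_of_isRegularField (hd : 2 ≤ d) {τ : ℝ} (hτ : τ ∈ Set.Ioo (1 : ℝ) d)
    {φ ψ : ℝ → ℝ} (hp : IsSmoothingPair τ φ ψ) {θ : ℝ → ℂ} {u : ℝ → L2 d} (hu : IsSolution φ u)
    {F : ℝ → Space d → ℂ} (hF : IsRegularField ψ θ u F) :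
    weightedNorm τ F = angularNorm (beta d τ θ) (u 0) := by
  have key : ∀ t : ℝ, ∀ w : L2 d, IsAngularMultiplier θ (u t) w →
      IsAngularMultiplier θ (𝓕 (u 0) : L2 d) (phaseOperator hd hp (-t) (𝓕 w : L2 d)) := by
    intro t w hw
    rw [← hu.hasSum_fourier_iff hd hp θ t, phaseOperator_phaseOperator, add_neg_cancel,
      phaseOperator_zero]
    rwa [show (𝓕⁻ (𝓕 w : L2 d) : L2 d) = w from
      (Lp.fourierTransformₗᵢ (Space d) ℂ).symm_apply_apply w]
  obtain ⟨t₀, w₀, v₀, hw₀, hv₀, -⟩ := hF.2.exists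
  set W := phaseOperator hd hp (-t₀) (𝓕 w₀ : L2 d) with hW
  set V := phaseOperator hd hp (-t₀) (𝓕 v₀ : L2 d) with hV
  have hWsum := key t₀ w₀ hw₀
  have hVW : V =ᵐ[volume] fun ξ => (ψ (2 * Real.pi * ‖ξ‖) : ℂ) * W ξ := by
    filter_upwards [hv₀, coeFn_phaseOperator hd hp (-t₀) (𝓕 w₀ : L2 d),
      coeFn_phaseOperator hd hp (-t₀) (𝓕 v₀ : L2 d)] with ξ h1 h2 h3
    rw [hV, h3, h1, hW, h2]
    ring
  rw [weightedNorm_eq_angularNorm hd hτ hp hVW hF.1, hWsum.angularNorm_eq hd hτ, angularNorm_fourier hd]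
  filter_upwards [hF.2] with t ⟨w, v, hw, hv, hFv⟩
  refine ⟨v, hFv, ?_⟩
  have h1 : phaseOperator hd hp (-t) (𝓕 w : L2 d) = W := (key t w hw).unique hWsum
  have h2 : (𝓕 w : L2 d) = phaseOperator hd hp t W := by
    rw [← h1, phaseOperator_phaseOperator, add_neg_cancel, phaseOperator_zero]
  rw [IsRadialMultiplier, h2] at hv
  filter_upwards [hv, hVW, coeFn_phaseOperator hd hp t W] with ξ h3 h4 h5
  rw [h3, h4, h5]
  ring

theorem IsSolution.sub {φ : ℝ → ℝ} {u u' : ℝ → L2 d} (hu : IsSolution φ u) (hu' : IsSolution φ u') :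
    IsSolution φ (fun t => u t - u' t) := by
  refine ⟨hu.1.sub hu'.1, fun g h hgh t => ?_⟩
  simp_rw [inner_sub_right, mul_sub]
  exact (hu.2 g h hgh t).sub (hu'.2 g h hgh t)

theorem IsRadialMultiplier.sub {m : ℝ → ℝ} {f f' h h' : L2 d} (hf : IsRadialMultiplier m f h)
    (hf' : IsRadialMultiplier m f' h') : IsRadialMultiplier m (f - f') (h - h') := by
  have e : ∀ a b : L2 d, (𝓕 (a - b) : L2 d) = (𝓕 a : L2 d) - (𝓕 b : L2 d) :=
    map_sub (Lp.fourierTransformₗᵢ (Space d) ℂ)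
  rw [IsRadialMultiplier, e, e]
  filter_upwards [hf, hf', Lp.coeFn_sub (𝓕 f : L2 d) (𝓕 f' : L2 d),
    Lp.coeFn_sub (𝓕 h : L2 d) (𝓕 h' : L2 d)] with ξ h1 h2 h3 h4
  rw [h4, h3, Pi.sub_apply, Pi.sub_apply, h1, h2, mul_sub]

theorem IsAngularMultiplier.sub {θ : ℝ → ℂ} {f f' h h' : L2 d} (hf : IsAngularMultiplier θ f h)
    (hf' : IsAngularMultiplier θ f' h') : IsAngularMultiplier θ (f - f') (h - h') := by
  unfold IsAngularMultiplier
  simp_rw [map_sub, smul_sub]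
  exact HasSum.sub hf hf'

theorem IsRegularField.sub {ψ : ℝ → ℝ} {θ : ℝ → ℂ} {u u' : ℝ → L2 d} {F F' : ℝ → Space d → ℂ}
    (hF : IsRegularField ψ θ u F) (hF' : IsRegularField ψ θ u' F') :
    IsRegularField ψ θ (fun t => u t - u' t) (fun t x => F t x - F' t x) := by
  refine ⟨hF.1.sub hF'.1, ?_⟩
  filter_upwards [hF.2, hF'.2] with t ⟨w, v, h1, h2, h3⟩ ⟨w', v', h1', h2', h3'⟩
  exact ⟨w - w', v - v', h1.sub h1', h2.sub h2', (h3.sub h3').trans (Lp.coeFn_sub v v').symm⟩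

theorem angularNorm_le_liminf {c : ℕ → ℝ≥0∞} (hc : ∀ k, c k ≠ ∞) {a : ℕ → L2 d} {f : L2 d}
    (ha : Filter.Tendsto a Filter.atTop (nhds f)) :
    angularNorm c f ^ 2 ≤ Filter.liminf (fun n => angularNorm c (a n) ^ 2) Filter.atTop :=
  (LowerSemicontinuousAt.le_liminf (lowerSemicontinuous_angularNorm_sq c hc f)).trans
    (Filter.liminf_le_liminf_of_le ha)

theorem beta_ne_top (τ : ℝ) (θ : ℝ → ℂ) (k : ℕ) : beta d τ θ k ≠ ∞ := ENNReal.ofReal_ne_top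

/-- The norm of F is determined by the data alone, so the closure of the graph is single-valued up
to null sets of the weight. The regular case is used for the approximations and for their
differences. -/
theorem weightedNorm_of_isSmoothedField (hd : 2 ≤ d) {τ : ℝ} (hτ : τ ∈ Set.Ioo (1 : ℝ) d)
    {φ ψ : ℝ → ℝ} (hp : IsSmoothingPair τ φ ψ) {θ : ℝ → ℂ} {u : ℝ → L2 d}
    {F : ℝ → Space d → ℂ} (hF : IsSmoothedField τ φ ψ θ u F) :
    weightedNorm τ F = angularNorm (beta d τ θ) (u 0) := by
  obtain ⟨hFm, hF⟩ := hF
  have h := fun n : ℕ => hF (1 / ((n : ℝ) + 1)) (by positivity)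
  choose v G hv hG hvu hGF using h
  set N := angularNorm (d := d) (beta d τ θ) with hN
  set η : ℕ → ℝ≥0∞ := fun n => weightedNorm τ (fun t x => G n t x - F t x) with hη
  have hη0 : Filter.Tendsto η Filter.atTop (nhds 0) := by
    refine tendsto_zero_of_sq (tendsto_of_tendsto_of_tendsto_of_le_of_le tendsto_const_nhds
      (h := fun n : ℕ => ENNReal.ofReal (1 / ((n : ℝ) + 1))) ?_ (fun _ => zero_le) fun n => ?_)
    · simpa using ENNReal.tendsto_ofReal (tendsto_one_div_add_atTop_nhds_zero_nat (𝕜 := ℝ))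
    · simp only [hη]
      rw [weightedNorm_sq ((hG n).1.sub hFm)]
      exact hGF n
  have ha : Filter.Tendsto (fun n => v n 0) Filter.atTop (nhds (u 0)) := by
    rw [tendsto_iff_norm_sub_tendsto_zero]
    exact squeeze_zero (fun _ => norm_nonneg _) hvu tendsto_one_div_add_atTop_nhds_zero_nat
  have hGn : ∀ n, weightedNorm τ (G n) = N (v n 0) := fun n =>
    weightedNorm_of_isRegularField hd hτ hp (hv n) (hG n)
  have hdiff : ∀ n m, N (v n 0 - v m 0) ≤ η n + η m := by
    intro n m
    have h1 := weightedNorm_of_isRegularField hd hτ hp ((hv n).sub (hv m)) ((hG n).sub (hG m))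
    rw [hN, ← h1]
    have h2 := weightedNorm_add_le (τ := τ) (F := fun t x => G n t x - F t x)
      (G := fun t x => F t x - G m t x) ((hG n).1.sub hFm) (hFm.sub (hG m).1)
    simp only [sub_add_sub_cancel] at h2
    refine h2.trans (add_le_add le_rfl (le_of_eq ?_))
    rw [weightedNorm_sub_comm]
  -- The limit data need not have a regular field, so the difference v n - v m is used, and lower
  -- semicontinuity sends m to infinity.
  have hlimdiff : ∀ n, N (v n 0 - u 0) ≤ η n := by
    intro n
    rw [← ENNReal.pow_le_pow_left_iff two_ne_zero]
    refine (angularNorm_le_liminf (beta_ne_top τ θ) (ha.const_sub (v n 0))).trans ?_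
    refine (Filter.liminf_le_liminf (Filter.Eventually.of_forall fun m =>
      ENNReal.pow_le_pow_left (hdiff n m))).trans (le_of_eq (Filter.Tendsto.liminf_eq ?_))
    refine ((ENNReal.continuous_pow 2).tendsto _).comp ?_
    simpa using hη0.const_add (η n)
  have hlim : ∀ a : ℝ≥0∞, Filter.Tendsto (fun n => a + η n + η n) Filter.atTop (nhds a) := by
    intro a
    simpa using (hη0.const_add a).add hη0
  refine le_antisymm (ge_of_tendsto' (hlim _) fun n => ?_) (ge_of_tendsto' (hlim _) fun n => ?_)
  · refine (weightedNorm_le_add_sub hFm (hG n).1).trans (add_le_add ?_ ?_)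
    · rw [hGn]
      exact (angularNorm_le_add_sub _ _ (u 0)).trans (add_le_add_right (hlimdiff n) _)
    · rw [weightedNorm_sub_comm]
  · refine (angularNorm_le_add_sub _ (u 0) (v n 0)).trans (add_le_add ?_ ?_)
    · change N (v n 0) ≤ _
      rw [← hGn]
      exact weightedNorm_le_add_sub (hG n).1 hFm
    · rw [angularNorm_sub_comm]
      exact hlimdiff n

end SmoothedFields

end AngularSmoothing

namespace AngularSmoothing

open MeasureTheory
open scoped FourierTransform ENNReal ComplexConjugate

variable {d : ℕ}

/-! ### Truncated data and the energy identity. -/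

section Truncation

/-- Multiplication by the characteristic function of `|ξ| ∈ cutoffSet τ φ m`. -/
noncomputable def cutoffOperator (d : ℕ) (τ : ℝ) (φ : ℝ → ℝ) (m : ℝ) : L2 d →L[ℂ] L2 d :=
  (exists_mulOperator (g := fun ξ : Space d => cutoff τ φ m ‖ξ‖)
    ((measurable_cutoff τ φ m).comp measurable_norm).aestronglyMeasurable (C := 1)
    fun _ => norm_cutoff_le _ _ _ _).choose

theorem coeFn_cutoffOperator (τ : ℝ) (φ : ℝ → ℝ) (m : ℝ) (f : L2 d) :
    cutoffOperator d τ φ m f =ᵐ[volume] fun ξ => cutoff τ φ m ‖ξ‖ * f ξ :=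
  (exists_mulOperator (g := fun ξ : Space d => cutoff τ φ m ‖ξ‖)
    ((measurable_cutoff τ φ m).comp measurable_norm).aestronglyMeasurable (C := 1)
    fun _ => norm_cutoff_le _ _ _ _).choose_spec f

theorem harmonicProj_cutoffOperator (hd : 2 ≤ d) (τ : ℝ) (φ : ℝ → ℝ) (m : ℝ) (k : ℕ) (f : L2 d) :
    harmonicProj d k (cutoffOperator d τ φ m f) = cutoffOperator d τ φ m (harmonicProj d k f) :=
  harmonicProj_mulOperator hd (coeFn_cutoffOperator τ φ m) k f

theorem norm_cutoffOperator_le (τ : ℝ) (φ : ℝ → ℝ) (m : ℝ) (f : L2 d) :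
    ‖cutoffOperator d τ φ m f‖ ≤ ‖f‖ := by
  refine Lp.norm_le_norm_of_ae_le ?_
  filter_upwards [coeFn_cutoffOperator τ φ m f] with ξ h
  rw [h, norm_mul]
  exact mul_le_of_le_one_left (norm_nonneg _) (norm_cutoff_le _ _ _ _)

theorem norm_cutoffOperator_sub_le (τ : ℝ) (φ : ℝ → ℝ) (m : ℝ) (f : L2 d) :
    ‖cutoffOperator d τ φ m f - f‖ ≤ ‖f‖ := by
  refine Lp.norm_le_norm_of_ae_le ?_
  filter_upwards [coeFn_cutoffOperator τ φ m f, Lp.coeFn_sub (cutoffOperator d τ φ m f) f] with ξ h h'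
  rw [h', Pi.sub_apply, h]
  by_cases hξ : ‖ξ‖ ∈ cutoffSet τ φ m
  · simp [cutoff_of_mem hξ]
  · simp [cutoff_of_notMem hξ]

theorem tendsto_cutoffOperator (hd : 2 ≤ d) {τ : ℝ} {φ ψ : ℝ → ℝ} (hp : IsSmoothingPair τ φ ψ)
    (f : L2 d) : Filter.Tendsto (fun n : ℕ => ‖cutoffOperator d τ φ n f - f‖ₑ) Filter.atTop
      (nhds 0) := by
  refine tendsto_zero_of_sq ?_
  have h1 : ∀ n : ℕ, ‖cutoffOperator d τ φ n f - f‖ₑ ^ 2 =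
      ∫⁻ ξ, ‖cutoff τ φ n ‖ξ‖ * f ξ - f ξ‖ₑ ^ 2 := by
    intro n
    rw [enorm_sq_Lp]
    refine lintegral_congr_ae ?_
    filter_upwards [coeFn_cutoffOperator τ φ n f, Lp.coeFn_sub (cutoffOperator d τ φ n f) f]
      with ξ h h'
    rw [h', Pi.sub_apply, h]
  simp_rw [h1]
  have := tendsto_lintegral_of_dominated_convergence' (μ := volume)
    (F := fun (n : ℕ) (ξ : Space d) => ‖cutoff τ φ n ‖ξ‖ * f ξ - f ξ‖ₑ ^ 2) (f := fun _ => 0)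
    (fun ξ => ‖f ξ‖ₑ ^ 2) (fun n => ?_) (fun n => Filter.Eventually.of_forall fun ξ => ?_) ?_ ?_
  · simpa using this
  · exact (((((measurable_cutoff τ φ n).comp measurable_norm).aestronglyMeasurable (μ := volume)).mul
      (Lp.aestronglyMeasurable f)).sub (Lp.aestronglyMeasurable f)).enorm.pow_const 2
  · by_cases hξ : ‖ξ‖ ∈ cutoffSet τ φ n
    · simp [cutoff_of_mem hξ]
    · simp [cutoff_of_notMem hξ]
  · rw [← enorm_sq_Lp]
    simp
  · filter_upwards [ae_norm_pos hd] with ξ hξ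
    refine tendsto_const_nhds.congr' ?_
    filter_upwards [hp.eventually_cutoff_eq_one hξ] with n hn
    simp [hn]

/-- The truncation of `f` in frequency and in the degree of the spherical harmonics. -/
noncomputable def truncation (τ : ℝ) (φ : ℝ → ℝ) (n : ℕ) (f : L2 d) : L2 d :=
  cutoffOperator d τ φ n (∑ k ∈ Finset.range n, harmonicProj d k f)

theorem harmonicProj_truncation (hd : 2 ≤ d) (τ : ℝ) (φ : ℝ → ℝ) (n k : ℕ) (f : L2 d) :
    harmonicProj d k (truncation τ φ n f) =
      if k < n then cutoffOperator d τ φ n (harmonicProj d k f) else 0 := by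
  rw [truncation, harmonicProj_cutoffOperator hd]
  have h1 : harmonicProj d k (∑ j ∈ Finset.range n, harmonicProj d j f) =
      if k < n then harmonicProj d k f else 0 := by
    rw [map_sum]
    have h2 : ∀ j, harmonicProj d k (harmonicProj d j f) =
        if j = k then harmonicProj d k f else 0 := by
      intro j
      split_ifs with h
      · rw [h]
        exact closureProj_of_mem (closureProj_mem (harmonicSpace d) k f)
      · exact closureProj_of_mem_ne (harmonicSpace_isOrtho hd) h
          (closureProj_mem (harmonicSpace d) j f)
    simp [h2]
  rw [h1]
  split_ifs <;> simp

theorem angularNorm_truncation_le (hd : 2 ≤ d) (τ : ℝ) (φ : ℝ → ℝ) (c : ℕ → ℝ≥0∞) (n : ℕ) (f : L2 d) :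
    angularNorm c (truncation τ φ n f) ≤ angularNorm c f := by
  refine eLpNorm_mono fun k => ?_
  rw [harmonicProj_truncation hd]
  split_ifs
  · exact norm_cutoffOperator_le _ _ _ _
  · simp

/-- Dominated convergence over the degrees, the terms of the finite norm of f being the majorant. -/
theorem tendsto_angularNorm_truncation_sub (hd : 2 ≤ d) {τ : ℝ} {φ ψ : ℝ → ℝ}
    (hp : IsSmoothingPair τ φ ψ) {c : ℕ → ℝ≥0∞} (hc : ∀ k, c k ≠ ∞) {f : L2 d}
    (hf : angularNorm c f ≠ ∞) :
    Filter.Tendsto (fun n => angularNorm c (truncation τ φ n f - f)) Filter.atTop (nhds 0) := by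
  refine tendsto_zero_of_sq ?_
  simp_rw [angularNorm_sq, ← lintegral_count]
  have := tendsto_lintegral_of_dominated_convergence (μ := Measure.count)
    (F := fun (n k : ℕ) => c k * ‖harmonicProj d k (truncation τ φ n f - f)‖ₑ ^ 2) (f := fun _ => 0)
    (fun k => c k * ‖harmonicProj d k f‖ₑ ^ 2) (fun n => measurable_of_countable _)
    (fun n => Filter.Eventually.of_forall fun k => ?_) ?_ (Filter.Eventually.of_forall fun k => ?_)
  · simpa using this
  · refine mul_le_mul_right (ENNReal.pow_le_pow_left ?_) _
    rw [map_sub, harmonicProj_truncation hd]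
    split_ifs
    · rw [← ofReal_norm, ← ofReal_norm]
      exact ENNReal.ofReal_le_ofReal (norm_cutoffOperator_sub_le _ _ _ _)
    · simp
  · rw [lintegral_count, ← angularNorm_sq]
    exact ENNReal.pow_ne_top hf
  · have h1 : Filter.Tendsto (fun n : ℕ => c k * ‖cutoffOperator d τ φ n (harmonicProj d k f) -
        harmonicProj d k f‖ₑ ^ 2) Filter.atTop (nhds (c k * 0 ^ 2)) :=
      ENNReal.Tendsto.const_mul (((ENNReal.continuous_pow 2).tendsto _).comp
        (tendsto_cutoffOperator hd hp _)) (Or.inr (hc k))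
    rw [zero_pow two_ne_zero, mul_zero] at h1
    refine h1.congr' ?_
    filter_upwards [Filter.eventually_gt_atTop k] with n hn
    rw [map_sub, harmonicProj_truncation hd, if_pos hn]

theorem angularNorm_one (hd : 2 ≤ d) (f : L2 d) : angularNorm (fun _ => 1) f = ‖f‖ₑ := by
  refine (ENNReal.pow_right_strictMono two_ne_zero).injective ?_
  simp only [angularNorm_sq, one_mul]
  exact (enorm_sq_eq_tsum_harmonicProj hd f).symm

theorem isAngularMultiplier_truncation (hd : 2 ≤ d) (τ : ℝ) (φ : ℝ → ℝ) (θ : ℝ → ℂ) (n : ℕ)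
    (f : L2 d) : IsAngularMultiplier θ (truncation τ φ n f) (cutoffOperator d τ φ n
      (∑ k ∈ Finset.range n, θ (sphereEigenvalue d k) • harmonicProj d k f)) := by
  have h1 : cutoffOperator d τ φ n (∑ k ∈ Finset.range n, θ (sphereEigenvalue d k) •
      harmonicProj d k f) = ∑ k ∈ Finset.range n, θ (sphereEigenvalue d k) •
        harmonicProj d k (truncation τ φ n f) := by
    rw [map_sum]
    refine Finset.sum_congr rfl fun k hk => ?_
    rw [map_smul, harmonicProj_truncation hd, if_pos (Finset.mem_range.1 hk)]
  rw [h1]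
  refine hasSum_sum_of_ne_finset_zero fun k hk => ?_
  rw [harmonicProj_truncation hd, if_neg (by simpa using hk), smul_zero]

theorem integrable_of_memLp_of_support {f : Space d → ℂ} (hf : MemLp f 2) {R : ℝ}
    (hR : ∀ ξ, f ξ ≠ 0 → ‖ξ‖ ≤ R) : Integrable f := by
  have h1 : (Metric.closedBall (0 : Space d) R).indicator f = f := by
    rw [Set.indicator_eq_self]
    intro ξ hξ
    simpa using hR ξ hξ
  have : IsFiniteMeasure ((volume : Measure (Space d)).restrict (Metric.closedBall 0 R)) :=
    ⟨by simpa using measure_closedBall_lt_top⟩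
  rw [← h1, integrable_indicator_iff measurableSet_closedBall]
  exact (hf.restrict _).integrable (by norm_num)

/-- Truncated data have a regular field. -/
theorem exists_isRegularField (hd : 2 ≤ d) {τ : ℝ} {φ ψ : ℝ → ℝ} (hp : IsSmoothingPair τ φ ψ)
    (θ : ℝ → ℂ) {u : ℝ → L2 d} (hu : IsSolution φ u) {n : ℕ} {f : L2 d}
    (hf : (𝓕 (u 0) : L2 d) = truncation τ φ n f) : ∃ F, IsRegularField ψ θ u F := by
  set g : L2 d := ∑ k ∈ Finset.range n, θ (sphereEigenvalue d k) • harmonicProj d k f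
  set W : L2 d := cutoffOperator d τ φ n g with hW
  have hWsum : IsAngularMultiplier θ (𝓕 (u 0) : L2 d) W := by
    rw [hf]
    exact isAngularMultiplier_truncation hd τ φ θ n f
  -- The cutoff bounds both ψ and |ξ|, so V is in L¹ ∩ L²; thus the field is given pointwise by a
  -- Fourier integral and is jointly measurable.
  set V : Space d → ℂ := fun ξ => (ψ (2 * Real.pi * ‖ξ‖) : ℂ) * (cutoff τ φ n ‖ξ‖ * g ξ) with hV
  have hVm : AEStronglyMeasurable V :=
    (Complex.measurable_ofReal.comp_aemeasurable (hp.aemeasurable_comp_norm' hd)).aestronglyMeasurable.mul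
      ((((measurable_cutoff τ φ n).comp measurable_norm).aestronglyMeasurable).mul
        (Lp.aestronglyMeasurable g))
  have hV2 : MemLp V 2 := by
    refine (Lp.memLp g).of_le_mul (c := n) hVm (Filter.Eventually.of_forall fun ξ => ?_)
    by_cases hξ : ‖ξ‖ ∈ cutoffSet τ φ n
    · simp only [hV, cutoff_of_mem hξ, one_mul, norm_mul, Complex.norm_real, Real.norm_eq_abs]
      exact mul_le_mul_of_nonneg_right (hp.abs_le_of_mem_cutoffSet hξ) (norm_nonneg _)
    · simp only [hV, cutoff_of_notMem hξ, zero_mul, mul_zero, norm_zero]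
      positivity
  have hV1 : Integrable V := by
    refine integrable_of_memLp_of_support hV2 (R := n) fun ξ hξ => ?_
    by_contra h0
    refine hξ ?_
    have : ‖ξ‖ ∉ cutoffSet τ φ n := fun h => h0 h.2.1
    simp [hV, cutoff_of_notMem this]
  have hVW : (hV2.toLp V : L2 d) =ᵐ[volume] fun ξ => (ψ (2 * Real.pi * ‖ξ‖) : ℂ) * W ξ := by
    filter_upwards [hV2.coeFn_toLp, coeFn_cutoffOperator τ φ n g] with ξ h1 h2
    rw [h1, hW, h2]
  refine ⟨waveField φ V, (stronglyMeasurable_waveField (hp.aemeasurable_comp_norm hd)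
    hVm).aestronglyMeasurable, Filter.Eventually.of_forall fun t => ?_⟩
  refine ⟨(𝓕⁻ (phaseOperator hd hp t W) : L2 d), (𝓕⁻ (phaseOperator hd hp t (hV2.toLp V)) : L2 d),
    (hu.hasSum_fourier_iff hd hp θ t W).2 hWsum, ?_, ?_⟩
  · rw [IsRadialMultiplier, fourier_fourierInv, fourier_fourierInv]
    filter_upwards [hVW, coeFn_phaseOperator hd hp t W, coeFn_phaseOperator hd hp t (hV2.toLp V)]
      with ξ h1 h2 h3
    rw [h3, h1, h2]
    ring
  · have hm := hp.aestronglyMeasurable_phase hd t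
    have i1 : Integrable fun ξ => Complex.exp (Complex.I * t * φ (2 * Real.pi * ‖ξ‖)) * V ξ :=
      hV1.mono (hm.mul hVm) (Filter.Eventually.of_forall fun ξ => by
        rw [norm_mul, norm_phase, one_mul])
    have i2 : MemLp (fun ξ => Complex.exp (Complex.I * t * φ (2 * Real.pi * ‖ξ‖)) * V ξ) 2 :=
      hV2.of_le (hm.mul hVm) (Filter.Eventually.of_forall fun ξ => by
        rw [norm_mul, norm_phase, one_mul])
    have e : i2.toLp _ = phaseOperator hd hp t (hV2.toLp V) := by
      refine Lp.ext ?_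
      filter_upwards [i2.coeFn_toLp, coeFn_phaseOperator hd hp t (hV2.toLp V), hV2.coeFn_toLp]
        with ξ h1 h2 h3
      rw [h1, h2, h3]
    rw [← e]
    exact (fourierInv_toLp_ae i1 i2).symm

/-- The fields of the truncated data are Cauchy in the weighted L² space, by the exact identity for
their differences. Completeness supplies F. -/
theorem exists_isSmoothedField (hd : 2 ≤ d) {τ : ℝ} (hτ : τ ∈ Set.Ioo (1 : ℝ) d)
    {φ ψ : ℝ → ℝ} (hp : IsSmoothingPair τ φ ψ) {θ : ℝ → ℂ} {u : ℝ → L2 d}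
    (hfin : angularNorm (beta d τ θ) (u 0) ≠ ∞) : ∃ F, IsSmoothedField τ φ ψ θ u F := by
  set f : L2 d := (𝓕 (u 0) : L2 d) with hf
  have hfinf : angularNorm (beta d τ θ) f ≠ ∞ := by rwa [hf, angularNorm_fourier hd]
  have hex := fun n : ℕ => exists_isSolution hd hp (𝓕⁻ (truncation τ φ n f) : L2 d)
  choose v hv hv0 using hex
  have hvf : ∀ n, (𝓕 (v n 0) : L2 d) = truncation τ φ n f := fun n => by
    rw [hv0, fourier_fourierInv]
  choose G hG using fun n => exists_isRegularField hd hp θ (hv n) (hvf n)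
  have hsub : ∀ a b : L2 d, (𝓕 (a - b) : L2 d) = (𝓕 a : L2 d) - (𝓕 b : L2 d) :=
    map_sub (Lp.fourierTransformₗᵢ (Space d) ℂ)
  have hdist : ∀ (c : ℕ → ℝ≥0∞) (n : ℕ), angularNorm c (v n 0 - u 0) =
      angularNorm c (truncation τ φ n f - f) := by
    intro c n
    rw [← angularNorm_fourier hd, hsub, hvf]
  have hGm : ∀ n, AEStronglyMeasurable (Function.uncurry (G n)) (weightedMeasure d τ) := fun n =>
    (hG n).1.mono_ac (weightedMeasure_absolutelyContinuous d τ)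
  have hGLp : ∀ n, MemLp (Function.uncurry (G n)) 2 (weightedMeasure d τ) := by
    refine fun n => ⟨hGm n, ?_⟩
    change weightedNorm τ (G n) < ∞
    rw [weightedNorm_of_isRegularField hd hτ hp (hv n) (hG n), ← angularNorm_fourier hd, hvf]
    exact (angularNorm_truncation_le hd τ φ _ n f).trans_lt (lt_top_iff_ne_top.2 hfinf)
  set δ : ℕ → ℝ≥0∞ := fun n => angularNorm (beta d τ θ) (truncation τ φ n f - f) with hδ
  have hδ0 : Filter.Tendsto δ Filter.atTop (nhds 0) :=
    tendsto_angularNorm_truncation_sub hd hp (beta_ne_top τ θ) hfinf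
  have hed : ∀ n m, edist ((hGLp n).toLp _) ((hGLp m).toLp _) ≤ δ n + δ m := by
    intro n m
    rw [Lp.edist_toLp_toLp]
    change weightedNorm τ (fun t x => G n t x - G m t x) ≤ _
    rw [weightedNorm_of_isRegularField hd hτ hp ((hv n).sub (hv m)) ((hG n).sub (hG m)),
      ← sub_add_sub_cancel _ (u 0)]
    refine (angularNorm_add_le _ _ _).trans (add_le_add (hdist _ n).le ?_)
    rw [angularNorm_sub_comm]
    exact (hdist _ m).le
  have hcauchy : CauchySeq fun n => (hGLp n).toLp (Function.uncurry (G n)) := by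
    rw [EMetric.cauchySeq_iff]
    intro ε hε
    obtain ⟨N, hN⟩ := Filter.eventually_atTop.1 (hδ0.eventually_lt_const (ENNReal.half_pos hε.ne'))
    refine ⟨N, fun m hm n hn => (hed m n).trans_lt ?_⟩
    exact (ENNReal.add_lt_add (hN m hm) (hN n hn)).trans_eq (ENNReal.add_halves ε)
  obtain ⟨L, hL⟩ := cauchySeq_tendsto_of_complete hcauchy
  have hLm : StronglyMeasurable (L : ℝ × Space d → ℂ) := Lp.stronglyMeasurable L
  refine ⟨fun t x => L (t, x), hLm.aestronglyMeasurable, fun ε hε => ?_⟩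
  -- Convergence of the data in L² is the same truncation statement with all weights equal to 1.
  have hu0 : Filter.Tendsto (fun n => ‖v n 0 - u 0‖ₑ) Filter.atTop (nhds 0) := by
    simp_rw [← angularNorm_one hd, hdist]
    exact tendsto_angularNorm_truncation_sub hd hp (by simp) (by rw [angularNorm_one hd]; simp)
  have hwn : Filter.Tendsto (fun n => weightedIntegral τ (fun t x => G n t x - L (t, x)))
      Filter.atTop (nhds 0) := by
    have h1 : ∀ n, weightedIntegral τ (fun t x => G n t x - L (t, x)) =
        edist ((hGLp n).toLp _) L ^ 2 := by
      intro n
      rw [← weightedNorm_sq ((hG n).1.sub hLm.aestronglyMeasurable)]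
      congr 1
      conv_rhs => rw [← Lp.toLp_coeFn L (Lp.memLp L), Lp.edist_toLp_toLp]
      rfl
    simp_rw [h1]
    have h2 := ((ENNReal.continuous_pow 2).tendsto _).comp (tendsto_iff_edist_tendsto_0.1 hL)
    rw [zero_pow two_ne_zero] at h2
    exact h2
  obtain ⟨n, hn1, hn2⟩ := ((hu0.eventually_le_const (ENNReal.ofReal_pos.2 hε)).and
    (hwn.eventually_le_const (ENNReal.ofReal_pos.2 hε))).exists
  refine ⟨v n, G n, hv n, hG n, ?_, hn2⟩
  rw [← ofReal_norm] at hn1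
  exact (ENNReal.ofReal_le_ofReal_iff hε.le).1 hn1

/-- The smoothing energy is diagonal with respect to the spherical harmonics decomposition. -/
theorem smoothingEnergy_eq (hd : 2 ≤ d) {τ : ℝ} (hτ : τ ∈ Set.Ioo (1 : ℝ) d)
    {φ ψ : ℝ → ℝ} (hp : IsSmoothingPair τ φ ψ) (θ : ℝ → ℂ) (u : ℝ → L2 d) :
    smoothingEnergy τ φ ψ θ u = ∑' k, beta d τ θ k * ‖harmonicProj d k (u 0)‖ₑ ^ 2 := by
  rw [← angularNorm_sq]
  have h1 : ∀ F, IsSmoothedField τ φ ψ θ u F →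
      weightedIntegral τ F = angularNorm (beta d τ θ) (u 0) ^ 2 := fun F hF => by
    rw [← weightedNorm_sq hF.1, weightedNorm_of_isSmoothedField hd hτ hp hF]
  refine le_antisymm ?_ (le_iInf₂ fun F hF => (h1 F hF).ge)
  -- If the norm is infinite, the remaining inequality is trivial; otherwise an admissible field
  -- exists and realises it.
  by_cases hfin : angularNorm (beta d τ θ) (u 0) = ∞
  · rw [hfin]
    simp
  · obtain ⟨F, hF⟩ := exists_isSmoothedField hd hτ hp hfin
    exact (iInf₂_le F hF).trans (h1 F hF).le

end Truncation

end AngularSmoothing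

namespace AngularSmoothing

open MeasureTheory
open scoped FourierTransform ENNReal ComplexConjugate

variable {d : ℕ}

/-! ### Nontriviality of each degree and the case of equality. -/

section Extremisers

/-- Powers of an isotropic linear form are harmonic. -/
theorem isSolidHarmonic_pow (c : Fin d → ℂ) (hc : ∑ i, c i ^ 2 = 0) (k : ℕ) :
    IsSolidHarmonic k ((∑ i, MvPolynomial.C (c i) * MvPolynomial.X i) ^ k) := by
  set L : MvPolynomial (Fin d) ℂ := ∑ i, MvPolynomial.C (c i) * MvPolynomial.X i with hL
  have h1 : L.IsHomogeneous 1 := by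
    refine MvPolynomial.IsHomogeneous.sum _ _ _ fun i _ => ?_
    simpa using (MvPolynomial.isHomogeneous_C (Fin d) (c i)).mul (MvPolynomial.isHomogeneous_X ℂ i)
  have h2 : ∀ i, MvPolynomial.pderiv i L = MvPolynomial.C (c i) := by
    intro i
    rw [hL, map_sum, Finset.sum_eq_single i]
    · simp
    · intro j _ hj
      simp [MvPolynomial.pderiv_X_of_ne hj]
    · simp
  refine ⟨by simpa using h1.pow k, ?_⟩
  have h3 : ∀ i, MvPolynomial.pderiv i (MvPolynomial.pderiv i (L ^ k)) =
      MvPolynomial.C (c i ^ 2) * ((k : MvPolynomial (Fin d) ℂ) *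
        (((k - 1 : ℕ) : MvPolynomial (Fin d) ℂ) * L ^ (k - 1 - 1))) := by
    intro i
    rw [MvPolynomial.pderiv_pow, h2, Derivation.leibniz, Derivation.leibniz, MvPolynomial.pderiv_pow, h2]
    simp only [MvPolynomial.pderiv_C, Derivation.map_natCast, smul_eq_mul, map_pow]
    ring
  simp_rw [h3]
  rw [← Finset.sum_mul, ← map_sum, hc, map_zero, zero_mul]

theorem exists_ne_zero_mem_harmonicSpace (hd : 2 ≤ d) (k : ℕ) :
    ∃ f ∈ harmonicSpace d k, f ≠ 0 := by
  let i₀ : Fin d := ⟨0, by omega⟩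
  let i₁ : Fin d := ⟨1, by omega⟩
  have hne : i₀ ≠ i₁ := by simp [i₀, i₁]
  -- The linear form x₀ + i x₁ is isotropic because 1 + i² = 0; two coordinates are available since
  -- d ≥ 2.
  let c : Fin d → ℂ := fun i => if i = i₀ then 1 else if i = i₁ then Complex.I else 0
  have hc : ∑ i, c i ^ 2 = 0 := by
    rw [← Finset.sum_subset (Finset.subset_univ {i₀, i₁}), Finset.sum_pair hne]
    · simp [c, hne.symm]
    · intro i _ hi
      simp only [Finset.mem_insert, Finset.mem_singleton, not_or] at hi
      simp [c, hi.1, hi.2]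
  have hP := isSolidHarmonic_pow c hc k
  set P : MvPolynomial (Fin d) ℂ := (∑ i, MvPolynomial.C (c i) * MvPolynomial.X i) ^ k with hPdef
  refine ⟨gaussianL2 P one_pos, gaussianL2_mem_harmonicSpace hd hP one_pos, fun h0 => ?_⟩
  have h1 : (fun ξ : Space d => evalAt P ξ * gaussianWave ((1 : ℝ) : ℂ) 0 0 ξ) =ᵐ[volume] 0 :=
    (coeFn_gaussianL2 P one_pos).symm.trans ((Lp.eq_zero_iff_ae_eq_zero).1 h0)
  have h2 := (Continuous.ae_eq_iff_eq volume ((continuous_evalAt P).mul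
    (continuous_gaussianWave _ _ _)) continuous_zero).1 h1
  have h3 := congrFun h2 (EuclideanSpace.single i₀ 1)
  rw [Pi.mul_apply, gaussianWave_zero] at h3
  have h4 : evalAt P (EuclideanSpace.single i₀ (1 : ℝ) : Space d) = 1 := by
    rw [hPdef, evalAt_pow, evalAt_sum, Finset.sum_eq_single i₀]
    · simp [c]
    · intro i _ hi
      simp [hi]
    · simp
  rw [h4, one_mul, Pi.zero_apply, Complex.ofReal_eq_zero] at h3
  exact (Real.exp_pos _).ne' h3

theorem mem_harmonicSum_iff (hd : 2 ≤ d) (S : Set ℕ) (f : L2 d) :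
    f ∈ harmonicSum d S ↔ ∀ k ∉ S, harmonicProj d k f = 0 :=
  mem_closure_iSup_iff (harmonicSpace_isOrtho hd) (harmonicSpace_total hd) S f

/-- A strict inequality in one term would survive summation, provided that the smaller sum is
finite. -/
theorem eq_of_tsum_eq {f g : ℕ → ℝ≥0∞} (hfg : ∀ k, f k ≤ g k) (hf : ∑' k, f k ≠ ∞)
    (h : ∑' k, f k = ∑' k, g k) (k : ℕ) : f k = g k := by
  by_contra hne
  exact (ENNReal.tsum_lt_tsum hf hfg (lt_of_le_of_ne (hfg k) hne)).ne h

theorem enorm_sq_ne_top (f : L2 d) : ‖f‖ₑ ^ 2 ≠ ∞ := ENNReal.pow_ne_top enorm_ne_top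

theorem tsum_beta_of_mem_harmonicSpace (hd : 2 ≤ d) (τ : ℝ) (θ : ℝ → ℂ) {k : ℕ} {f : L2 d}
    (hf : f ∈ harmonicSpace d k) :
    ∑' j, beta d τ θ j * ‖harmonicProj d j f‖ₑ ^ 2 = beta d τ θ k * ‖f‖ₑ ^ 2 := by
  have hf' := Submodule.le_topologicalClosure _ hf
  rw [tsum_eq_single k, show harmonicProj d k f = f from closureProj_of_mem hf']
  intro j hj
  rw [show harmonicProj d j f = 0 from closureProj_of_mem_ne (harmonicSpace_isOrtho hd) hj.symm hf']
  simp

theorem tsum_mul_enorm_sq (hd : 2 ≤ d) (c : ℝ≥0∞) (f : L2 d) :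
    ∑' k, c * ‖harmonicProj d k f‖ₑ ^ 2 = c * ‖f‖ₑ ^ 2 := by
  rw [ENNReal.tsum_mul_left, ← enorm_sq_eq_tsum_harmonicProj hd]

theorem tsum_beta_eq_of_harmonicProj_eq_zero (hd : 2 ≤ d) {τ : ℝ} {θ : ℝ → ℂ} {c : ℝ≥0∞} {f : L2 d}
    (h : ∀ k, c ≠ beta d τ θ k → harmonicProj d k f = 0) :
    ∑' k, beta d τ θ k * ‖harmonicProj d k f‖ₑ ^ 2 = c * ‖f‖ₑ ^ 2 := by
  rw [← tsum_mul_enorm_sq hd]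
  refine tsum_congr fun k => ?_
  by_cases hk : c = beta d τ θ k
  · rw [hk]
  · simp [h k hk]

theorem harmonicProj_eq_zero_of_mul_eq {a b : ℝ≥0∞} {k : ℕ} {f : L2 d} (hab : a ≠ b)
    (h : a * ‖harmonicProj d k f‖ₑ ^ 2 = b * ‖harmonicProj d k f‖ₑ ^ 2) :
    harmonicProj d k f = 0 := by
  by_contra h0
  refine hab ((ENNReal.mul_left_inj (pow_ne_zero 2 ?_) (enorm_sq_ne_top _)).1 h)
  simpa using h0

end Extremisers

end AngularSmoothing

theorem theorem1p1 (d : ℕ) (hd : 2 ≤ d) (τ : ℝ) (hτ : τ ∈ Set.Ioo (1 : ℝ) (d : ℝ))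
    (φ ψ : ℝ → ℝ) (θ : ℝ → ℂ)
    (hφ_inj : Set.InjOn φ (Set.Ioi 0))
    (hφ_diff : DifferentiableOn ℝ φ (Set.Ioi 0))
    (hφ_deriv : ∀ᵐ ρ ∂(MeasureTheory.volume.restrict (Set.Ioi (0 : ℝ))), deriv φ ρ ≠ 0)
    (hψ_meas : AEMeasurable ψ (MeasureTheory.volume.restrict (Set.Ioi (0 : ℝ))))
    (hψ : ∀ ρ : ℝ, 0 < ρ → ψ ρ ^ 2 = |deriv φ ρ| * ρ ^ (1 - τ)) :
    -- the weighted integral does not depend on the function representing `ψ(|∇|) θ(-Λ) u`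
    (∀ u : ℝ → AngularSmoothing.L2 d, AngularSmoothing.IsSolution φ u →
      ∀ F : ℝ → AngularSmoothing.Space d → ℂ, AngularSmoothing.IsSmoothedField τ φ ψ θ u F →
        AngularSmoothing.weightedIntegral τ F = AngularSmoothing.smoothingEnergy τ φ ψ θ u) ∧
    -- the two bounds
    (∀ u : ℝ → AngularSmoothing.L2 d, AngularSmoothing.IsSolution φ u →
      (⨅ k, AngularSmoothing.beta d τ θ k) * ‖u 0‖ₑ ^ 2 ≤
          AngularSmoothing.smoothingEnergy τ φ ψ θ u ∧
        AngularSmoothing.smoothingEnergy τ φ ψ θ u ≤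
          (⨆ k, AngularSmoothing.beta d τ θ k) * ‖u 0‖ₑ ^ 2) ∧
    -- optimality of both constants
    (∀ c : ENNReal,
      (∀ u : ℝ → AngularSmoothing.L2 d, AngularSmoothing.IsSolution φ u →
        c * ‖u 0‖ₑ ^ 2 ≤ AngularSmoothing.smoothingEnergy τ φ ψ θ u) →
      c ≤ (⨅ k, AngularSmoothing.beta d τ θ k)) ∧
    (∀ C : ENNReal,
      (∀ u : ℝ → AngularSmoothing.L2 d, AngularSmoothing.IsSolution φ u →
        AngularSmoothing.smoothingEnergy τ φ ψ θ u ≤ C * ‖u 0‖ₑ ^ 2) →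
      (⨆ k, AngularSmoothing.beta d τ θ k) ≤ C) ∧
    -- extremisers
    (∀ u : ℝ → AngularSmoothing.L2 d, AngularSmoothing.IsSolution φ u → u 0 ≠ 0 →
      (AngularSmoothing.IsLowerExtremiser τ φ ψ θ u ↔
          u 0 ∈ AngularSmoothing.harmonicSum d (AngularSmoothing.lowerIndexSet d τ θ)) ∧
        (AngularSmoothing.IsUpperExtremiser τ φ ψ θ u ↔
          u 0 ∈ AngularSmoothing.harmonicSum d (AngularSmoothing.upperIndexSet d τ θ))) := by
  open AngularSmoothing in
  have hp : IsSmoothingPair τ φ ψ := ⟨hφ_inj, hφ_diff, hφ_deriv, hψ_meas, hψ⟩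
  have hE := smoothingEnergy_eq hd hτ hp θ
  refine ⟨fun u _ F hF => ?_, fun u _ => ⟨?_, ?_⟩, fun c hc => le_iInf fun k => ?_,
    fun C hC => iSup_le fun k => ?_, fun u _ hu0 => ⟨⟨?_, ?_⟩, ⟨?_, ?_⟩⟩⟩
  · rw [hE, ← angularNorm_sq, ← weightedNorm_sq hF.1, weightedNorm_of_isSmoothedField hd hτ hp hF]
  · rw [hE, ← tsum_mul_enorm_sq hd]
    exact ENNReal.tsum_le_tsum fun k => mul_le_mul_left (iInf_le _ k) _
  · rw [hE, ← tsum_mul_enorm_sq hd]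
    exact ENNReal.tsum_le_tsum fun k => mul_le_mul_left (le_iSup (beta d τ θ) k) _
  -- Data in 𝔥_k have energy exactly β_k ‖u(0)‖², so testing every k bounds c by the infimum.
  · obtain ⟨f, hf, hf0⟩ := exists_ne_zero_mem_harmonicSpace hd k
    obtain ⟨u, hu, rfl⟩ := exists_isSolution hd hp f
    have h1 := hc u hu
    rw [hE, tsum_beta_of_mem_harmonicSpace hd τ θ hf] at h1
    exact (ENNReal.mul_le_mul_iff_left (pow_ne_zero 2 (by simpa using hf0)) (enorm_sq_ne_top _)).1 h1
  · obtain ⟨f, hf, hf0⟩ := exists_ne_zero_mem_harmonicSpace hd k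
    obtain ⟨u, hu, rfl⟩ := exists_isSolution hd hp f
    have h1 := hC u hu
    rw [hE, tsum_beta_of_mem_harmonicSpace hd τ θ hf] at h1
    exact (ENNReal.mul_le_mul_iff_left (pow_ne_zero 2 (by simpa using hf0)) (enorm_sq_ne_top _)).1 h1
  · rintro ⟨-, hfin, heq⟩
    rw [mem_harmonicSum_iff hd]
    intro k hk
    -- Termwise comparison needs the smaller series to be finite: here it is the one with the
    -- infimum, in the upper case the one with the β_k.
    rw [heq, ← tsum_mul_enorm_sq hd] at hfin
    rw [hE, ← tsum_mul_enorm_sq hd] at heq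
    exact harmonicProj_eq_zero_of_mul_eq hk (eq_of_tsum_eq
      (fun k => mul_le_mul_left (iInf_le (beta d τ θ) k) _) hfin.ne heq.symm k)
  · intro h
    rw [mem_harmonicSum_iff hd] at h
    have h1 : smoothingEnergy τ φ ψ θ u = (⨅ k, beta d τ θ k) * ‖u 0‖ₑ ^ 2 := by
      rw [hE]
      exact tsum_beta_eq_of_harmonicProj_eq_zero hd fun k hk => h k hk
    refine ⟨hu0, ?_, h1⟩
    -- exact ENNReal.mul_lt_top ((iInf_le _ 0)
    rw [h1]
    exact ENNReal.mul_lt_top ((iInf_le _ 0).trans_lt (beta_ne_top τ θ 0).lt_top)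
      (enorm_sq_ne_top _).lt_top
  · rintro ⟨-, hfin, heq⟩
    rw [mem_harmonicSum_iff hd]
    intro k hk
    rw [hE] at hfin
    rw [hE, ← tsum_mul_enorm_sq hd] at heq
    exact harmonicProj_eq_zero_of_mul_eq (Ne.symm hk) (eq_of_tsum_eq
      (fun k => mul_le_mul_left (le_iSup (beta d τ θ) k) _) hfin.ne heq k)
  · intro h
    rw [mem_harmonicSum_iff hd] at h
    have h1 : smoothingEnergy τ φ ψ θ u = (⨆ k, beta d τ θ k) * ‖u 0‖ₑ ^ 2 := by
      rw [hE]
      exact tsum_beta_eq_of_harmonicProj_eq_zero hd fun k hk => h k hk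
    refine ⟨hu0, ?_, h1⟩
    -- If the supremum were not attained, all components of u(0) would vanish. As u(0) ≠ 0, it
    -- equals some β_k and is therefore finite.
    have h2 : ∃ k, (⨆ l, beta d τ θ l) = beta d τ θ k := by
      by_contra! h3
      refine hu0 ((hasSum_harmonicProj hd (u 0)).unique ?_)
      simp_rw [fun k => h k (h3 k)]
      exact hasSum_zero
    obtain ⟨k, hk⟩ := h2
    rw [h1, hk]
    exact ENNReal.mul_lt_top (beta_ne_top τ θ k).lt_top (enorm_sq_ne_top _).lt_top
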